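/- Let $k$ be an algebraically closed field of characteristic $0$. Let $C$ be a generalized Cartan matrix indexed by a finite set $I$, with minimal realization $(H,\{h_i\},\{\alpha_i\})$, $\alpha_j(h_i)=C_{ij}$, and let $d_i\in k\setminus\{0\}$ be such that $d_iC_{ij}=d_jC_{ji}$ for all $i,j$. The Kac–Moody algebra $L(C)$ is the quotient of the Lie algebra generated by $e_i,f_i$ ($i\in I$) and $\tilde h$ ($h\in H$), with $h\mapsto\tilde h$ linear, $[\tilde x,\tilde y]=0$, $[e_i,f_j]=\delta_{ij}\tilde h_i$, $[\tilde x,e_i]=\alpha_i(x)e_i$, $[\tilde x,f_i]=-\alpha_i(x)f_i$, by its largest ideal meeting $\{\tilde h\}$ trivially. The Kac–Moody bialgebra $L(C)$ has the cobracket $\delta$ which is a 1-cocycle with $\delta e_i=\frac{d_i}{2}e_i\wedge\tilde h_i$, $\delta f_i=\frac{d_i}{2}f_i\wedge\tilde h_i$, $\delta\tilde h=0$. Let $C'$, indexed by a finite set $J$, be another generalized Cartan matrix with minimal realization $(H',\{h'_j\},\{\alpha'_j\})$, forming a sub-root datum via $\iota$: that is, $\iota:J\to I$ is injective, $C'_{ij}=C_{\iota(i)\iota(j)}$,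 and there is an injective linear map $s:H'\to H$ with $s(h'_j)=h_{\iota(j)}$ and $\alpha_{\iota(j)}\circ s=\alpha'_j$. The Kac–Moody bialgebra $L(C')$ is formed with the scalars $d_{\iota(j)}$. Put $D=I\setminus\iota(J)$ with indicator function $\chi_D$. Let $L^\sharp(C')\subseteq L(C)$ be the Lie subalgebra generated by $e_{\iota(j)},f_{\iota(j)}$ ($j\in J$) and all $\tilde h$ ($h\in H$). Let $B^-(C)\subseteq L(C)$ be the Lie subalgebra generated by all $f_i$ and $\tilde h$, with the $\mathbb N$-grading $\deg f_i=\chi_D(i)$, $\deg\tilde h=0$; let $\pi$ be the projection of $B^-(C)$ onto its degree-$0$ part, and $\mathfrak b=\ker\pi$, with the bracket of $L(C)$, the adjoint action of $L^\sharp(C')$, and the braided cobracket $\underline\delta=(\mathrm{id}-\pi)^{\otimes2}\circ\delta$. Let $\mathfrak b^*$ be the graded dual of $\mathfrak b$ with respect to its root-space decomposition. Then $\delta$ exists and makes $L(C)$ (and likewise $L(C')$) a Lie bialgebra, and: 1. $L(C)$ is $\mathbb Z$-graded by $\deg e_i=\chi_D(i)$, $\deg f_i=-\chi_D(i)$, $\deg\tilde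 h=0$. Its degree-$0$ part is $L^\sharp(C')$, which is a Lie sub-bialgebra and a central extension of $L(C')$: there is a surjective homomorphism of Lie bialgebras $L^\sharp(C')\to L(C')$ with central kernel, sending $e_{\iota(j)}\mapsto e_j$, $f_{\iota(j)}\mapsto f_j$. 2. $L^\sharp(C')$ is formally quasitriangular: there is a (possibly infinite) formal sum $r=\sum_\beta r_\beta$ over $\beta\in\bigoplus_{i\in I}\mathbb N\alpha_i$, with $r_\beta\in L^\sharp(C')_\beta\otimes L^\sharp(C')_{-\beta}$ (root spaces), satisfying $\delta\xi=\mathrm{ad}_\xi r$ (after evaluation on functionals in the graded dual) and $(\mathrm{id}\otimes\delta)r=[r_{13},r_{12}]$ (in each degree of the first tensor factor). 3. With respect to some such $r$, $\mathfrak b$ and $\mathfrak b^*$ are dually paired braided-Lie bialgebras in the category of $L^\sharp(C')$-modules; explicitly, with $2r_+=r+\tau(r)$ and $\triangleright$ the action, the bracket and cobracket are $L^\sharp(C')$-equivariant Lie algebra and Lie coalgebra structures with $\underline\delta[x,y]=\mathrm{ad}_x\underline\delta y-\mathrm{ad}_y\underline\delta x-2r_+\triangleright(x\otimes y-y\otimes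 x)$, and the structures of $\mathfrak b^*$ are dual to those of $\mathfrak b$ under evaluation $\langle\ ,\ \rangle$. The coaction $x\mapsto r^{(2)}\otimes r^{(1)}\triangleright x$ on $\mathfrak b$ equals $(\pi\otimes\mathrm{id})\circ\delta$. 4. $L(C)\cong\mathfrak b\rtimes L^\sharp(C')\ltimes\mathfrak b^{*\mathrm{op}}$ as Lie bialgebras, where the right-hand side is the double-bosonisation: the vector space $\mathfrak b\oplus L^\sharp(C')\oplus\mathfrak b^*$ in which $L^\sharp(C')$ is a Lie sub-bialgebra, $\mathfrak b$ and $\mathfrak b^{*\mathrm{op}}$ (opposite bracket) are Lie subalgebras, and for $x\in\mathfrak b$, $\xi\in L^\sharp(C')$, $\phi\in\mathfrak b^*$ (with $\underline\delta x=x_{(1)}\otimes x_{(2)}$, and similarly for $\phi$), $$[\xi,x]=\xi\triangleright x,\qquad [\xi,\phi]=\xi\triangleright\phi,\qquad [x,\phi]=x_{(1)}\langle\phi,x_{(2)}\rangle+\phi_{(1)}\langle\phi_{(2)},x\rangle+2r_+^{(1)}\langle\phi,r_+^{(2)}\triangleright x\rangle,$$ $$\delta x=\underline\delta x+r^{(2)}\otimes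 r^{(1)}\triangleright x-r^{(1)}\triangleright x\otimes r^{(2)},\qquad \delta\phi=\underline\delta\phi+r^{(2)}\triangleright\phi\otimes r^{(1)}-r^{(1)}\otimes r^{(2)}\triangleright\phi,$$ all sums over $\beta$ here being finite. The isomorphism is the inclusion on $\mathfrak b$ and on $L^\sharp(C')$, and carries $\mathfrak b$ and $\mathfrak b^*$ onto the sums of the homogeneous components of $L(C)$ of negative and of positive degree respectively. (For $J=\emptyset$ this is the triangular decomposition of $L(C)$.) -/

import Mathlib

open scoped TensorProduct

noncomputable section

/-! ### Lie coalgebras and Lie bialgebras -/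

namespace LieBi

section Basic

variable {k : Type*} [Field k]

/-- `a ∧ b = a ⊗ b - b ⊗ a`. -/
def wedge {V : Type*} [AddCommGroup V] [Module k V] (a b : V) : V ⊗[k] V :=
  a ⊗ₜ[k] b - b ⊗ₜ[k] a

/-- Cyclic rotation `(a ⊗ b) ⊗ c ↦ (b ⊗ c) ⊗ a`. -/
def cyc (k V : Type*) [Field k] [AddCommGroup V] [Module k V] :
    (V ⊗[k] V) ⊗[k] V →ₗ[k] (V ⊗[k] V) ⊗[k] V :=
  (TensorProduct.comm k V (V ⊗[k] V)).toLinearMap ∘ₗ (TensorProduct.assoc k V V V).toLinearMap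

/-- `(V, δ)` is a Lie coalgebra: `δ + τ ∘ δ = 0` and `(δ ⊗ id) ∘ δ + cyclic = 0`. -/
structure IsLieCoalgebra {V : Type*} [AddCommGroup V] [Module k V] (δ : V →ₗ[k] V ⊗[k] V) :
    Prop where
  anticocomm : ∀ x, δ x + TensorProduct.comm k V V (δ x) = 0
  coJacobi : ∀ x,
    TensorProduct.map δ LinearMap.id (δ x)
      + cyc k V (TensorProduct.map δ LinearMap.id (δ x))
      + cyc k V (cyc k V (TensorProduct.map δ LinearMap.id (δ x))) = 0

/-- `(g, [,], δ)` is a Lie bialgebra. Here `⁅x, t⁆` for `t ∈ g ⊗ g` is the adjoint action extended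
to the tensor square as a derivation. -/
structure IsLieBialgebra {g : Type*} [LieRing g] [LieAlgebra k g] (δ : g →ₗ[k] g ⊗[k] g) :
    Prop where
  coalgebra : IsLieCoalgebra δ
  cocycle : ∀ x y, δ ⁅x, y⁆ = ⁅x, δ y⁆ - ⁅y, δ x⁆

/-- `δ₀` is the restriction of the cobracket `δ` of `g` to the Lie subalgebra `s`; its existence
says `δ s ⊆ s ⊗ s`, and it is then unique. -/
def IsRestrictedCobracket {g : Type*} [LieRing g] [LieAlgebra k g] (δ : g →ₗ[k] g ⊗[k] g)
    (s : LieSubalgebra k g) (δ₀ : s →ₗ[k] s ⊗[k] s) : Prop :=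
  ∀ x : s, TensorProduct.map s.toSubmodule.subtype s.toSubmodule.subtype (δ₀ x) = δ (x : g)

/-- `f` intertwines the cobrackets `δ` and `δ'`. -/
def IsCobracketHom {V W : Type*} [AddCommGroup V] [Module k V] [AddCommGroup W] [Module k W]
    (δ : V →ₗ[k] V ⊗[k] V) (δ' : W →ₗ[k] W ⊗[k] W) (f : V →ₗ[k] W) : Prop :=
  ∀ x, TensorProduct.map f f (δ x) = δ' (f x)

/-- The graded dual of `V = ⨁ 𝒜 i`: the functionals that vanish on all but finitely many `𝒜 i`. -/
def gradedDual {σ V : Type*} [AddCommGroup V] [Module k V] (𝒜 : σ → Submodule k V) :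
    Submodule k (Module.Dual k V) where
  carrier := {φ | {i | ∃ x ∈ 𝒜 i, φ x ≠ 0}.Finite}
  zero_mem' := by simp
  add_mem' := by
    intro φ ψ hφ hψ
    refine (Set.Finite.union hφ hψ).subset ?_
    rintro i ⟨x, hx, hne⟩
    by_cases h : φ x = 0
    · exact Or.inr ⟨x, hx, fun h' => hne (by simp [h, h'])⟩
    · exact Or.inl ⟨x, hx, h⟩
  smul_mem' := by
    intro c φ hφ
    refine Set.Finite.subset hφ ?_
    rintro i ⟨x, hx, hne⟩
    exact ⟨x, hx, fun h' => hne (by simp [h'])⟩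

/-- The functional `φ ⊗ ψ` on `V ⊗ W`. -/
def tensorDual {V W : Type*} [AddCommGroup V] [Module k V] [AddCommGroup W] [Module k W]
    (φ : Module.Dual k V) (ψ : Module.Dual k W) : Module.Dual k (V ⊗[k] W) :=
  (TensorProduct.lid k k).toLinearMap ∘ₗ TensorProduct.map φ ψ

/-- The operator `T ⊗ id + id ⊗ T`. -/
def tensorDer {V : Type*} [AddCommGroup V] [Module k V] (T : Module.End k V) :
    Module.End k (V ⊗[k] V) :=
  TensorProduct.map T LinearMap.id + TensorProduct.map LinearMap.id T

/-- The grading of a Lie algebra generated by homogeneous generators: `S m x` says that `x` is a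
generator of degree `m`, and `GenDegree k S m` is the least family of subspaces that contains the
generators and satisfies `[g_m, g_n] ⊆ g_{m+n}`. -/
inductive GenDegree (k : Type*) {g M : Type*} [Field k] [LieRing g] [LieAlgebra k g] [AddMonoid M]
    (S : M → g → Prop) : M → g → Prop
  | gen (m : M) (x : g) : S m x → GenDegree k S m x
  | zero (m : M) : GenDegree k S m 0
  | add (m : M) (x y : g) : GenDegree k S m x → GenDegree k S m y → GenDegree k S m (x + y)
  | smul (m : M) (c : k) (x : g) : GenDegree k S m x → GenDegree k S m (c • x)
  | lie (m n : M) (x y : g) :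
      GenDegree k S m x → GenDegree k S n y → GenDegree k S (m + n) ⁅x, y⁆

/-- The degree-`m` subspace of the grading generated by `S`. -/
def genGrading (k : Type*) {g M : Type*} [Field k] [LieRing g] [LieAlgebra k g] [AddMonoid M]
    (S : M → g → Prop) (m : M) : Submodule k g where
  carrier := {x | GenDegree k S m x}
  zero_mem' := GenDegree.zero m
  add_mem' := fun hx hy => GenDegree.add m _ _ hx hy
  smul_mem' := fun c _ hx => GenDegree.smul m c _ hx

/-- `π` is the projection of an `ℕ`-graded space onto its degree-`0` part (viewed as an
endomorphism): the identity in degree `0` and zero in positive degrees. -/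
structure IsDegreeZeroProjection {V : Type*} [AddCommGroup V] [Module k V]
    (𝒜 : ℕ → Submodule k V) (π : V →ₗ[k] V) : Prop where
  id_on_zero : ∀ x ∈ 𝒜 0, π x = x
  zero_on_pos : ∀ n, 0 < n → ∀ x ∈ 𝒜 n, π x = 0

end Basic

/-! ### Formal quasitriangular structures -/

section Quasitriangular

variable {k : Type*} [Field k] {g : Type*} [LieRing g] [LieAlgebra k g]

/-- The bracket as a linear map `g ⊗ g → g`. -/
def bracketMap (k g : Type*) [Field k] [LieRing g] [LieAlgebra k g] : g ⊗[k] g →ₗ[k] g :=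
  (LieModule.toModuleHom k g g : g ⊗[k] g →ₗ[k] g)

/-- For `t = a ⊗ b` and `t' = c ⊗ d`, the element `[t₁₃, t'₁₂] = [a, c] ⊗ d ⊗ b`. -/
def bracket1312 (t t' : g ⊗[k] g) : g ⊗[k] (g ⊗[k] g) :=
  TensorProduct.map (bracketMap k g) (TensorProduct.comm k g g).toLinearMap
    (TensorProduct.tensorTensorTensorComm k g g g g (t ⊗ₜ[k] t'))

/-- Inclusion of `Q₊ = ⨁ ℕ αᵢ` in `Q = ⨁ ℤ αᵢ`. -/
def toInt {σ : Type*} (β : σ →₀ ℕ) : σ →₀ ℤ := β.mapRange (fun n : ℕ => (n : ℤ)) (by simp)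

/-- A formal ("pseudo-") quasitriangular structure on a Lie bialgebra `(g, δ)` graded as a Lie
algebra by `Q = ⨁ ℤ αᵢ`, `g = ⨁ 𝒜 γ`. It is a possibly infinite formal sum `r = ∑ r_β`
over `β ∈ Q₊ = ⨁ ℕ αᵢ` with `r_β ∈ g_β ⊗ g_{-β}`, such that

* `δ ξ = ad_ξ r` holds formally, i.e. after evaluation on any two functionals in the graded dual
  of `g` (only finitely many `β` then contribute);
* `(id ⊗ δ) r = [r₁₃, r₁₂]` holds formally, i.e. in each degree `β` of the first tensor factor.

When only finitely many `r_β` are nonzero these are the usual axioms for `r = ∑ r_β ∈ g ⊗ g`. -/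
structure IsFormallyQuasitriangular {σ : Type*} [DecidableEq σ] (𝒜 : (σ →₀ ℤ) → Submodule k g)
    (δ : g →ₗ[k] g ⊗[k] g) (r : (σ →₀ ℕ) → g ⊗[k] g) : Prop where
  isLieBialgebra : IsLieBialgebra δ
  isInternal : DirectSum.IsInternal 𝒜
  lie_mem : ∀ γ γ' x y, x ∈ 𝒜 γ → y ∈ 𝒜 γ' → ⁅x, y⁆ ∈ 𝒜 (γ + γ')
  homogeneous : ∀ β, r β ∈ LinearMap.range
    (TensorProduct.map (𝒜 (toInt β)).subtype (𝒜 (-toInt β)).subtype)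
  coboundary : ∀ ξ : g, ∀ φ ∈ gradedDual 𝒜, ∀ ψ ∈ gradedDual 𝒜,
    tensorDual φ ψ (δ ξ) = ∑ᶠ β, tensorDual φ ψ ⁅ξ, r β⁆
  hexagon : ∀ β, TensorProduct.map LinearMap.id δ (r β)
    = ∑ p ∈ Finset.HasAntidiagonal.antidiagonal β, bracket1312 (r p.1) (r p.2)

end Quasitriangular

/-! ### Braided-Lie bialgebras -/

section Braided

variable {k : Type*} [Field k] {g : Type*} [LieRing g] [LieAlgebra k g] {σ : Type*}
variable {V : Type*} [AddCommGroup V] [Module k V]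

/-- For `t = t¹ ⊗ t²`, the operator `a ⊗ b ↦ t¹ ▷ a ⊗ t² ▷ b` on `V ⊗ V`. -/
def actTensor (act : g →ₗ[k] Module.End k V) (t : g ⊗[k] g) : Module.End k (V ⊗[k] V) :=
  TensorProduct.homTensorHomMap (RingHom.id k) V V V V
    (TensorProduct.map act act t)

/-- For `t = t¹ ⊗ t²`, the element `t¹ ⊗ t² ▷ x` of `g ⊗ V`. -/
def actRight (act : g →ₗ[k] Module.End k V) (t : g ⊗[k] g) (x : V) : g ⊗[k] V :=
  TensorProduct.map LinearMap.id (LinearMap.flip act x) t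

/-- For `t = t¹ ⊗ t²`, the element `t² ⊗ t¹ ▷ x` of `g ⊗ V`. -/
def actLeft (act : g →ₗ[k] Module.End k V) (t : g ⊗[k] g) (x : V) : g ⊗[k] V :=
  actRight act (TensorProduct.comm k g g t) x

/-- `2 t₊ = t + τ t`, twice the symmetric part of `t`. -/
def twiceSym (t : g ⊗[k] g) : g ⊗[k] g := t + TensorProduct.comm k g g t

/-- The infinitesimal braiding `ψ(a ⊗ b) = 2 r₊ ▷ (a ⊗ b - b ⊗ a)` for `r = ∑ r_β`. -/
def infBraiding (r : (σ →₀ ℕ) → g ⊗[k] g) (act : g →ₗ[k] Module.End k V) (a b : V) : V ⊗[k] V :=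
  ∑ᶠ β, actTensor act (twiceSym (r β)) (wedge a b)

/-- A braided-Lie bialgebra structure on `V` in the category of `g`-modules, for `g` with the
formal structure `r = ∑ r_β`. -/
structure BraidedLieBialgebra (r : (σ →₀ ℕ) → g ⊗[k] g) (V : Type*) [AddCommGroup V]
    [Module k V] where
  /-- the action `ξ ▷ x` of `g` -/
  act : g →ₗ[k] Module.End k V
  /-- the Lie bracket -/
  br : V →ₗ[k] V →ₗ[k] V
  /-- the braided cobracket -/
  cobr : V →ₗ[k] V ⊗[k] V
  act_lie : ∀ ξ η x, act ⁅ξ, η⁆ x = act ξ (act η x) - act η (act ξ x)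
  br_self : ∀ x, br x x = 0
  jacobi : ∀ x y z, br x (br y z) = br (br x y) z + br y (br x z)
  isLieCoalgebra : IsLieCoalgebra cobr
  act_br : ∀ ξ x y, act ξ (br x y) = br (act ξ x) y + br x (act ξ y)
  cobr_act : ∀ ξ x, cobr (act ξ x) = tensorDer (act ξ) (cobr x)
  /-- the infinite sum defining `r ▷ (x ⊗ y)`, hence that defining the braiding, is finite -/
  finite_braiding : ∀ x y, {β | actTensor act (r β) (x ⊗ₜ[k] y) ≠ 0}.Finite
  cocycle : ∀ x y, cobr (br x y)
    = tensorDer (br x) (cobr y) - tensorDer (br y) (cobr x) - infBraiding r act x y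

/-- `c` (on `W`) and `b` (on `V`) are dually paired braided-Lie bialgebras through the bilinear map
`p : (φ, x) ↦ ⟨φ, x⟩`, which is a morphism of `g`-modules. -/
structure IsDuallyPaired {W : Type*} [AddCommGroup W] [Module k W]
    {r : (σ →₀ ℕ) → g ⊗[k] g} (b : BraidedLieBialgebra r V) (c : BraidedLieBialgebra r W)
    (p : W →ₗ[k] V →ₗ[k] k) : Prop where
  invariant : ∀ ξ φ x, p (c.act ξ φ) x + p φ (b.act ξ x) = 0
  br_cobr : ∀ φ ψ x, p (c.br φ ψ) x = tensorDual (p φ) (p ψ) (b.cobr x)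
  cobr_br : ∀ φ x y, tensorDual (p.flip x) (p.flip y) (c.cobr φ) = p φ (b.br x y)

/-! ### Double-bosonisation -/

/-- `id ⊗ f`, read as a map `U ⊗ V → U`. -/
def idTensor {U : Type*} [AddCommGroup U] [Module k U] (f : Module.Dual k V) :
    U ⊗[k] V →ₗ[k] U :=
  (TensorProduct.rid k U).toLinearMap ∘ₗ TensorProduct.map LinearMap.id f

section Double

variable {W : Type*} [AddCommGroup W] [Module k W] {r : (σ →₀ ℕ) → g ⊗[k] g}

/-- The component `2 r₊¹ ⟨φ, r₊² ▷ x⟩` in `g` of `[x, φ]`. -/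
def mixed (b : BraidedLieBialgebra r V) (p : W →ₗ[k] V →ₗ[k] k) (x : V) (φ : W) : g :=
  ∑ᶠ β, idTensor (p φ) (actRight b.act (twiceSym (r β)) x)

/-- The bracket of the double-bosonisation on `b ⊕ g ⊕ c`: `b`, `g` and `c` with the opposite
bracket are subalgebras, `[ξ, x] = ξ ▷ x`, `[ξ, φ] = ξ ▷ φ`, and
`[x, φ] = x₁ ⟨φ, x₂⟩ + φ₁ ⟨φ₂, x⟩ + 2 r₊¹ ⟨φ, r₊² ▷ x⟩`. -/
def dbBracket (b : BraidedLieBialgebra r V) (c : BraidedLieBialgebra r W)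
    (p : W →ₗ[k] V →ₗ[k] k) (u v : V × g × W) : V × g × W :=
  let x := u.1
  let ξ := u.2.1
  let φ := u.2.2
  let y := v.1
  let η := v.2.1
  let χ := v.2.2
  ( b.br x y + b.act ξ y - b.act η x
      + idTensor (p χ) (b.cobr x) - idTensor (p φ) (b.cobr y),
    ⁅ξ, η⁆ + mixed b p x χ - mixed b p y φ,
    -c.br φ χ + c.act ξ χ - c.act η φ
      + idTensor (p.flip x) (c.cobr χ) - idTensor (p.flip y) (c.cobr φ) )

/-- The cobracket of the double-bosonisation on `b ⊕ g ⊕ c`: that of `g` on `g`, and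
`δ x = δ_b x + r² ⊗ r¹ ▷ x - r¹ ▷ x ⊗ r²`, `δ φ = δ_c φ + r² ▷ φ ⊗ r¹ - r¹ ⊗ r² ▷ φ`. -/
def dbCobracket (δ : g →ₗ[k] g ⊗[k] g) (b : BraidedLieBialgebra r V)
    (c : BraidedLieBialgebra r W) (u : V × g × W) : (V × g × W) ⊗[k] (V × g × W) :=
  let inV : V →ₗ[k] V × g × W := LinearMap.inl k V (g × W)
  let inG : g →ₗ[k] V × g × W := LinearMap.inr k V (g × W) ∘ₗ LinearMap.inl k g W
  let inW : W →ₗ[k] V × g × W := LinearMap.inr k V (g × W) ∘ₗ LinearMap.inr k g W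
  let rx : g ⊗[k] V := ∑ᶠ β, actLeft b.act (r β) u.1
  let rφ : g ⊗[k] W := ∑ᶠ β, actRight c.act (r β) u.2.2
  TensorProduct.map inV inV (b.cobr u.1)
    + TensorProduct.map inG inV rx
    - TensorProduct.map inV inG (TensorProduct.comm k g V rx)
    + TensorProduct.map inG inG (δ u.2.1)
    + TensorProduct.map inW inW (c.cobr u.2.2)
    + TensorProduct.map inW inG (TensorProduct.comm k g W rφ)
    - TensorProduct.map inG inW rφ

/-- `Φ` is an isomorphism of Lie bialgebras from the double-bosonisation of `g` by `b` and `c`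
(paired by `p`) onto the Lie bialgebra `(L, δL)`, all the infinite sums in the definition of the
double-bosonisation being finite. -/
structure IsDoubleBosonisationIso {L : Type*} [LieRing L] [LieAlgebra k L]
    (δ : g →ₗ[k] g ⊗[k] g) (b : BraidedLieBialgebra r V) (c : BraidedLieBialgebra r W)
    (p : W →ₗ[k] V →ₗ[k] k) (δL : L →ₗ[k] L ⊗[k] L) (Φ : (V × g × W) ≃ₗ[k] L) : Prop where
  finite_left : ∀ x, {β | actLeft b.act (r β) x ≠ 0}.Finite
  finite_right : ∀ φ, {β | actRight c.act (r β) φ ≠ 0}.Finite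
  finite_mixed : ∀ x φ,
    {β | idTensor (p φ) (actRight b.act (twiceSym (r β)) x) ≠ 0}.Finite
  map_bracket : ∀ u v, Φ (dbBracket b c p u v) = ⁅Φ u, Φ v⁆
  map_cobracket : ∀ u,
    TensorProduct.map Φ.toLinearMap Φ.toLinearMap (dbCobracket δ b c u) = δL (Φ u)

end Double

end Braided

end LieBi

/-! ### Kac–Moody algebras -/

namespace KacMoody

open LieBi

/-- Generalized Cartan matrices. -/
structure IsGenCartan {I : Type*} (C : Matrix I I ℤ) : Prop where
  diag : ∀ i, C i i = 2
  offDiag : ∀ i j, i ≠ j → C i j ≤ 0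
  zero_symm : ∀ i j, C i j = 0 → C j i = 0

/-- `C` is a generalized Cartan matrix and `(H, {h_i}, {α_i})` a minimal realization of it. -/
structure RootDatum (k : Type*) [Field k] {I : Type*} [Fintype I] (C : Matrix I I ℤ)
    (H : Type*) [AddCommGroup H] [Module k H] where
  /-- `h_i` -/
  coroot : I → H
  /-- `α_i` -/
  root : I → Module.Dual k H
  isGenCartan : IsGenCartan C
  finite : Module.Finite k H
  finrank_add_rank : Module.finrank k H + (C.map (fun z : ℤ => (z : k))).rank = 2 * Fintype.card I
  coroot_indep : LinearIndependent k coroot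
  root_indep : LinearIndependent k root
  root_coroot : ∀ i j, root j (coroot i) = (C i j : k)

/-- The generators `e_i`, `f_i`, `h̃`. -/
inductive Gen (I H : Type*)
  | e (i : I)
  | f (i : I)
  | h (x : H)

section Algebra

variable {k : Type*} [Field k] {I : Type*} [Fintype I] {C : Matrix I I ℤ}
  {H : Type*} [AddCommGroup H] [Module k H]

/-- A generator as an element of the free Lie algebra. -/
def freeGen (_R : RootDatum k C H) (t : Gen I H) : FreeLieAlgebra k (Gen I H) :=
  FreeLieAlgebra.of k t

/-- The elements set to zero in the presentation of `L̃(C)`. -/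
inductive DefRel (R : RootDatum k C H) : FreeLieAlgebra k (Gen I H) → Prop
  | linear (a b : k) (y z : H) :
      DefRel R (freeGen R (.h (a • y + b • z)) - (a • freeGen R (.h y) + b • freeGen R (.h z)))
  | hh (x y : H) : DefRel R ⁅freeGen R (.h x), freeGen R (.h y)⁆
  | ef_same (i : I) : DefRel R (⁅freeGen R (.e i), freeGen R (.f i)⁆ - freeGen R (.h (R.coroot i)))
  | ef_ne (i j : I) : i ≠ j → DefRel R ⁅freeGen R (.e i), freeGen R (.f j)⁆
  | he (x : H) (i : I) :
      DefRel R (⁅freeGen R (.h x), freeGen R (.e i)⁆ - R.root i x • freeGen R (.e i))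
  | hf (x : H) (i : I) :
      DefRel R (⁅freeGen R (.h x), freeGen R (.f i)⁆ + R.root i x • freeGen R (.f i))

/-- The Lie algebra `L̃(C)`. -/
abbrev TildeL (R : RootDatum k C H) : Type _ :=
  FreeLieAlgebra k (Gen I H) ⧸
    LieSubmodule.lieSpan k (FreeLieAlgebra k (Gen I H)) {x | DefRel R x}

/-- The images of the generators in `L̃(C)`. -/
def tildeGen (R : RootDatum k C H) (t : Gen I H) : TildeL R :=
  LieSubmodule.Quotient.mk (freeGen R t)

/-- The subalgebra `H̃` of `L̃(C)` generated by the `h̃`. -/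
def tildeH (R : RootDatum k C H) : LieSubalgebra k (TildeL R) :=
  LieSubalgebra.lieSpan k (TildeL R) (Set.range fun x : H => tildeGen R (.h x))

/-- The maximal ideal of `L̃(C)` among those meeting `H̃` trivially, as the sum of all of them. -/
def maxIdeal (R : RootDatum k C H) : LieIdeal k (TildeL R) :=
  sSup {𝔞 : LieIdeal k (TildeL R) | ∀ x ∈ 𝔞, x ∈ tildeH R → x = 0}

/-- The Kac–Moody algebra `L(C)`. -/
def Alg (R : RootDatum k C H) : Type _ := TildeL R ⧸ maxIdeal R

instance (R : RootDatum k C H) : LieRing (Alg R) :=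
  inferInstanceAs (LieRing (TildeL R ⧸ maxIdeal R))

instance (R : RootDatum k C H) : LieAlgebra k (Alg R) :=
  inferInstanceAs (LieAlgebra k (TildeL R ⧸ maxIdeal R))

/-- The images of the generators in `L(C)`. -/
def gen (R : RootDatum k C H) (t : Gen I H) : Alg R :=
  (LieSubmodule.Quotient.mk (tildeGen R t) : TildeL R ⧸ maxIdeal R)

/-- `e_i` in `L(C)`. -/
def e (R : RootDatum k C H) (i : I) : Alg R := gen R (.e i)
/-- `f_i` in `L(C)`. -/
def f (R : RootDatum k C H) (i : I) : Alg R := gen R (.f i)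
/-- `h̃` in `L(C)`. -/
def h (R : RootDatum k C H) (x : H) : Alg R := gen R (.h x)

/-- `d` gives the diagonal of a nonsingular diagonal matrix `D` with `D C` symmetric. -/
structure IsSymmetrizer {k : Type*} [Field k] {I : Type*} (C : Matrix I I ℤ) (d : I → k) :
    Prop where
  ne_zero : ∀ i, d i ≠ 0
  symm : ∀ i j, d i * (C i j : k) = d j * (C j i : k)

/-- The cobracket of the Kac–Moody bialgebra: `δ e_i = (d_i/2) e_i ∧ h̃_i`,
`δ f_i = (d_i/2) f_i ∧ h̃_i`, `δ h̃ = 0`, and `δ` is a 1-cocycle. As the generators generate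
`L(C)`, there is at most one such `δ`. -/
structure IsStandardCobracket (R : RootDatum k C H) (d : I → k)
    (δ : Alg R →ₗ[k] Alg R ⊗[k] Alg R) : Prop where
  on_e : ∀ i, δ (e R i) = (d i / 2) • wedge (e R i) (h R (R.coroot i))
  on_f : ∀ i, δ (f R i) = (d i / 2) • wedge (f R i) (h R (R.coroot i))
  on_h : ∀ x, δ (h R x) = 0
  cocycle : ∀ x y, δ ⁅x, y⁆ = ⁅x, δ y⁆ - ⁅y, δ x⁆

/-- The root space of `L(C)` of weight `∑ γ_i α_i`. -/
def rootSpace (R : RootDatum k C H) (γ : I →₀ ℤ) : Submodule k (Alg R) where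
  carrier := {x | ∀ y : H, ⁅h R y, x⁆ = (∑ i, (γ i : k) * R.root i y) • x}
  zero_mem' := by intro y; simp
  add_mem' := by
    intro a b ha hb y
    rw [lie_add, ha y, hb y, smul_add]
  smul_mem' := by
    intro c a ha y
    rw [lie_smul, ha y, smul_comm]

/-- The negative Borel subalgebra `B⁻(C)`, generated by the `f_i` and the `h̃`. -/
def borel (R : RootDatum k C H) : LieSubalgebra k (Alg R) :=
  LieSubalgebra.lieSpan k (Alg R) (Set.range (f R) ∪ Set.range (h R))

end Algebra

/-! ### Sub-root data and the associated objects -/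

section Sub

variable {k : Type*} [Field k] {I J : Type*} [Fintype I] [Fintype J]
  {C : Matrix I I ℤ} {C' : Matrix J J ℤ}
  {H H' : Type*} [AddCommGroup H] [Module k H] [AddCommGroup H'] [Module k H']

/-- `R'` is a sub-root datum of `R` via `ι`. -/
structure IsSubRootDatum (R' : RootDatum k C' H') (R : RootDatum k C H) (ι : J → I) : Prop where
  injective : Function.Injective ι
  submatrix : ∀ i j, C' i j = C (ι i) (ι j)
  exists_map : ∃ s : H' →ₗ[k] H, Function.Injective s ∧
    (∀ j, s (R'.coroot j) = R.coroot (ι j)) ∧ (∀ j, R.root (ι j) ∘ₗ s = R'.root j)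

open Classical in
/-- The indicator function of `D = I \ ι(J)`. -/
def chi (ι : J → I) (i : I) : ℕ := if i ∈ Set.range ι then 0 else 1

/-- The subalgebra `L♯(C')` of `L(C)`, generated by the `e_j`, `f_j` (`j ∈ J`) and all `h̃`. -/
def sharp (R : RootDatum k C H) (ι : J → I) : LieSubalgebra k (Alg R) :=
  LieSubalgebra.lieSpan k (Alg R)
    (Set.range (fun j => e R (ι j)) ∪ Set.range (fun j => f R (ι j)) ∪ Set.range (h R))

/-- The `ℤ`-grading of `L(C)` with `deg e_i = χ_D(i)`, `deg f_i = -χ_D(i)`, `deg h̃ = 0`. -/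
def zGrading (R : RootDatum k C H) (ι : J → I) : ℤ → Submodule k (Alg R) :=
  genGrading k fun n x =>
    (∃ i, x = e R i ∧ n = (chi ι i : ℤ)) ∨ (∃ i, x = f R i ∧ n = -(chi ι i : ℤ)) ∨
      (∃ y, x = h R y ∧ n = 0)

/-- The `ℕ`-grading of `B⁻(C)` with `deg f_i = χ_D(i)`, `deg h̃ = 0`. -/
def nGrading (R : RootDatum k C H) (ι : J → I) : ℕ → Submodule k (borel R) :=
  genGrading k fun n x =>
    (∃ i, (x : Alg R) = f R i ∧ n = chi ι i) ∨ (∃ y, (x : Alg R) = h R y ∧ n = 0)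

/-- The space `b`, the positive-degree part of the `ℕ`-graded Lie algebra `B⁻(C)`. -/
def bSpace (R : RootDatum k C H) (ι : J → I) : Submodule k (borel R) :=
  ⨆ (n : ℕ) (_ : 0 < n), nGrading R ι n

/-- The inclusion of `b` in `L(C)`. -/
def bIncl (R : RootDatum k C H) (ι : J → I) : bSpace R ι →ₗ[k] Alg R :=
  (borel R).toSubmodule.subtype ∘ₗ (bSpace R ι).subtype

/-- The root-space grading of `L♯(C')`. -/
def sharpGrading (R : RootDatum k C H) (ι : J → I) (γ : I →₀ ℤ) : Submodule k (sharp R ι) :=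
  (rootSpace R γ).comap (sharp R ι).toSubmodule.subtype

/-- The root-space grading of `b`. -/
def bGrading (R : RootDatum k C H) (ι : J → I) (γ : I →₀ ℤ) : Submodule k (bSpace R ι) :=
  (rootSpace R γ).comap (bIncl R ι)

/-- The graded dual of `b`, with respect to the (finite-dimensional) root spaces. -/
abbrev bDual (R : RootDatum k C H) (ι : J → I) : Submodule k (Module.Dual k (bSpace R ι)) :=
  gradedDual (bGrading R ι)

/-- The evaluation pairing of the graded dual with `b`. -/
def evalPairing (R : RootDatum k C H) (ι : J → I) :
    bDual R ι →ₗ[k] bSpace R ι →ₗ[k] k :=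
  (bDual R ι).subtype

/-- `B` is the braided-Lie bialgebra attached to the split projection `π` of `B⁻(C)` onto its
degree-`0` part: the space `b = ker π`, with the Lie bracket of `L(C)`, the adjoint action (here of
`L♯(C')`) and the braided cobracket `(id - π) ⊗ (id - π) ∘ δ`. The last field says that the coaction
`x ↦ r² ⊗ r¹ ▷ x` coming from `r` is the coaction `(π ⊗ id) ∘ δ` of the degree-`0` part. -/
structure IsKernelBraided (R : RootDatum k C H) (ι : J → I)
    (δB : borel R →ₗ[k] borel R ⊗[k] borel R) (π : borel R →ₗ[k] borel R)
    {r : (I →₀ ℕ) → sharp R ι ⊗[k] sharp R ι} (B : BraidedLieBialgebra r (bSpace R ι)) :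
    Prop where
  ker_eq : LinearMap.ker π = bSpace R ι
  br_eq : ∀ x y, bIncl R ι (B.br x y) = ⁅bIncl R ι x, bIncl R ι y⁆
  act_eq : ∀ ξ x, bIncl R ι (B.act ξ x) = ⁅(ξ : Alg R), bIncl R ι x⁆
  cobr_eq : ∀ x, TensorProduct.map (bSpace R ι).subtype (bSpace R ι).subtype (B.cobr x)
    = TensorProduct.map (LinearMap.id - π) (LinearMap.id - π) (δB (x : borel R))
  coaction_eq : ∀ x,
    TensorProduct.map (sharp R ι).toSubmodule.subtype (bIncl R ι) (∑ᶠ β, actLeft B.act (r β) x)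
      = TensorProduct.map ((borel R).toSubmodule.subtype ∘ₗ π) (borel R).toSubmodule.subtype
          (δB (x : borel R))

end Sub

end KacMoody

end

noncomputable section

set_option linter.unusedSectionVars false

/-! Two objects control everything: an invariant nondegenerate symmetric form `B` on L(C), and the
operator `T` that is 1 on positive root spaces, 1/2 on H and 0 on negative root spaces.

The form. A minimal realization carries a symmetric nondegenerate form on H with d_i (h_i, y) =
α_i(y). Choose a functional `lam` with d_i lam(h_i) = 1, so that lam(ν(γ)) = ht γ for ν(γ) = Σ γ_i
d_i h_i. On opposite root spaces put B(x, y) = lam([x, y]) / ht γ. The substance is that [x, y] =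
B(x, y) ν(γ); this is proved by induction on the height together with invariance (`inv_step`,
`lieF_core`, `lieEq_all`). The radical of `B` is an ideal meeting H trivially, hence zero
(`exists_form`, `data_ideal`).

The cobracket. Write u₊ = T u and u₋ = u - T u. The identity T(u ⋆ v) = -[T u, T v] (`T_star`) makes
u ⋆ v = [u₋, v₋] - [u₊, v₊] a Lie bracket, and δ is its transpose under `B`. The transpose takes
values in L ⊗ L because the commutator of `T` with ad e_i and ad f_i has finite rank (`T_comm_e`,
`T_comm_f`), because it vanishes for h (`T_comm_h`), and because x ↦ [ad x, T] is a 1-cocycle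
(`star_apply_lie`). Coantisymmetry, co-Jacobi and the cocycle law are then the transposes of
properties of ⋆.

The decomposition. The degree ω = `chiDeg` splits L into negative, zero and positive parts. These
are b, L♯(C') and, through `B`, the graded dual of b (`exists_dual_slice`). The family `r`
represents `T` on degree 0 (`finsum_r`). As T + T* = 1, the family 2 r₊ represents `B` itself
(`finsum_twiceSym`). Since the functionals `B u` separate tensors (`tensor_ext`), the remaining
tensor identities are tested on pairs u, v. The hexagon becomes `T_star`, the braided cocycle law
becomes invariance of `B` split by degree (`exists_braided`), and the formulas of the
double-bosonisation are the three degree components of [x, φ] and of u ⋆ v (`mixed_eq`,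
`star_apply_neg`, `star_apply_pos`). The infinite sums acting on b and its dual are finite because a
weight of negative degree can be raised within its degree in only finitely many ways (`finite_neg`).

The central extension. L♯(C') → L(C') is obtained from the subalgebra of the product generated by
pairs of generators, which turns out to be a graph (`exists_sharp_hom`). A nonzero root component of
the kernel would put some ν(γ) with nonzero image in the kernel, so the kernel lies in H, where it
is killed by all α_{ι(j)} (`ker_le_center`). -/

namespace KacMoody

open LieBi

/-! ### Chevalley data, weights and weight spaces -/

/-- A Lie algebra generated by Chevalley generators `e i`, `f i` and a commutative subalgebra
`h H`, subject to the relations of a contragredient Lie algebra with independent roots. -/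
structure KMData (k I H L : Type*) [Field k] [Fintype I] [AddCommGroup H] [Module k H]
    [LieRing L] [LieAlgebra k L] where
  root : I → Module.Dual k H
  coroot : I → H
  e : I → L
  f : I → L
  h : H →ₗ[k] L
  root_indep : LinearIndependent k root
  h_inj : Function.Injective h
  hh : ∀ x y, ⁅h x, h y⁆ = 0
  he : ∀ x i, ⁅h x, e i⁆ = root i x • e i
  hf : ∀ x i, ⁅h x, f i⁆ = -(root i x • f i)
  ef_same : ∀ i, ⁅e i, f i⁆ = h (coroot i)
  ef_ne : ∀ i j, i ≠ j → ⁅e i, f j⁆ = 0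
  gen : LieSubalgebra.lieSpan k L (Set.range e ∪ Set.range f ∪ Set.range h) = ⊤

namespace KMData

variable {k I H L : Type*} [Field k] [Fintype I] [AddCommGroup H] [Module k H]
  [LieRing L] [LieAlgebra k L]

/-- The data with the roles of `e` and `f` exchanged. -/
@[simps] def mirror (D : KMData k I H L) : KMData k I H L where
  root := D.root
  coroot := D.coroot
  e := D.f
  f := D.e
  -- The sign keeps the same roots and coroots valid after the exchange. Weights change sign, so
  -- each statement about `e` and positive weights yields the one about `f` and negative weights.
  h := -D.h
  root_indep := D.root_indep
  h_inj := by
    intro x y hxy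
    exact D.h_inj (neg_injective (by simpa using hxy))
  hh := by intro x y; simp [D.hh]
  he := by intro x i; simp [D.hf]
  hf := by intro x i; simp [D.he]
  ef_same := by
    intro i
    rw [← lie_skew, D.ef_same]; rfl
  ef_ne := by
    intro i j hij
    rw [← lie_skew, D.ef_ne j i hij.symm, neg_zero]
  gen := by
    have : Set.range (-D.h : H →ₗ[k] L) = Set.range D.h := by
      ext x; constructor
      · rintro ⟨y, rfl⟩; exact ⟨-y, by simp⟩
      · rintro ⟨y, rfl⟩; exact ⟨-y, by simp⟩
    rw [this, Set.union_comm (Set.range D.f), D.gen]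

/-- The value of the weight `∑ γ_i α_i` at `y`. -/
def ev (D : KMData k I H L) (γ : I →₀ ℤ) (y : H) : k := ∑ i, (γ i : k) * D.root i y

section ev

variable (D : KMData k I H L)

@[simp] lemma ev_zero (y : H) : D.ev 0 y = 0 := by simp [ev]
@[simp] lemma ev_add (γ γ' : I →₀ ℤ) (y : H) : D.ev (γ + γ') y = D.ev γ y + D.ev γ' y := by
  simp [ev, add_mul, Finset.sum_add_distrib]
@[simp] lemma ev_neg (γ : I →₀ ℤ) (y : H) : D.ev (-γ) y = -D.ev γ y := by
  simp [ev]
@[simp] lemma ev_single (i : I) (y : H) : D.ev (Finsupp.single i 1) y = D.root i y := by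
  classical
  simp [ev, Finsupp.single_apply]
@[simp] lemma mirror_ev (γ : I →₀ ℤ) (y : H) : D.mirror.ev γ y = D.ev γ y := rfl

/-- The roots are independent over `k` and ℤ embeds in `k`. Hence integer vectors label weights
faithfully. -/
lemma exists_ev_ne [CharZero k] {γ γ' : I →₀ ℤ} (hne : γ ≠ γ') : ∃ y, D.ev γ y ≠ D.ev γ' y := by
  by_contra! hc
  apply hne
  have h1 := Fintype.linearIndependent_iff.1 D.root_indep (fun i => (γ i : k) - γ' i) (by
    ext y
    have := hc y
    simp only [ev] at this
    simp [sub_mul, Finset.sum_sub_distrib, this])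
  ext i
  have := h1 i
  rw [sub_eq_zero] at this
  exact_mod_cast this

end ev

/-- The weight space of weight `∑ γ_i α_i`. -/
def W (D : KMData k I H L) (γ : I →₀ ℤ) : Submodule k L where
  carrier := {x | ∀ y : H, ⁅D.h y, x⁆ = D.ev γ y • x}
  zero_mem' := by intro y; simp
  add_mem' := by
    intro a b ha hb y
    rw [lie_add, ha y, hb y, smul_add]
  smul_mem' := by
    intro c a ha y
    rw [lie_smul, ha y, smul_comm]

variable (D : KMData k I H L)

lemma mem_W {γ : I →₀ ℤ} {x : L} : x ∈ D.W γ ↔ ∀ y : H, ⁅D.h y, x⁆ = D.ev γ y • x := Iff.rfl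

lemma mirror_W (γ : I →₀ ℤ) : D.mirror.W γ = D.W (-γ) := by
  ext x
  simp only [mem_W, mirror_h, mirror_ev, ev_neg, LinearMap.neg_apply, neg_lie, neg_smul]
  exact forall_congr' fun y => neg_eq_iff_eq_neg

lemma lie_mem_W {γ γ' : I →₀ ℤ} {x y : L} (hx : x ∈ D.W γ) (hy : y ∈ D.W γ') :
    ⁅x, y⁆ ∈ D.W (γ + γ') := by
  intro z
  rw [leibniz_lie, hx z, hy z, ev_add, smul_lie, lie_smul, add_smul]

lemma lie_mem_W' {γ γ' δ : I →₀ ℤ} {x y : L} (hx : x ∈ D.W γ) (hy : y ∈ D.W γ')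
    (h : γ + γ' = δ) : ⁅x, y⁆ ∈ D.W δ := h ▸ D.lie_mem_W hx hy

lemma h_mem (y : H) : D.h y ∈ D.W 0 := by intro z; simp [D.hh]
lemma e_mem (i : I) : D.e i ∈ D.W (Finsupp.single i 1) := by intro z; simp [D.he]
lemma f_mem (i : I) : D.f i ∈ D.W (-Finsupp.single i 1) := by intro z; simp [D.hf]

/-- Elimination of one weight at a time: ad(h y) - γ₁(y) kills the component of weight γ₁ and
rescales the others, and `y` is chosen so that the factor of the wanted component is nonzero. With
`N = ⊥` this gives independence of weight spaces; for an ideal it gives gradedness. -/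
lemma mem_of_sum_mem [CharZero k] {N : Submodule k L} (hN : ∀ y, ∀ x ∈ N, ⁅D.h y, x⁆ ∈ N)
    (s : Finset (I →₀ ℤ)) : ∀ x : (I →₀ ℤ) → L, (∀ γ ∈ s, x γ ∈ D.W γ) →
    ∑ γ ∈ s, x γ ∈ N → ∀ γ ∈ s, x γ ∈ N := by
  classical
  induction s using Finset.induction_on with
  | empty => intro x _ _ γ hγ; simp at hγ
  | insert γ₁ s hγ₁ ih =>
    intro x hx hs
    have key : ∀ γ ∈ s, x γ ∈ N := by
      intro γ₀ hγ₀
      obtain ⟨y, hy⟩ := D.exists_ev_ne (γ := γ₀) (γ' := γ₁) (by rintro rfl; exact hγ₁ hγ₀)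
      have h1 : ∑ γ ∈ s, (D.ev γ y - D.ev γ₁ y) • x γ ∈ N := by
        have := N.sub_mem (hN y _ hs) (N.smul_mem (D.ev γ₁ y) hs)
        rw [lie_sum, Finset.smul_sum, ← Finset.sum_sub_distrib, Finset.sum_insert hγ₁,
          hx γ₁ (by simp) y, sub_self, zero_add] at this
        convert this using 1
        refine Finset.sum_congr rfl fun γ hγ => ?_
        rw [hx γ (by simp [hγ]) y, sub_smul]
      have h2 := ih (fun γ => (D.ev γ y - D.ev γ₁ y) • x γ)
        (fun γ hγ => (D.W γ).smul_mem _ (hx γ (by simp [hγ]))) h1 γ₀ hγ₀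
      have h3 : D.ev γ₀ y - D.ev γ₁ y ≠ 0 := sub_ne_zero.2 hy
      exact (N.smul_mem_iff h3).1 h2
    intro γ hγ
    rcases Finset.mem_insert.1 hγ with rfl | hγ
    · rw [Finset.sum_insert hγ₁] at hs
      exact (N.add_mem_iff_left (N.sum_mem key)).1 hs
    · exact key γ hγ

/-! ### Iterated brackets span: the triangular decomposition as a spanning set -/

/-- Iterated brackets of the `e i`. -/
def ew : List I → I → L
  | [], i => D.e i
  | j :: l, i => ⁅D.e j, ew l i⁆

/-- Iterated brackets of the `f i`. -/
def fw (l : List I) (i : I) : L := D.mirror.ew l i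

/-- The weight of an iterated bracket. -/
def lwt {I : Type*} (l : List I) (i : I) : I →₀ ℤ :=
  (l.map fun j => Finsupp.single j 1).sum + Finsupp.single i 1

lemma lwt_nil (i : I) : lwt [] i = Finsupp.single i 1 := by simp [lwt]
lemma lwt_cons (j : I) (l : List I) (i : I) :
    lwt (j :: l) i = Finsupp.single j 1 + lwt l i := by simp [lwt, add_assoc]

lemma ew_mem (l : List I) (i : I) : D.ew l i ∈ D.W (lwt l i) := by
  induction l with
  | nil => rw [lwt_nil]; exact D.e_mem i
  | cons j l ih => rw [lwt_cons]; exact D.lie_mem_W (D.e_mem j) ih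

lemma fw_mem (l : List I) (i : I) : D.fw l i ∈ D.W (-lwt l i) := by
  rw [← mirror_W]; exact D.mirror.ew_mem l i

lemma mirror_mirror : D.mirror.mirror = D := by
  cases D; simp [mirror]

lemma mirror_fw (l : List I) (i : I) : D.mirror.fw l i = D.ew l i := by
  rw [fw, mirror_mirror]

lemma fw_cons (j : I) (l : List I) (i : I) : D.fw (j :: l) i = ⁅D.f j, D.fw l i⁆ := rfl
lemma fw_nil (i : I) : D.fw [] i = D.f i := rfl

/-- The span of the `h y` and the iterated brackets of the `f i`. -/
def negSpan : Submodule k L :=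
  Submodule.span k (Set.range D.h ∪ Set.range (Function.uncurry D.fw))

lemma h_mem_negSpan (y : H) : D.h y ∈ D.negSpan := Submodule.subset_span (Or.inl ⟨y, rfl⟩)
lemma fw_mem_negSpan (l : List I) (i : I) : D.fw l i ∈ D.negSpan :=
  Submodule.subset_span (Or.inr ⟨(l, i), rfl⟩)

lemma h_lie_negSpan (y : H) {x : L} (hx : x ∈ D.negSpan) : ⁅D.h y, x⁆ ∈ D.negSpan := by
  induction hx using Submodule.span_induction with
  | mem x hx =>
    rcases hx with ⟨z, rfl⟩ | ⟨⟨l, i⟩, rfl⟩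
    · simp [D.hh]
    · rw [Function.uncurry_apply_pair, D.fw_mem l i y]
      exact Submodule.smul_mem _ _ (D.fw_mem_negSpan l i)
  | zero => simp
  | add a b _ _ ha hb => rw [lie_add]; exact add_mem ha hb
  | smul c a _ ha => rw [lie_smul]; exact Submodule.smul_mem _ _ ha

lemma f_lie_negSpan (j : I) {x : L} (hx : x ∈ D.negSpan) : ⁅D.f j, x⁆ ∈ D.negSpan := by
  induction hx using Submodule.span_induction with
  | mem x hx =>
    rcases hx with ⟨z, rfl⟩ | ⟨⟨l, i⟩, rfl⟩
    · rw [← lie_skew, D.hf, neg_neg]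
      exact Submodule.smul_mem _ _ (D.fw_mem_negSpan [] j)
    · exact D.fw_mem_negSpan (j :: l) i
  | zero => simp
  | add a b _ _ ha hb => rw [lie_add]; exact add_mem ha hb
  | smul c a _ ha => rw [lie_smul]; exact Submodule.smul_mem _ _ ha

/-- Moving `e j` past the letters of the word replaces a matching letter by a coroot, which acts by
scalars on what follows. No `e` survives. -/
lemma e_lie_fw (j : I) (l : List I) (i : I) : ⁅D.e j, D.fw l i⁆ ∈ D.negSpan := by
  classical
  have ef : ∀ i j, ⁅D.e i, D.f j⁆ = if i = j then D.h (D.coroot i) else 0 := by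
    intro i j; split_ifs with h
    · subst h; exact D.ef_same i
    · exact D.ef_ne i j h
  induction l with
  | nil =>
    rw [fw_nil, ef]
    split_ifs
    · exact D.h_mem_negSpan _
    · exact zero_mem _
  | cons m l ih =>
    rw [fw_cons, leibniz_lie, ef]
    refine add_mem ?_ (D.f_lie_negSpan m ih)
    split_ifs
    · exact D.h_lie_negSpan _ (D.fw_mem_negSpan l i)
    · simp

/-- The homogeneous spanning set of `L`. -/
def spanning : Submodule k L :=
  Submodule.span k (Set.range D.h ∪ Set.range (Function.uncurry D.ew) ∪
    Set.range (Function.uncurry D.fw))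

lemma negSpan_le : D.negSpan ≤ D.spanning :=
  Submodule.span_mono (by rintro x (h | h); exacts [Or.inl (Or.inl h), Or.inr h])

lemma mirror_spanning : D.mirror.spanning = D.spanning := by
  have : Set.range (-D.h : H →ₗ[k] L) = Set.range D.h := by
    ext x; constructor
    · rintro ⟨y, rfl⟩; exact ⟨-y, by simp⟩
    · rintro ⟨y, rfl⟩; exact ⟨-y, by simp⟩
  have h2 : D.mirror.fw = D.ew := by funext l i; exact D.mirror_fw l i
  unfold spanning
  rw [h2, mirror_h, this, Set.union_right_comm]
  rfl

lemma e_lie_spanning (j : I) {x : L} (hx : x ∈ D.spanning) : ⁅D.e j, x⁆ ∈ D.spanning := by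
  induction hx using Submodule.span_induction with
  | mem x hx =>
    rcases hx with (⟨z, rfl⟩ | ⟨⟨l, i⟩, rfl⟩) | ⟨⟨l, i⟩, rfl⟩
    · rw [← lie_skew, D.he]
      exact neg_mem (Submodule.smul_mem _ _ (Submodule.subset_span (Or.inl (Or.inr ⟨([], j), rfl⟩))))
    · exact Submodule.subset_span (Or.inl (Or.inr ⟨(j :: l, i), rfl⟩))
    · exact D.negSpan_le (D.e_lie_fw j l i)
  | zero => simp
  | add a b _ _ ha hb => rw [lie_add]; exact add_mem ha hb
  | smul c a _ ha => rw [lie_smul]; exact Submodule.smul_mem _ _ ha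

lemma f_lie_spanning (j : I) {x : L} (hx : x ∈ D.spanning) : ⁅D.f j, x⁆ ∈ D.spanning := by
  rw [← mirror_spanning] at hx ⊢
  exact D.mirror.e_lie_spanning j hx

lemma h_lie_spanning (y : H) {x : L} (hx : x ∈ D.spanning) : ⁅D.h y, x⁆ ∈ D.spanning := by
  induction hx using Submodule.span_induction with
  | mem x hx =>
    rcases hx with (⟨z, rfl⟩ | ⟨⟨l, i⟩, rfl⟩) | ⟨⟨l, i⟩, rfl⟩
    · simp [D.hh]
    · rw [Function.uncurry_apply_pair, D.ew_mem l i y]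
      exact Submodule.smul_mem _ _ (Submodule.subset_span (Or.inl (Or.inr ⟨(l, i), rfl⟩)))
    · rw [Function.uncurry_apply_pair, D.fw_mem l i y]
      exact Submodule.smul_mem _ _ (Submodule.subset_span (Or.inr ⟨(l, i), rfl⟩))
  | zero => simp
  | add a b _ _ ha hb => rw [lie_add]; exact add_mem ha hb
  | smul c a _ ha => rw [lie_smul]; exact Submodule.smul_mem _ _ ha

/-- Induction on the generation of `L` by `e`, `f`, `h`. -/
lemma gen_induction {p : L → Prop} (he : ∀ i, p (D.e i)) (hf : ∀ i, p (D.f i))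
    (hh : ∀ y, p (D.h y)) (h0 : p 0) (hadd : ∀ x y, p x → p y → p (x + y))
    (hsmul : ∀ (c : k) x, p x → p (c • x)) (hlie : ∀ x y, p x → p y → p ⁅x, y⁆) (x : L) : p x := by
  let S : LieSubalgebra k L :=
    { carrier := {x | p x}
      add_mem' := fun hx hy => hadd _ _ hx hy
      zero_mem' := h0
      smul_mem' := fun c _ hx => hsmul c _ hx
      lie_mem' := fun hx hy => hlie _ _ hx hy }
  have h1 : LieSubalgebra.lieSpan k L (Set.range D.e ∪ Set.range D.f ∪ Set.range D.h) ≤ S := by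
    rw [LieSubalgebra.lieSpan_le]
    rintro x ((⟨i, rfl⟩ | ⟨i, rfl⟩) | ⟨y, rfl⟩)
    exacts [he i, hf i, hh y]
  rw [D.gen] at h1
  exact h1 (LieSubalgebra.mem_top x)

/-- A subspace stable under the generators is an ideal. -/
lemma lie_mem_of_gen {N : Submodule k L} (he : ∀ i, ∀ x ∈ N, ⁅D.e i, x⁆ ∈ N)
    (hf : ∀ i, ∀ x ∈ N, ⁅D.f i, x⁆ ∈ N) (hh : ∀ y, ∀ x ∈ N, ⁅D.h y, x⁆ ∈ N) (z : L) :
    ∀ x ∈ N, ⁅z, x⁆ ∈ N := by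
  induction z using D.gen_induction with
  | he i => exact he i
  | hf i => exact hf i
  | hh y => exact hh y
  | h0 => intro x _; simp
  | hadd a b ha hb => intro x hx; rw [add_lie]; exact add_mem (ha x hx) (hb x hx)
  | hsmul c a ha => intro x hx; rw [smul_lie]; exact N.smul_mem _ (ha x hx)
  | hlie a b ha hb =>
    intro x hx
    rw [lie_lie]
    exact sub_mem (ha _ (hb x hx)) (hb _ (ha x hx))

/-- The span is stable under the adjoint action of the generators, hence under all of `L`; it
therefore contains brackets of its elements, and it contains the generators. -/
lemma spanning_eq_top : D.spanning = ⊤ := by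
  rw [eq_top_iff]
  rintro x -
  have hid := D.lie_mem_of_gen (N := D.spanning) (fun i _ => D.e_lie_spanning i)
    (fun i _ => D.f_lie_spanning i) (fun y _ => D.h_lie_spanning y)
  induction x using D.gen_induction with
  | he i => exact Submodule.subset_span (Or.inl (Or.inr ⟨([], i), rfl⟩))
  | hf i => exact Submodule.subset_span (Or.inr ⟨([], i), rfl⟩)
  | hh y => exact Submodule.subset_span (Or.inl (Or.inl ⟨y, rfl⟩))
  | h0 => exact zero_mem _
  | hadd a b ha hb => exact add_mem ha hb
  | hsmul c a ha => exact Submodule.smul_mem _ _ ha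
  | hlie a b ha hb => exact hid a b hb

lemma span_induction {p : L → Prop} (he : ∀ l i, p (D.ew l i)) (hf : ∀ l i, p (D.fw l i))
    (hh : ∀ y, p (D.h y)) (h0 : p 0) (hadd : ∀ x y, p x → p y → p (x + y))
    (hsmul : ∀ (c : k) x, p x → p (c • x)) (x : L) : p x := by
  have hx : x ∈ D.spanning := by rw [spanning_eq_top]; trivial
  induction hx using Submodule.span_induction with
  | mem x hx =>
    rcases hx with (⟨z, rfl⟩ | ⟨⟨l, i⟩, rfl⟩) | ⟨⟨l, i⟩, rfl⟩
    exacts [hh z, he l i, hf l i]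
  | zero => exact h0
  | add a b _ _ ha hb => exact hadd a b ha hb
  | smul c a _ ha => exact hsmul c a ha

lemma iSup_W : ⨆ γ, D.W γ = ⊤ := by
  rw [eq_top_iff]
  rintro x -
  induction x using D.span_induction with
  | he l i => exact Submodule.mem_iSup_of_mem _ (D.ew_mem l i)
  | hf l i => exact Submodule.mem_iSup_of_mem _ (D.fw_mem l i)
  | hh y => exact Submodule.mem_iSup_of_mem _ (D.h_mem y)
  | h0 => exact zero_mem _
  | hadd a b ha hb => exact add_mem ha hb
  | hsmul c a ha => exact Submodule.smul_mem _ _ ha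

lemma W_indep [CharZero k] : iSupIndep D.W := by
  classical
  apply iSupIndep_of_dfinsupp_lsum_injective
  rw [← LinearMap.ker_eq_bot, LinearMap.ker_eq_bot']
  intro m hm
  ext γ
  have h1 := D.mem_of_sum_mem (N := ⊥) (by simp) m.support (fun γ => (m γ : L))
    (fun γ _ => (m γ).2) (by
      rw [DFinsupp.lsum_apply_apply, DFinsupp.sumAddHom_apply] at hm
      simpa [DFinsupp.sum] using hm)
  by_cases hγ : γ ∈ m.support
  · simpa using h1 γ hγ
  · simpa using hγ

lemma internal [CharZero k] [DecidableEq (I →₀ ℤ)] : DirectSum.IsInternal D.W := by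
  rw [DirectSum.isInternal_submodule_iff_iSupIndep_and_iSup_eq_top]
  exact ⟨D.W_indep, D.iSup_W⟩

lemma hom_induction {p : L → Prop} (hW : ∀ γ, ∀ x ∈ D.W γ, p x)
    (hadd : ∀ x y, p x → p y → p (x + y)) (x : L) : p x := by
  have hx : x ∈ ⨆ γ, D.W γ := by rw [iSup_W]; trivial
  exact Submodule.iSup_induction _ (motive := p) hx hW (hW 0 0 (zero_mem _)) hadd

lemma hom_ext {M : Type*} [AddCommGroup M] [Module k M] {φ ψ : L →ₗ[k] M}
    (hW : ∀ γ, ∀ x ∈ D.W γ, φ x = ψ x) : φ = ψ := by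
  ext x
  induction x using D.hom_induction with
  | hW γ x hx => exact hW γ x hx
  | hadd a b ha hb => simp [ha, hb]

/-! ### Projections onto sets of weights -/

open Classical in
/-- The operator that acts on the weight space of weight `γ` by the scalar `w γ`. -/
def scale [CharZero k] (w : (I →₀ ℤ) → k) : L →ₗ[k] L :=
  DirectSum.toModule k _ L (fun γ => w γ • (D.W γ).subtype) ∘ₗ
    (LinearEquiv.ofBijective (DirectSum.coeLinearMap D.W) D.internal).symm.toLinearMap

section scale

variable [CharZero k]

lemma scale_apply (w : (I →₀ ℤ) → k) {γ : I →₀ ℤ} {x : L} (hx : x ∈ D.W γ) :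
    D.scale w x = w γ • x := by
  classical
  have : (LinearEquiv.ofBijective (DirectSum.coeLinearMap D.W) D.internal).symm x
      = DirectSum.lof k _ (fun γ => D.W γ) γ ⟨x, hx⟩ := by
    rw [LinearEquiv.symm_apply_eq]
    exact (DirectSum.coeLinearMap_lof D.W γ ⟨x, hx⟩).symm
  simp only [scale, LinearMap.comp_apply, LinearEquiv.coe_coe]
  rw [this, DirectSum.toModule_lof]
  simp

lemma scale_mem (w : (I →₀ ℤ) → k) {γ : I →₀ ℤ} {x : L} (hx : x ∈ D.W γ) :
    D.scale w x ∈ D.W γ := by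
  rw [D.scale_apply w hx]; exact Submodule.smul_mem _ _ hx

lemma scale_scale (w w' : (I →₀ ℤ) → k) (x : L) :
    D.scale w (D.scale w' x) = D.scale (fun γ => w γ * w' γ) x := by
  induction x using D.hom_induction with
  | hW γ x hx =>
    rw [D.scale_apply _ hx, map_smul, D.scale_apply _ hx, D.scale_apply _ hx, smul_smul, mul_comm]
  | hadd a b ha hb => simp [ha, hb]

/-- The projection onto the sum of the weight spaces with weight in `A`. -/
def proj (A : Set (I →₀ ℤ)) : L →ₗ[k] L := D.scale (A.indicator 1)

lemma proj_of_mem {A : Set (I →₀ ℤ)} {γ : I →₀ ℤ} {x : L} (hx : x ∈ D.W γ) (h : γ ∈ A) :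
    D.proj A x = x := by
  rw [proj, D.scale_apply _ hx]; simp [h]

lemma proj_of_notMem {A : Set (I →₀ ℤ)} {γ : I →₀ ℤ} {x : L} (hx : x ∈ D.W γ) (h : γ ∉ A) :
    D.proj A x = 0 := by
  rw [proj, D.scale_apply _ hx]; simp [h]

lemma proj_proj (A A' : Set (I →₀ ℤ)) (x : L) : D.proj A (D.proj A' x) = D.proj (A ∩ A') x := by
  classical
  rw [proj, proj, scale_scale, proj]
  congr 2
  funext γ
  simp only [Set.indicator_apply, Set.mem_inter_iff]
  split_ifs <;> simp_all

/-- A projection lies in any subspace containing the spanning elements of suitable weight. -/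
lemma proj_mem (A : Set (I →₀ ℤ)) {N : Submodule k L}
    (he : ∀ l i, lwt l i ∈ A → D.ew l i ∈ N) (hf : ∀ l i, -lwt l i ∈ A → D.fw l i ∈ N)
    (hh : 0 ∈ A → ∀ y, D.h y ∈ N) (x : L) : D.proj A x ∈ N := by
  induction x using D.span_induction with
  | he l i =>
    by_cases h : lwt l i ∈ A
    · rw [D.proj_of_mem (D.ew_mem l i) h]; exact he l i h
    · rw [D.proj_of_notMem (D.ew_mem l i) h]; exact zero_mem _
  | hf l i =>
    by_cases h : -lwt l i ∈ A
    · rw [D.proj_of_mem (D.fw_mem l i) h]; exact hf l i h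
    · rw [D.proj_of_notMem (D.fw_mem l i) h]; exact zero_mem _
  | hh y =>
    by_cases h : (0 : I →₀ ℤ) ∈ A
    · rw [D.proj_of_mem (D.h_mem y) h]; exact hh h y
    · rw [D.proj_of_notMem (D.h_mem y) h]; exact zero_mem _
  | h0 => simp
  | hadd a b ha hb => rw [map_add]; exact add_mem ha hb
  | hsmul c a ha => rw [map_smul]; exact Submodule.smul_mem _ _ ha

/-- Projecting the spanning set to weight `γ` discards every element of another weight. Questions
about `W γ` are thereby reduced to iterated brackets of weight exactly `γ`. -/
lemma mem_of_proj_mem {N : Submodule k L} {γ : I →₀ ℤ}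
    (he : ∀ l i, lwt l i = γ → D.ew l i ∈ N) (hf : ∀ l i, -lwt l i = γ → D.fw l i ∈ N)
    (hh : γ = 0 → ∀ y, D.h y ∈ N) {x : L} (hx : x ∈ D.W γ) : x ∈ N := by
  rw [← D.proj_of_mem hx (Set.mem_singleton γ)]
  exact D.proj_mem _ (fun l i h => he l i h) (fun l i h => hf l i h) (fun h => hh h.symm) x

lemma proj_mem_of_stable {N : Submodule k L} (hN : ∀ y, ∀ x ∈ N, ⁅D.h y, x⁆ ∈ N)
    (A : Set (I →₀ ℤ)) {x : L} (hx : x ∈ N) : D.proj A x ∈ N := by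
  classical
  obtain ⟨m, rfl⟩ : ∃ m : Π₀ γ, D.W γ, x = ∑ γ ∈ m.support, (m γ : L) := by
    have h1 : x ∈ ⨆ γ, D.W γ := by rw [iSup_W]; trivial
    rw [Submodule.mem_iSup_iff_exists_dfinsupp'] at h1
    obtain ⟨m, hm⟩ := h1
    exact ⟨m, hm.symm⟩
  have h1 := D.mem_of_sum_mem hN m.support (fun γ => (m γ : L)) (fun γ _ => (m γ).2) hx
  rw [map_sum]
  refine N.sum_mem fun γ hγ => ?_
  by_cases h : γ ∈ A
  · rw [D.proj_of_mem (m γ).2 h]; exact h1 γ hγ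
  · rw [D.proj_of_notMem (m γ).2 h]; exact zero_mem _

end scale

/-! ### Heights, signs of weights and small weight spaces -/

/-- The height of a weight. -/
def ht : (I →₀ ℤ) →+ ℤ where
  toFun γ := ∑ i, γ i
  map_zero' := by simp
  map_add' := by intro a b; simp [Finset.sum_add_distrib]

@[simp] lemma ht_single (i : I) (n : ℤ) : ht (Finsupp.single i n) = n := by
  classical
  simp [ht, Finsupp.single_apply]

lemma lwt_nonneg (l : List I) (i : I) : 0 ≤ lwt l i := by
  induction l with
  | nil => rw [lwt_nil]; simp
  | cons j l ih => rw [lwt_cons]; exact add_nonneg (by simp) ih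

lemma ht_lwt (l : List I) (i : I) : ht (lwt l i) = l.length + 1 := by
  induction l with
  | nil => simp [lwt_nil]
  | cons j l ih => rw [lwt_cons, map_add, ih]; simp; ring

lemma lwt_pos (l : List I) (i : I) : 0 < lwt l i := by
  refine lt_of_le_of_ne (lwt_nonneg l i) ?_
  intro h
  have := ht_lwt l i
  rw [← h, map_zero] at this
  omega

lemma ht_pos {γ : I →₀ ℤ} (h : 0 < γ) : 0 < ht γ := by
  have h1 : 0 ≤ γ := h.le
  have h2 : ∀ i ∈ Finset.univ, 0 ≤ γ i := fun i _ => h1 i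
  refine lt_of_le_of_ne (Finset.sum_nonneg h2) fun h0 => h.ne' ?_
  ext i
  exact (Finset.sum_eq_zero_iff_of_nonneg h2).1 h0.symm i (Finset.mem_univ i)

variable [CharZero k]

lemma W_zero {x : L} (hx : x ∈ D.W 0) : ∃ y, D.h y = x := by
  have : x ∈ LinearMap.range D.h := D.mem_of_proj_mem (N := LinearMap.range D.h)
    (fun l i h => absurd h (lwt_pos l i).ne')
    (fun l i h => absurd (neg_eq_zero.1 h) (lwt_pos l i).ne')
    (fun _ y => ⟨y, rfl⟩) hx
  exact this

/-- An iterated bracket of `e`'s has positive weight and one of `f`'s negative weight, so no weight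
of mixed sign occurs. The later case distinctions on weights rest on this. -/
lemma W_sign {γ : I →₀ ℤ} {x : L} (hx : x ∈ D.W γ) : x = 0 ∨ 0 < γ ∨ γ = 0 ∨ γ < 0 := by
  by_contra! hc
  obtain ⟨h0, h1, h2, h3⟩ := hc
  apply h0
  have : x ∈ (⊥ : Submodule k L) := D.mem_of_proj_mem
    (fun l i h => absurd (h ▸ lwt_pos l i) h1)
    (fun l i h => absurd (by rw [← h]; exact neg_neg_of_pos (lwt_pos l i)) h3)
    (fun h => absurd h h2) hx
  simpa using this

lemma W_single {i : I} {x : L} (hx : x ∈ D.W (Finsupp.single i 1)) : ∃ c : k, x = c • D.e i := by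
  have : x ∈ Submodule.span k {D.e i} := D.mem_of_proj_mem
    (fun l j h => by
      have h1 := ht_lwt l j
      rw [h, ht_single] at h1
      obtain rfl : l = [] := by
        rw [← List.length_eq_zero_iff]; omega
      rw [lwt_nil] at h
      obtain rfl := (Finsupp.single_left_inj one_ne_zero).1 h
      exact Submodule.mem_span_singleton_self _)
    (fun l j h => by
      have h1 := ht_lwt l j
      have h2 := congrArg ht h
      rw [map_neg, ht_single] at h2
      omega)
    (fun h => by simp at h) hx
  obtain ⟨c, hc⟩ := Submodule.mem_span_singleton.1 this
  exact ⟨c, hc.symm⟩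

lemma W_neg_single {i : I} {x : L} (hx : x ∈ D.W (-Finsupp.single i 1)) :
    ∃ c : k, x = c • D.f i := by
  rw [← mirror_W] at hx
  exact D.mirror.W_single hx

/-- Weight spaces of height at least `2` consist of sums of brackets `⁅e j, y⁆`. -/
lemma W_pos_induction {p : L → Prop} {γ : I →₀ ℤ} (hγ : 2 ≤ ht γ) (h0 : p 0)
    (hadd : ∀ x y, p x → p y → p (x + y))
    (he : ∀ j, ∀ y ∈ D.W (γ - Finsupp.single j 1), p ⁅D.e j, y⁆) {x : L} (hx : x ∈ D.W γ) :
    p x := by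
  have : x ∈ ⨆ j, (D.W (γ - Finsupp.single j 1)).map (LieAlgebra.ad k L (D.e j) : L →ₗ[k] L) :=
    D.mem_of_proj_mem
    (fun l i h => by
      cases l with
      | nil => rw [lwt_nil] at h; rw [← h, ht_single] at hγ; omega
      | cons j l =>
        refine Submodule.mem_iSup_of_mem j ⟨D.ew l i, ?_, rfl⟩
        rw [← h, lwt_cons, add_sub_cancel_left]
        exact D.ew_mem l i)
    (fun l i h => by
      have h2 := ht_lwt l i
      rw [← h, map_neg] at hγ
      omega)
    (fun h => by rw [h, map_zero] at hγ; omega) hx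
  refine Submodule.iSup_induction _ (motive := p) this ?_ h0 hadd
  rintro j _ ⟨y, hy, rfl⟩
  exact he j y hy

lemma W_neg_induction {p : L → Prop} {γ : I →₀ ℤ} (hγ : ht γ ≤ -2) (h0 : p 0)
    (hadd : ∀ x y, p x → p y → p (x + y))
    (hf : ∀ j, ∀ y ∈ D.W (γ + Finsupp.single j 1), p ⁅D.f j, y⁆) {x : L} (hx : x ∈ D.W γ) :
    p x := by
  refine D.mirror.W_pos_induction (γ := -γ) (by rw [map_neg]; omega) h0 hadd ?_
    (by rw [mirror_W, neg_neg]; exact hx)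
  intro j y hy
  rw [mirror_W] at hy
  exact hf j y (by convert hy using 2; abel)

/-- The height of an iterated bracket is one more than the length of its list, up to sign, so a
fixed weight meets only finitely many of them. Where `toNat` truncates it only enlarges a finite
spanning set. -/
instance W_finite [Module.Finite k H] (γ : I →₀ ℤ) : Module.Finite k (D.W γ) := by
  classical
  have hfin : ∀ n : ℕ, {p : List I × I | p.1.length = n}.Finite := fun n =>
    ((List.finite_length_eq I n).prod (Set.finite_univ (α := I))).subset
      (fun p hp => ⟨hp, trivial⟩)
  let N : Submodule k L := LinearMap.range D.h ⊔
    (Submodule.span k (Function.uncurry D.ew '' {p | p.1.length = (ht γ - 1).toNat}) ⊔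
    Submodule.span k (Function.uncurry D.fw '' {p | p.1.length = (-ht γ - 1).toNat}))
  have hle : D.W γ ≤ N := fun x hx => D.mem_of_proj_mem (N := N)
    (fun l i h => Submodule.mem_sup_right (Submodule.mem_sup_left
      (Submodule.subset_span ⟨(l, i), by
        have := ht_lwt l i
        rw [h] at this
        simp only [Set.mem_ofPred_eq]; omega, rfl⟩)))
    (fun l i h => Submodule.mem_sup_right (Submodule.mem_sup_right
      (Submodule.subset_span ⟨(l, i), by
        have := ht_lwt l i
        rw [← neg_eq_iff_eq_neg.2 h.symm, map_neg] at this
        simp only [Set.mem_ofPred_eq]; omega, rfl⟩)))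
    (fun _ y => Submodule.mem_sup_left ⟨y, rfl⟩) hx
  have hN : Module.Finite k N := by
    have h1 : Module.Finite k (Submodule.span k
        (Function.uncurry D.ew '' {p | p.1.length = (ht γ - 1).toNat})) :=
      Module.Finite.span_of_finite k ((hfin _).image _)
    have h2 : Module.Finite k (Submodule.span k
        (Function.uncurry D.fw '' {p | p.1.length = (-ht γ - 1).toNat})) :=
      Module.Finite.span_of_finite k ((hfin _).image _)
    infer_instance
  exact Submodule.finiteDimensional_of_le hle

end KMData

/-! ### Brackets of opposite root spaces, by induction on the height -/

namespace KMData

variable {k I H L : Type*} [Field k] [Fintype I] [AddCommGroup H] [Module k H]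
  [LieRing L] [LieAlgebra k L] (D : KMData k I H L)

/-- The element of `H` that corresponds to the weight `γ`. -/
def nu (d : I → k) (γ : I →₀ ℤ) : H := ∑ i, ((γ i : k) * d i) • D.coroot i

lemma nu_add (d : I → k) (γ γ' : I →₀ ℤ) : D.nu d (γ + γ') = D.nu d γ + D.nu d γ' := by
  simp [nu, add_mul, add_smul, Finset.sum_add_distrib]

lemma nu_neg (d : I → k) (γ : I →₀ ℤ) : D.nu d (-γ) = -D.nu d γ := by
  simp [nu]

lemma nu_single (d : I → k) (i : I) : D.nu d (Finsupp.single i 1) = d i • D.coroot i := by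
  classical
  simp [nu, Finsupp.single_apply]

lemma mirror_nu (d : I → k) (γ : I →₀ ℤ) : D.mirror.nu d γ = D.nu d γ := rfl

/-- `d` symmetrizes the matrix of the values of the roots on the coroots. -/
def Symmetrizes (d : I → k) : Prop :=
  ∀ i j, d i * D.root j (D.coroot i) = d j * D.root i (D.coroot j)

variable {D} {d : I → k}

lemma root_nu (hd : D.Symmetrizes d) (i : I) (γ : I →₀ ℤ) :
    D.root i (D.nu d γ) = d i * D.ev γ (D.coroot i) := by
  simp only [nu, ev, map_sum, map_smul, smul_eq_mul, Finset.mul_sum]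
  refine Finset.sum_congr rfl fun j _ => ?_
  linear_combination (γ j : k) * hd j i

/-- This normalization is why division by the height recovers the coefficient of ν(γ) in a bracket
of opposite root vectors. -/
lemma apply_nu (lam : Module.Dual k H) (hlam : ∀ i, d i * lam (D.coroot i) = 1) (γ : I →₀ ℤ) :
    lam (D.nu d γ) = (ht γ : ℤ) := by
  simp only [nu, map_sum, map_smul, smul_eq_mul, mul_assoc, hlam, mul_one]
  simp [ht]

variable (D) (d)

/-- The bracket of opposite weight spaces of height `n` is determined by `B`. -/
def LieEqHt (B : L →ₗ[k] L →ₗ[k] k) (n : ℤ) : Prop :=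
  ∀ γ, ht γ = n → ∀ x ∈ D.W γ, ∀ y ∈ D.W (-γ), ⁅x, y⁆ = B x y • D.h (D.nu d γ)

/-- The brackets that land in `k f i` are determined by `B`. -/
def LieFEqHt (B : L →ₗ[k] L →ₗ[k] k) (n : ℤ) : Prop :=
  ∀ γ i, ht γ = n → ∀ x ∈ D.W γ, ∀ y ∈ D.W (-γ - Finsupp.single i 1),
    ⁅x, y⁆ = -(d i * B x ⁅D.e i, y⁆) • D.f i

/-- Invariance under `e i` for elements of height `n`. -/
def InvHt (B : L →ₗ[k] L →ₗ[k] k) (n : ℤ) : Prop :=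
  ∀ γ i, ht γ = n → ∀ x ∈ D.W γ, ∀ y ∈ D.W (-γ - Finsupp.single i 1),
    B ⁅D.e i, x⁆ y = -B x ⁅D.e i, y⁆

/-- `B` recovers the value of `lam` on brackets of opposite weight vectors. -/
def Recovers (lam : Module.Dual k H) (B : L →ₗ[k] L →ₗ[k] k) : Prop :=
  ∀ γ, ∀ x ∈ D.W γ, ∀ y ∈ D.W (-γ), ∀ z, ⁅x, y⁆ = D.h z → ((ht γ : ℤ) : k) * B x y = lam z

variable {D} {d} {lam : Module.Dual k H} {B : L →ₗ[k] L →ₗ[k] k}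

lemma Recovers.mirror (hB : D.Recovers lam B) : D.mirror.Recovers lam B := by
  intro γ x hx y hy z hz
  rw [mirror_W] at hx hy
  have := hB (-γ) x hx y hy (-z) (by rw [hz]; simp)
  simpa using this

lemma LieEqHt.mirror (hs : ∀ x y, B x y = B y x) {n : ℤ} (h : D.LieEqHt d B n) :
    D.mirror.LieEqHt d B n := by
  intro γ hγ x hx y hy
  rw [mirror_W] at hx hy
  rw [neg_neg] at hy
  rw [← lie_skew, h γ hγ y hy x hx, hs y x, mirror_nu]
  simp

/-- The Jacobi identity and the two hypotheses at height `n` express [[e_i, x], y] as -B(x, [e_i,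
y]) ν(γ + α_i). Applying `lam` multiplies both sides of the desired invariance by `n + 1`, which is
cancelled in characteristic zero. As height `n + 1` is spanned by brackets with some `e j`, the
bracket formula follows there. -/
lemma inv_step [CharZero k] (hlam : ∀ i, d i * lam (D.coroot i) = 1) (hB : D.Recovers lam B)
    {n : ℤ} (hn : 0 < n) (h1 : D.LieEqHt d B n) (h2 : D.LieFEqHt d B n) :
    D.InvHt B n ∧ D.LieEqHt d B (n + 1) := by
  have key : ∀ γ i, ht γ = n → ∀ x ∈ D.W γ, ∀ y ∈ D.W (-γ - Finsupp.single i 1),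
      ⁅⁅D.e i, x⁆, y⁆ = D.h (-B x ⁅D.e i, y⁆ • D.nu d (γ + Finsupp.single i 1)) := by
    intro γ i hγ x hx y hy
    have h3 : ⁅D.e i, y⁆ ∈ D.W (-γ) := D.lie_mem_W' (D.e_mem i) hy (by abel)
    rw [lie_lie, h2 γ i hγ x hx y hy, h1 γ hγ x hx _ h3, lie_smul, D.ef_same, nu_add, nu_single,
      smul_add, map_add, map_smul, map_smul, map_smul]
    module
  have hinv : D.InvHt B n := by
    intro γ i hγ x hx y hy
    have h3 := hB (γ + Finsupp.single i 1) ⁅D.e i, x⁆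
      (D.lie_mem_W' (D.e_mem i) hx (add_comm _ _)) y (by convert hy using 2; abel) _
      (key γ i hγ x hx y hy)
    rw [map_smul, apply_nu lam hlam, map_add, ht_single, hγ, smul_eq_mul, mul_comm] at h3
    refine mul_right_cancel₀ ?_ h3
    have : n + 1 ≠ 0 := by omega
    exact_mod_cast this
  refine ⟨hinv, ?_⟩
  intro γ hγ x hx y hy
  refine D.W_pos_induction (γ := γ) (by omega)
    (p := fun x => ⁅x, y⁆ = B x y • D.h (D.nu d γ)) ?_ ?_ ?_ hx
  · simp
  · intro a b ha hb
    rw [add_lie, ha, hb, map_add, LinearMap.add_apply, add_smul]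
  · intro j x hx
    have h4 : ht (γ - Finsupp.single j 1) = n := by rw [map_sub, ht_single]; omega
    have h5 : y ∈ D.W (-(γ - Finsupp.single j 1) - Finsupp.single j 1) := by
      convert hy using 2; abel
    rw [key _ j h4 x hx y h5, hinv _ j h4 x hx y h5, sub_add_cancel, map_smul]

lemma W_diff_eq_zero [CharZero k] {i j : I} (hij : i ≠ j) {x : L}
    (hx : x ∈ D.W (Finsupp.single i 1 - Finsupp.single j 1)) : x = 0 := by
  have h0 : ht (Finsupp.single i 1 - Finsupp.single j 1 : I →₀ ℤ) = 0 := by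
    rw [map_sub, ht_single, ht_single, sub_self]
  rcases D.W_sign hx with h | h | h | h
  · exact h
  · exact absurd h0 (ht_pos h).ne'
  · rw [sub_eq_zero] at h
    exact absurd ((Finsupp.single_left_inj one_ne_zero).1 h) hij
  · have := ht_pos (neg_pos.2 h)
    rw [map_neg, h0] at this
    omega

/-- The element `y` has height at most -2, so it is a sum of brackets [f_j, y']. In the Leibniz
expansion [x, y'] has weight α_j - α_i: it vanishes for `j ≠ i`, and for `j = i` it lies in H and is
known from `h1`. There `root_nu`, that is, symmetrizability, makes the coefficients agree. The other
term is `hcore`. -/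
lemma lieF_core [CharZero k] (hd : D.Symmetrizes d) {n : ℤ} (hn : 0 < n)
    (h1 : D.LieEqHt d B n) {γ : I →₀ ℤ} (hγ : ht γ = n) (i : I) {x : L} (hx : x ∈ D.W γ)
    (hcore : ∀ j, ∀ y ∈ D.W (-γ - Finsupp.single i 1 + Finsupp.single j 1),
      ⁅⁅x, D.f j⁆, y⁆ = -(d i * B x ⁅D.f j, ⁅D.e i, y⁆⁆) • D.f i)
    {y : L} (hy : y ∈ D.W (-γ - Finsupp.single i 1)) :
    ⁅x, y⁆ = -(d i * B x ⁅D.e i, y⁆) • D.f i := by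
  refine D.W_neg_induction (γ := -γ - Finsupp.single i 1)
    (by rw [map_sub, map_neg, ht_single, hγ]; omega)
    (p := fun y => ⁅x, y⁆ = -(d i * B x ⁅D.e i, y⁆) • D.f i) ?_ ?_ ?_ hy
  · simp
  · intro a b ha hb
    rw [lie_add, ha, hb, lie_add, map_add]; module
  · intro j y hy
    rw [leibniz_lie, leibniz_lie (D.e i), hcore j y hy, map_add]
    by_cases hij : i = j
    · subst hij
      rw [sub_add_cancel] at hy
      rw [h1 γ hγ x hx y hy, D.ef_same, hy, lie_smul, ← lie_skew (D.f i) (D.h _), D.hf,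
        neg_neg, root_nu hd,
        map_smul, smul_eq_mul, ev_neg]
      module
    · have h2 : ⁅x, y⁆ = 0 := W_diff_eq_zero (Ne.symm hij) (D.lie_mem_W' hx hy (by abel))
      rw [h2, D.ef_ne i j hij]
      simp

/-- Here [x, f_j] has height `n`, so `h2` evaluates its bracket, and invariance for the mirrored
data moves `f j` to the other side of `B`. -/
lemma lieF_step [CharZero k] (hd : D.Symmetrizes d) (hs : ∀ x y, B x y = B y x) {n : ℤ}
    (hn : 0 < n) (h1 : D.LieEqHt d B (n + 1)) (h2 : D.LieFEqHt d B n)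
    (h3 : D.mirror.InvHt B n) : D.LieFEqHt d B (n + 1) := by
  intro γ i hγ x hx y hy
  refine lieF_core hd (by omega) h1 hγ i hx ?_ hy
  intro j y hy
  have h4 : ht (γ - Finsupp.single j 1) = n := by rw [map_sub, ht_single]; omega
  rw [h2 (γ - Finsupp.single j 1) i h4 _ (D.lie_mem_W' hx (D.f_mem j) (by abel)) y
    (by convert hy using 2; abel)]
  have h5 := h3 (γ - Finsupp.single j 1) j h4 ⁅D.e i, y⁆
    (by rw [mirror_W]; exact D.lie_mem_W' (D.e_mem i) hy (by abel)) x
    (by rw [mirror_W]; convert hx using 2; abel)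
  rw [mirror_e] at h5
  rw [hs x, h5, ← lie_skew x, map_neg, LinearMap.neg_apply, hs ⁅D.f j, x⁆]

lemma eq_single_of_ht_eq_one [CharZero k] {γ : I →₀ ℤ} (hγ : ht γ = 1) {x : L}
    (hx : x ∈ D.W γ) : x = 0 ∨ ∃ m, γ = Finsupp.single m 1 := by
  by_contra! hc
  apply hc.1
  have : x ∈ (⊥ : Submodule k L) := D.mem_of_proj_mem
    (fun l i h => by
      have h1 := ht_lwt l i
      rw [h, hγ] at h1
      obtain rfl : l = [] := by
        rw [← List.length_eq_zero_iff]; omega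
      rw [lwt_nil] at h
      exact absurd h.symm (hc.2 i))
    (fun l i h => by
      have h1 := ht_lwt l i
      rw [← h, map_neg] at hγ
      omega)
    (fun h => by rw [h, map_zero] at hγ; omega) hx
  simpa using this

lemma B_e_f (hlam : ∀ i, d i * lam (D.coroot i) = 1) (hB : D.Recovers lam B) (i : I) :
    d i * B (D.e i) (D.f i) = 1 := by
  have := hB _ _ (D.e_mem i) _ (D.f_mem i) _ (D.ef_same i)
  rw [ht_single, Int.cast_one, one_mul] at this
  rw [this, hlam]

lemma lieEq_one [CharZero k] (hlam : ∀ i, d i * lam (D.coroot i) = 1)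
    (hB : D.Recovers lam B) : D.LieEqHt d B 1 := by
  intro γ hγ x hx y hy
  rcases eq_single_of_ht_eq_one hγ hx with rfl | ⟨m, rfl⟩
  · simp
  · obtain ⟨c, rfl⟩ := D.W_single hx
    obtain ⟨c', rfl⟩ := D.W_neg_single hy
    have := B_e_f hlam hB m
    rw [smul_lie, lie_smul, D.ef_same, nu_single, map_smul, map_smul, map_smul,
      LinearMap.smul_apply, smul_smul, smul_smul]
    congr 1
    simp only [smul_eq_mul]
    linear_combination (-c * c') * this

/-- In height one `x` is a multiple of some `e m`, and only `j = m` contributes. The identity left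
over compares α_i(h_m) with α_m(h_i), which is the symmetry supplied by `d`. -/
lemma lieFEq_one [CharZero k] (hd : D.Symmetrizes d) (hlam : ∀ i, d i * lam (D.coroot i) = 1)
    (hB : D.Recovers lam B) : D.LieFEqHt d B 1 := by
  intro γ i hγ x hx y hy
  refine lieF_core hd one_pos (lieEq_one hlam hB) hγ i hx ?_ hy
  intro j y hy
  rcases eq_single_of_ht_eq_one hγ hx with rfl | ⟨m, rfl⟩
  · simp
  by_cases hj : m = j
  · subst hj
    have hm := B_e_f hlam hB m
    obtain ⟨c, rfl⟩ := D.W_single hx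
    obtain ⟨c', rfl⟩ := D.W_neg_single (i := i) (by convert hy using 2; abel)
    have h1 : ⁅⁅c • D.e m, D.f m⁆, c' • D.f i⁆
        = -(c * c' * D.root i (D.coroot m)) • D.f i := by
      rw [smul_lie, D.ef_same, smul_lie, lie_smul, D.hf]; module
    have h2 : ⁅D.f m, ⁅D.e i, c' • D.f i⁆⁆ = (c' * D.root m (D.coroot i)) • D.f m := by
      rw [lie_smul, D.ef_same, lie_smul, ← lie_skew, D.hf]; module
    rw [h1, h2, map_smul, map_smul, LinearMap.smul_apply]
    congr 1
    simp only [smul_eq_mul]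
    have := hd i m
    linear_combination (c * c' * B (D.e m) (D.f m)) * this
      + c * c' * D.root i (D.coroot m) * hm
  · obtain ⟨c, rfl⟩ := D.W_single hx
    rw [smul_lie, D.ef_ne m j hj]
    have h2 : ⁅D.e i, y⁆ = 0 :=
      W_diff_eq_zero (D := D) (i := j) (j := m) (Ne.symm hj) (D.lie_mem_W' (D.e_mem i) hy (by abel))
    rw [h2]
    simp

/-- The three statements need a common induction: the step for `LieFEqHt` uses invariance under `f`,
which comes from the mirrored `LieFEqHt` one height below, and conversely. -/
lemma lieEq_all [CharZero k] (hd : D.Symmetrizes d) (hlam : ∀ i, d i * lam (D.coroot i) = 1)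
    (hB : D.Recovers lam B) (hs : ∀ x y, B x y = B y x) (n : ℕ) :
    D.LieEqHt d B (n + 1) ∧ D.LieFEqHt d B (n + 1) ∧ D.mirror.LieFEqHt d B (n + 1) := by
  have hd' : D.mirror.Symmetrizes d := hd
  induction n with
  | zero =>
    refine ⟨?_, ?_, ?_⟩
    · simpa using lieEq_one hlam hB
    · simpa using lieFEq_one hd hlam hB
    · simpa using lieFEq_one (D := D.mirror) hd' hlam hB.mirror
  | succ n ih =>
    obtain ⟨h1, h2, h3⟩ := ih
    have h4 := inv_step hlam hB (by omega) h1 h2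
    have h5 := inv_step (D := D.mirror) hlam hB.mirror (by omega) (h1.mirror hs) h3
    push_cast
    exact ⟨h4.2, lieF_step hd hs (by omega) h4.2 h2 h5.1,
      lieF_step (D := D.mirror) hd' hs (by omega) h5.2 h3 (by rw [mirror_mirror]; exact h4.1)⟩

lemma lieEq_of_ne [CharZero k] (hd : D.Symmetrizes d) (hlam : ∀ i, d i * lam (D.coroot i) = 1)
    (hB : D.Recovers lam B) (hs : ∀ x y, B x y = B y x) {γ : I →₀ ℤ} (hγ : γ ≠ 0) {x y : L}
    (hx : x ∈ D.W γ) (hy : y ∈ D.W (-γ)) : ⁅x, y⁆ = B x y • D.h (D.nu d γ) := by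
  have pos : ∀ γ : I →₀ ℤ, 0 < ht γ → D.LieEqHt d B (ht γ) := by
    intro γ h
    have := (lieEq_all hd hlam hB hs (ht γ - 1).toNat).1
    rwa [show (((ht γ - 1).toNat : ℤ) + 1) = ht γ by omega] at this
  rcases D.W_sign hx with h | h | h | h
  · subst h; simp
  · exact pos γ (ht_pos h) γ rfl x hx y hy
  · exact absurd h hγ
  · have h1 : 0 < ht (-γ) := ht_pos (neg_pos.2 h)
    rw [← lie_skew, pos _ h1 (-γ) rfl y hy x (by rwa [neg_neg]), hs y x, nu_neg, map_neg]
    simp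

/-! ### The invariant form: invariance, construction, nondegeneracy -/

/-- An invariant symmetric bilinear form, normalized on the generators. -/
structure IsForm (D : KMData k I H L) (d : I → k) (B : L →ₗ[k] L →ₗ[k] k) : Prop where
  symm : ∀ x y, B x y = B y x
  inv : ∀ x y z, B ⁅x, y⁆ z = B x ⁅y, z⁆
  ortho : ∀ γ γ' : I →₀ ℤ, γ + γ' ≠ 0 → ∀ x ∈ D.W γ, ∀ y ∈ D.W γ', B x y = 0
  ef : ∀ i, d i * B (D.e i) (D.f i) = 1
  coroot : ∀ i y, d i * B (D.h (D.coroot i)) (D.h y) = D.root i y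
  lie_eq : ∀ γ : I →₀ ℤ, γ ≠ 0 → ∀ x ∈ D.W γ, ∀ y ∈ D.W (-γ), ⁅x, y⁆ = B x y • D.h (D.nu d γ)
  nondeg : ∀ x, (∀ y, B x y = 0) → x = 0

/-- Only weights with a + α_i + c = 0 matter. If `x` is positive this is `hinv`; if `x` lies in H it
is the normalization on generators. If `x` is negative, a height count shows that `z` cannot be
negative as well, and symmetry exchanges the roles of `x` and `z`. -/
lemma inv_e [CharZero k] (hd0 : ∀ i, d i ≠ 0) (hs : ∀ x y, B x y = B y x)
    (hortho : ∀ γ γ' : I →₀ ℤ, γ + γ' ≠ 0 → ∀ x ∈ D.W γ, ∀ y ∈ D.W γ', B x y = 0)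
    (hef : ∀ i, d i * B (D.e i) (D.f i) = 1)
    (hco : ∀ i y, d i * B (D.h (D.coroot i)) (D.h y) = D.root i y)
    (hinv : ∀ n : ℕ, D.InvHt B (n + 1)) (i : I) (x z : L) :
    B ⁅x, D.e i⁆ z = B x ⁅D.e i, z⁆ := by
  have hinv' : ∀ γ : I →₀ ℤ, 0 < γ → ∀ x ∈ D.W γ, ∀ y ∈ D.W (-γ - Finsupp.single i 1),
      B ⁅D.e i, x⁆ y = -B x ⁅D.e i, y⁆ := by
    intro γ hγ x hx y hy
    have h1 := ht_pos hγ
    have := hinv (ht γ - 1).toNat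
    rw [show (((ht γ - 1).toNat : ℤ) + 1) = ht γ by omega] at this
    exact this γ i rfl x hx y hy
  have hzero : ∀ y : H, ∀ w ∈ D.W (-Finsupp.single i 1),
      B ⁅D.h y, D.e i⁆ w = B (D.h y) ⁅D.e i, w⁆ := by
    intro y w hw
    obtain ⟨c, rfl⟩ := D.W_neg_single hw
    rw [D.he, lie_smul, D.ef_same, map_smul, map_smul, map_smul, LinearMap.smul_apply, hs (D.h y),
      smul_eq_mul, smul_eq_mul, smul_eq_mul]
    refine mul_left_cancel₀ (hd0 i) ?_
    linear_combination (c * D.root i y) * hef i - c * hco i y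
  induction x using D.hom_induction with
  | hadd a b ha hb => simp only [add_lie, map_add, LinearMap.add_apply, ha, hb]
  | hW a x hx =>
  induction z using D.hom_induction with
  | hadd a b ha hb => simp only [lie_add, map_add, ha, hb]
  | hW c z hz =>
  by_cases hac : a + Finsupp.single i 1 + c = 0
  swap
  · rw [hortho _ _ hac _ (D.lie_mem_W hx (D.e_mem i)) z hz,
      hortho a (Finsupp.single i 1 + c) (by rwa [← add_assoc]) x hx _
        (D.lie_mem_W (D.e_mem i) hz)]
  have hc : c = -a - Finsupp.single i 1 := by
    rw [← sub_eq_zero, ← hac]; abel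
  have ha : a = -c - Finsupp.single i 1 := by
    rw [← sub_eq_zero, ← hac]; abel
  rcases D.W_sign hx with h | h | h | h
  · subst h; simp
  · rw [← lie_skew, map_neg, LinearMap.neg_apply, hinv' a h x hx z (hc ▸ hz), neg_neg]
  · subst h
    obtain ⟨y, rfl⟩ := D.W_zero hx
    exact hzero y z (by rw [neg_zero, zero_sub] at hc; exact hc ▸ hz)
  rcases D.W_sign hz with h' | h' | h' | h'
  · subst h'; simp
  · rw [hs x, hinv' c h' z hz x (ha ▸ hx), hs _ z, ← lie_skew x, map_neg]
  · subst h'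
    obtain ⟨y, rfl⟩ := D.W_zero hz
    rw [neg_zero, zero_sub] at ha
    have := hzero y x (ha ▸ hx)
    rw [← lie_skew x, ← lie_skew _ (D.h y), hs, map_neg, map_neg, ← this, hs]
  · exfalso
    have h1 := ht_pos (neg_pos.2 h)
    have h2 := ht_pos (neg_pos.2 h')
    have h3 := congrArg ht hac
    rw [map_add, map_add, ht_single, map_zero] at h3
    rw [map_neg] at h1 h2
    omega

section construction

variable [CharZero k]

/-- The `H`-coordinate of an element of `L`. -/
def hcoord (D : KMData k I H L) : L →ₗ[k] H :=
  (LinearMap.exists_leftInverse_of_injective D.h (LinearMap.ker_eq_bot.2 D.h_inj)).choose ∘ₗ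
    D.proj {0}

lemma hcoord_h (y : H) : D.hcoord (D.h y) = y := by
  rw [hcoord, LinearMap.comp_apply, D.proj_of_mem (D.h_mem y) (Set.mem_singleton 0)]
  exact LinearMap.congr_fun
    (LinearMap.exists_leftInverse_of_injective D.h (LinearMap.ker_eq_bot.2 D.h_inj)).choose_spec y

lemma hcoord_of_ne {γ : I →₀ ℤ} (hγ : γ ≠ 0) {x : L} (hx : x ∈ D.W γ) : D.hcoord x = 0 := by
  rw [hcoord, LinearMap.comp_apply, D.proj_of_notMem hx (by simpa using hγ), map_zero]

variable (D) in
/-- The bilinear form determined by its restriction `S` to `H` and a functional `lam` on `H`. -/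
def formOf (lam : Module.Dual k H) (S : H →ₗ[k] H →ₗ[k] k) : L →ₗ[k] L →ₗ[k] k :=
  -- At weight 0 the scalar is `0⁻¹ = 0`, so the first summand vanishes on H and `S` alone is seen
  -- there; `hcoord` kills all other weights in the second summand.
  LinearMap.mk₂ k (fun x y => lam (D.hcoord ⁅D.scale (fun γ => ((ht γ : ℤ) : k)⁻¹) x, y⁆)
      + S (D.hcoord x) (D.hcoord y))
    (by intro a b c; simp only [map_add, add_lie, LinearMap.add_apply]; ring)
    (by intro c a b; simp only [map_smul, smul_lie, LinearMap.smul_apply, smul_add])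
    (by intro a b c; simp only [map_add, lie_add]; ring)
    (by intro c a b; simp only [map_smul, lie_smul, smul_add])

lemma formOf_apply (S : H →ₗ[k] H →ₗ[k] k) (x y : L) : D.formOf lam S x y =
    lam (D.hcoord ⁅D.scale (fun γ => ((ht γ : ℤ) : k)⁻¹) x, y⁆)
      + S (D.hcoord x) (D.hcoord y) := rfl

lemma formOf_h (S : H →ₗ[k] H →ₗ[k] k) (x y : H) : D.formOf lam S (D.h x) (D.h y) = S x y := by
  rw [formOf_apply, D.scale_apply _ (D.h_mem x)]
  simp [hcoord_h]

lemma formOf_ne (S : H →ₗ[k] H →ₗ[k] k) {γ : I →₀ ℤ} (hγ : γ ≠ 0) {x : L} (hx : x ∈ D.W γ)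
    (y : L) : D.formOf lam S x y = ((ht γ : ℤ) : k)⁻¹ * lam (D.hcoord ⁅x, y⁆) := by
  rw [formOf_apply, D.scale_apply _ hx, hcoord_of_ne hγ hx]
  simp

lemma formOf_ortho (S : H →ₗ[k] H →ₗ[k] k) {γ γ' : I →₀ ℤ} (h : γ + γ' ≠ 0) {x y : L}
    (hx : x ∈ D.W γ) (hy : y ∈ D.W γ') : D.formOf lam S x y = 0 := by
  by_cases hγ : γ = 0
  · subst hγ
    obtain ⟨z, rfl⟩ := D.W_zero hx
    rw [zero_add] at h
    rw [formOf_apply, D.scale_apply _ hx, hcoord_of_ne h hy]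
    simp
  · rw [formOf_ne S hγ hx, hcoord_of_ne h (D.lie_mem_W hx hy)]
    simp

lemma formOf_symm (S : H →ₗ[k] H →ₗ[k] k) (hS : ∀ x y, S x y = S y x) (x y : L) :
    D.formOf lam S x y = D.formOf lam S y x := by
  induction x using D.hom_induction with
  | hadd a b ha hb => simp only [map_add, LinearMap.add_apply, ha, hb]
  | hW a x hx =>
  induction y using D.hom_induction with
  | hadd a b ha hb => simp only [map_add, LinearMap.add_apply, ha, hb]
  | hW c y hy =>
  by_cases hac : a + c = 0
  swap
  · rw [formOf_ortho S hac hx hy, formOf_ortho S (by rwa [add_comm]) hy hx]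
  have hc : c = -a := by rw [eq_neg_iff_add_eq_zero, add_comm]; exact hac
  by_cases ha : a = 0
  · subst ha
    rw [neg_zero] at hc
    subst hc
    obtain ⟨u, rfl⟩ := D.W_zero hx
    obtain ⟨v, rfl⟩ := D.W_zero hy
    rw [formOf_h, formOf_h, hS]
  · rw [formOf_ne S ha hx, formOf_ne S (by rw [hc]; simpa using ha) hy, hc, ← lie_skew]
    rw [map_neg, map_neg, map_neg, Int.cast_neg, inv_neg]
    ring

lemma formOf_recovers (S : H →ₗ[k] H →ₗ[k] k) : D.Recovers lam (D.formOf lam S) := by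
  intro γ x hx y hy z hz
  by_cases hγ : γ = 0
  · subst hγ
    rw [neg_zero] at hy
    obtain ⟨u, rfl⟩ := D.W_zero hx
    obtain ⟨v, rfl⟩ := D.W_zero hy
    rw [D.hh] at hz
    rw [D.h_inj (hz.symm.trans (map_zero D.h).symm)]
    simp
  · rw [formOf_ne S hγ hx, hz, hcoord_h]
    rcases D.W_sign hx with h | h | h | h
    · subst h
      rw [zero_lie] at hz
      rw [D.h_inj (hz.symm.trans (map_zero D.h).symm)]
      simp
    · have := (ht_pos h).ne'
      field_simp
    · exact absurd h hγ
    · have h1 := ht_pos (neg_pos.2 h)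
      rw [map_neg] at h1
      have : ht γ ≠ 0 := by omega
      field_simp

/-- Existence of the standard invariant form. -/
theorem exists_form (hd : D.Symmetrizes d) (hd0 : ∀ i, d i ≠ 0)
    (hco : LinearIndependent k D.coroot) (S : H →ₗ[k] H →ₗ[k] k) (hS : ∀ x y, S x y = S y x)
    (hSco : ∀ i y, d i * S (D.coroot i) y = D.root i y) (hSn : ∀ x, (∀ y, S x y = 0) → x = 0)
    (hideal : ∀ N : Submodule k L, (∀ z : L, ∀ x ∈ N, ⁅z, x⁆ ∈ N) → (∀ y, D.h y ∈ N → y = 0) →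
      N = ⊥) :
    ∃ B, D.IsForm d B := by
  -- The coroots are independent, so values on them may be prescribed; `lam` plays the part of
  -- pairing with a Weyl vector.
  obtain ⟨lam, hlam⟩ : ∃ lam : Module.Dual k H, ∀ i, d i * lam (D.coroot i) = 1 := by
    obtain ⟨g, hg⟩ := LinearMap.exists_leftInverse_of_injective
      (Finsupp.linearCombination k D.coroot) (LinearMap.ker_eq_bot.2 hco)
    refine ⟨Finsupp.linearCombination k (fun i => (d i)⁻¹) ∘ₗ g, fun i => ?_⟩
    have := LinearMap.congr_fun hg (Finsupp.single i 1)
    rw [LinearMap.comp_apply, Finsupp.linearCombination_single, one_smul] at this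
    rw [LinearMap.comp_apply, this]
    simp [hd0]
  set B := D.formOf lam S with hBdef
  have hB : D.Recovers lam B := formOf_recovers S
  have hs : ∀ x y, B x y = B y x := formOf_symm S hS
  have hd' : D.mirror.Symmetrizes d := hd
  have hortho : ∀ γ γ' : I →₀ ℤ, γ + γ' ≠ 0 → ∀ x ∈ D.W γ, ∀ y ∈ D.W γ', B x y = 0 :=
    fun γ γ' h x hx y hy => formOf_ortho S h hx hy
  have hBh : ∀ i y, d i * B (D.h (D.coroot i)) (D.h y) = D.root i y := by
    intro i y
    rw [hBdef, formOf_h, hSco]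
  have hef : ∀ i, d i * B (D.e i) (D.f i) = 1 := B_e_f hlam hB
  have hall := lieEq_all hd hlam hB hs
  have he := inv_e hd0 hs hortho hef hBh fun n =>
    (inv_step hlam hB (by omega) (hall n).1 (hall n).2.1).1
  -- For the mirrored data `f i` is the raising operator, and the same `B` satisfies all hypotheses.
  have hf : ∀ i x z, B ⁅x, D.f i⁆ z = B x ⁅D.f i, z⁆ := by
    refine inv_e (D := D.mirror) hd0 hs ?_ ?_ ?_ fun n =>
      (inv_step (D := D.mirror) hlam hB.mirror (by omega) ((hall n).1.mirror hs) (hall n).2.2).1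
    · intro γ γ' h x hx y hy
      rw [mirror_W] at hx hy
      exact hortho _ _ (by rw [← neg_add]; exact neg_ne_zero.2 h) x hx y hy
    · intro i
      rw [hs]; exact hef i
    · intro i y
      simpa using hBh i y
  -- The `y` for which this holds form a subalgebra, so generators suffice. For `h y` it says that
  -- `B` pairs only opposite weights.
  have hinv : ∀ y x z, B ⁅x, y⁆ z = B x ⁅y, z⁆ := by
    intro y
    induction y using D.gen_induction with
    | he i => exact he i
    | hf i => exact hf i
    | h0 => simp
    | hadd a b ha hb => intro x z; simp only [lie_add, add_lie, map_add, LinearMap.add_apply, ha, hb]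
    | hsmul c a ha => intro x z; simp only [lie_smul, smul_lie, map_smul, LinearMap.smul_apply, ha]
    | hlie a b ha hb =>
      intro x z
      have e1 : B ⁅⁅x, a⁆, b⁆ z = B x ⁅a, ⁅b, z⁆⁆ := by rw [hb, ha]
      have e2 : B ⁅⁅x, b⁆, a⁆ z = B x ⁅b, ⁅a, z⁆⁆ := by rw [ha, hb]
      rw [lie_lie a b z, leibniz_lie x a b, ← lie_skew a ⁅x, b⁆, map_sub, map_add, map_neg,
        LinearMap.add_apply, LinearMap.neg_apply, e1, e2, sub_eq_add_neg]
    | hh y =>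
      intro x z
      induction x using D.hom_induction with
      | hadd a b ha hb => simp only [add_lie, map_add, LinearMap.add_apply, ha, hb]
      | hW a x hx =>
      induction z using D.hom_induction with
      | hadd a b ha hb => simp only [lie_add, map_add, ha, hb]
      | hW c z hz =>
      rw [← lie_skew, hx, hz, map_neg, map_smul, map_smul, LinearMap.neg_apply,
        LinearMap.smul_apply]
      by_cases hac : a + c = 0
      · have hc : c = -a := by rw [eq_neg_iff_add_eq_zero, add_comm]; exact hac
        rw [hc, ev_neg, neg_smul]
      · rw [hortho a c hac x hx z hz]; simp
  -- By invariance the radical is an ideal, and it meets H trivially because `S` is nondegenerate.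
  have hnd : ∀ x, (∀ y, B x y = 0) → x = 0 := by
    have hN := hideal (LinearMap.ker B)
      (by
        intro z x hx
        rw [LinearMap.mem_ker] at hx ⊢
        ext y
        rw [← lie_skew, map_neg, LinearMap.neg_apply, hinv, hx]; simp)
      (by
        intro y hy
        refine hSn y fun z => ?_
        rw [LinearMap.mem_ker] at hy
        have := LinearMap.congr_fun hy (D.h z)
        rwa [hBdef, formOf_h] at this)
    intro x hx
    have : x ∈ LinearMap.ker B := by
      rw [LinearMap.mem_ker]; ext y; exact hx y
    rw [hN] at this
    simpa using this
  exact ⟨B, hs, fun x y z => hinv y x z, hortho, hef, hBh,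
    fun γ hγ x hx y hy => lieEq_of_ne hd hlam hB hs hγ hx hy, hnd⟩

end construction

end KMData

end KacMoody

/-! ### Separating tensors by functionals; coalgebras by transposition -/

namespace LieBi

section Pairing

variable {k : Type*} [Field k] {V W X Y : Type*} [AddCommGroup V] [Module k V]
  [AddCommGroup W] [Module k W]

@[simp] lemma tensorDual_tmul (φ : Module.Dual k V) (ψ : Module.Dual k W) (a : V) (b : W) :
    tensorDual φ ψ (a ⊗ₜ[k] b) = φ a * ψ b := by
  simp [tensorDual]

lemma tensorDual_add_left (φ φ' : Module.Dual k V) (ψ : Module.Dual k W) (t : V ⊗[k] W) :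
    tensorDual (φ + φ') ψ t = tensorDual φ ψ t + tensorDual φ' ψ t := by
  simp [tensorDual, TensorProduct.map_add_left]

lemma tensorDual_add_right (φ : Module.Dual k V) (ψ ψ' : Module.Dual k W) (t : V ⊗[k] W) :
    tensorDual φ (ψ + ψ') t = tensorDual φ ψ t + tensorDual φ ψ' t := by
  simp [tensorDual, TensorProduct.map_add_right]

lemma tensorDual_smul_left (c : k) (φ : Module.Dual k V) (ψ : Module.Dual k W) (t : V ⊗[k] W) :
    tensorDual (c • φ) ψ t = c * tensorDual φ ψ t := by
  simp [tensorDual, TensorProduct.map_smul_left]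

lemma tensorDual_smul_right (c : k) (φ : Module.Dual k V) (ψ : Module.Dual k W)
    (t : V ⊗[k] W) : tensorDual φ (c • ψ) t = c * tensorDual φ ψ t := by
  simp [tensorDual, TensorProduct.map_smul_right]

lemma tensorDual_zero_left (ψ : Module.Dual k W) (t : V ⊗[k] W) :
    tensorDual (0 : Module.Dual k V) ψ t = 0 := by
  simpa using tensorDual_smul_left (0 : k) (0 : Module.Dual k V) ψ t

lemma tensorDual_comm (φ : Module.Dual k V) (ψ : Module.Dual k W) (t : W ⊗[k] V) :
    tensorDual φ ψ (TensorProduct.comm k W V t) = tensorDual ψ φ t := by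
  induction t using TensorProduct.induction_on with
  | zero => simp
  | tmul a b => simp [mul_comm]
  | add a b ha hb => simp only [map_add, ha, hb]

lemma tensorDual_map {V' W' : Type*} [AddCommGroup V'] [Module k V'] [AddCommGroup W']
    [Module k W'] (φ : Module.Dual k V) (ψ : Module.Dual k W) (f : V' →ₗ[k] V)
    (g : W' →ₗ[k] W) (t : V' ⊗[k] W') :
    tensorDual φ ψ (TensorProduct.map f g t) = tensorDual (φ ∘ₗ f) (ψ ∘ₗ g) t := by
  induction t using TensorProduct.induction_on with
  | zero => simp
  | tmul a b => simp
  | add a b ha hb => simp only [map_add, ha, hb]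

/-- Contracting the first factor with `F x` gives zero because `G` separates `W`. Hence each
coordinate of `t` along a basis of `W` is an element of `V` killed by every `F x`. No finiteness is
needed, and the families need not be linear in their indices. -/
lemma tensor_sep {F : X → Module.Dual k V} {G : Y → Module.Dual k W}
    (hF : ∀ v, (∀ x, F x v = 0) → v = 0) (hG : ∀ w, (∀ y, G y w = 0) → w = 0) {t : V ⊗[k] W}
    (h : ∀ x y, tensorDual (F x) (G y) t = 0) : t = 0 := by
  classical
  let c := Module.Basis.ofVectorSpace k W
  have h1 : ∀ x, (TensorProduct.lid k W).toLinearMap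
      (TensorProduct.map (F x) LinearMap.id t) = 0 := by
    intro x
    refine hG _ fun y => ?_
    rw [← h x y]
    -- The identity is valid for every tensor, so `t` is freed from the hypothesis `h` before the
    -- induction.
    generalize t = t
    induction t using TensorProduct.induction_on with
    | zero => simp
    | tmul a b => simp
    | add a b ha hb => simp only [map_add, ha, hb]
  have h2 : ∀ i, (TensorProduct.rid k V).toLinearMap
      (TensorProduct.map LinearMap.id (c.coord i) t) = 0 := by
    intro i
    refine hF _ fun x => ?_
    have := congrArg (c.coord i) (h1 x)
    rw [map_zero] at this
    rw [← this]
    generalize t = t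
    induction t using TensorProduct.induction_on with
    | zero => simp
    | tmul a b => simp [mul_comm]
    | add a b ha hb => simp only [map_add, ha, hb]
  apply (TensorProduct.equivFinsuppOfBasisRight c).injective
  rw [map_zero]
  ext i
  rw [Finsupp.zero_apply, ← h2 i]
  generalize t = t
  induction t using TensorProduct.induction_on with
  | zero => simp
  | tmul a b => simp [TensorProduct.equivFinsuppOfBasisRight_apply_tmul]
  | add a b ha hb => simp only [map_add, Finsupp.add_apply, ha, hb]

lemma tensor_ext {F : X → Module.Dual k V} {G : Y → Module.Dual k W}
    (hF : ∀ v, (∀ x, F x v = 0) → v = 0) (hG : ∀ w, (∀ y, G y w = 0) → w = 0)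
    {t t' : V ⊗[k] W} (h : ∀ x y, tensorDual (F x) (G y) t = tensorDual (F x) (G y) t') :
    t = t' := by
  rw [← sub_eq_zero]
  exact tensor_sep hF hG fun x y => by rw [map_sub, h, sub_self]

lemma tensor_sep' {F : X → Module.Dual k V} {G : Y → Module.Dual k W}
    (hF : ∀ v, (∀ x, F x v = 0) → v = 0) (hG : ∀ w, (∀ y, G y w = 0) → w = 0) (t : V ⊗[k] W)
    (h : ∀ p : X × Y, tensorDual (F p.1) (G p.2) t = 0) : t = 0 :=
  tensor_sep hF hG fun x y => h (x, y)

/-- The coalgebra axioms are the transposes of antisymmetry and Jacobi for `s`. These are required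
only after applying `F`, so `s` need not itself be a Lie bracket on the index set. -/
lemma isLieCoalgebra_of_pairing {F : X → Module.Dual k V} (hF : ∀ v, (∀ x, F x v = 0) → v = 0)
    {δ : V →ₗ[k] V ⊗[k] V} (s : X → X → X)
    (hδ : ∀ u v x, tensorDual (F u) (F v) (δ x) = F (s u v) x)
    (anti : ∀ u v x, F (s u v) x + F (s v u) x = 0)
    (jac : ∀ u v w x, F (s (s u v) w) x + F (s (s w u) v) x + F (s (s v w) u) x = 0) :
    IsLieCoalgebra δ where
  anticocomm x := by
    refine tensor_sep hF hF fun u v => ?_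
    rw [map_add, tensorDual_comm, hδ, hδ, anti]
  coJacobi x := by
    have h1 : ∀ u v w, tensorDual (tensorDual (F u) (F v)) (F w)
        (TensorProduct.map δ LinearMap.id (δ x)) = F (s (s u v) w) x := by
      intro u v w
      rw [tensorDual_map, ← hδ]
      congr 2
      ext y
      simp [hδ]
    have h2 : ∀ u v w (z : (V ⊗[k] V) ⊗[k] V), tensorDual (tensorDual (F u) (F v)) (F w)
        (cyc k V z) = tensorDual (tensorDual (F w) (F u)) (F v) z := by
      intro u v w z
      induction z using TensorProduct.induction_on with
      | zero => simp
      | add a b ha hb => simp only [map_add, ha, hb]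
      | tmul t c =>
        induction t using TensorProduct.induction_on with
        | zero => simp
        | add a b ha hb => simp only [TensorProduct.add_tmul, map_add, ha, hb]
        | tmul a b => simp [cyc]; ring
    refine tensor_sep (F := fun p : X × X => tensorDual (F p.1) (F p.2)) (tensor_sep' hF hF) hF ?_
    rintro ⟨u, v⟩ w
    rw [map_add, map_add, h2, h2, h2, h1, h1, h1, jac]

end Pairing

end LieBi

namespace KacMoody

open LieBi

/-! ### The r-bracket and the cobracket dual to it -/

namespace KMData

variable {k I H L : Type*} [Field k] [CharZero k] [Fintype I] [AddCommGroup H] [Module k H]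
  [LieRing L] [LieAlgebra k L] (D : KMData k I H L)

lemma single_pos {I : Type*} [Fintype I] (i : I) : (0 : I →₀ ℤ) < Finsupp.single i 1 := by
  rw [← lwt_nil]; exact lwt_pos _ _

open Classical in
/-- The scalars by which `T` acts on the weight spaces. -/
def wT (k : Type*) {I : Type*} [Field k] (γ : I →₀ ℤ) : k :=
  if 0 < γ then 1 else if γ = 0 then 1 / 2 else 0

lemma wT_pos {γ : I →₀ ℤ} (h : 0 < γ) : wT k γ = 1 := if_pos h
lemma wT_zero : wT k (0 : I →₀ ℤ) = 1 / 2 := by simp [wT]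
lemma wT_neg {γ : I →₀ ℤ} (h : γ < 0) : wT k γ = 0 := by
  rw [wT, if_neg h.le.not_gt, if_neg h.ne]

/-- The projection onto the positive part plus half the projection onto `H`. -/
def T : L →ₗ[k] L := D.scale (wT k)

/-- The bracket on `L` dual to the cobracket. -/
def star (u v : L) : L := ⁅u - D.T u, v - D.T v⁆ - ⁅D.T u, D.T v⁆

lemma star_add_left (u u' v : L) : D.star (u + u') v = D.star u v + D.star u' v := by
  simp only [star, map_add, add_sub_add_comm, add_lie]
lemma star_add_right (u v v' : L) : D.star u (v + v') = D.star u v + D.star u v' := by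
  simp only [star, map_add, add_sub_add_comm, lie_add]
lemma star_zero_left (v : L) : D.star 0 v = 0 := by simp [star]
lemma star_zero_right (v : L) : D.star v 0 = 0 := by simp [star]

lemma star_skew (u v : L) : D.star u v = -D.star v u := by
  rw [star, star, ← lie_skew, ← lie_skew (D.T u)]; abel

lemma star_eq (u v : L) : D.star u v = ⁅u, v⁆ - ⁅D.T u, v⁆ - ⁅u, D.T v⁆ := by
  simp only [star, sub_lie, lie_sub]; abel

/-- On weight vectors `star` is the bracket times 1 - wT a - wT b, and the claim is checked sign by
sign. The value 1/2 on H is harmless because H is commutative. Thus `T` and 1 - `T` carry `star` to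
minus the bracket and to the bracket. -/
lemma T_star (u v : L) : D.T (D.star u v) = -⁅D.T u, D.T v⁆ := by
  induction u using D.hom_induction with
  | hadd a b ha hb => simp only [star_add_left, map_add, add_lie, ha, hb, neg_add]
  | hW a u hu =>
  induction v using D.hom_induction with
  | hadd a b ha hb => simp only [star_add_right, map_add, lie_add, ha, hb, neg_add]
  | hW b v hv =>
  have huv := D.lie_mem_W hu hv
  rw [star_eq, T, D.scale_apply _ hu, D.scale_apply _ hv, smul_lie, lie_smul, lie_smul, smul_lie,
    map_sub, map_sub, map_smul, map_smul, D.scale_apply _ huv]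
  rcases D.W_sign hu with h | h | h | h
  · subst h; simp
  · rcases D.W_sign hv with h' | h' | h' | h'
    · subst h'; simp
    · rw [wT_pos h, wT_pos h', wT_pos (add_pos h h')]; module
    · subst h'; rw [add_zero, wT_pos h, wT_zero]; module
    · rw [wT_pos h, wT_neg h']; module
  · subst h
    rcases D.W_sign hv with h' | h' | h' | h'
    · subst h'; simp
    · rw [zero_add, wT_pos h', wT_zero]; module
    · subst h'
      obtain ⟨y, rfl⟩ := D.W_zero hu
      obtain ⟨z, rfl⟩ := D.W_zero hv
      simp [D.hh]
    · rw [zero_add, wT_neg h', wT_zero]; module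
  · rcases D.W_sign hv with h' | h' | h' | h'
    · subst h'; simp
    · rw [wT_neg h, wT_pos h']; module
    · subst h'; rw [add_zero, wT_neg h, wT_zero]; module
    · rw [wT_neg h, wT_neg h', wT_neg (add_neg h h')]; module

/-- By `T_star` the double product is [[u₋, v₋], w₋] + [[u₊, v₊], w₊], and each summand satisfies
the Jacobi identity in `L`. -/
lemma star_jacobi (u v w : L) :
    D.star (D.star u v) w + D.star (D.star w u) v + D.star (D.star v w) u = 0 := by
  have key : ∀ u v w, D.star (D.star u v) w
      = ⁅⁅u - D.T u, v - D.T v⁆, w - D.T w⁆ + ⁅⁅D.T u, D.T v⁆, D.T w⁆ := by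
    intro u v w
    have h1 : D.star u v - D.T (D.star u v) = ⁅u - D.T u, v - D.T v⁆ := by
      rw [T_star, star]; abel
    rw [star, h1, T_star, neg_lie, sub_neg_eq_add]
  have jac : ∀ a b c : L, ⁅⁅a, b⁆, c⁆ + ⁅⁅c, a⁆, b⁆ + ⁅⁅b, c⁆, a⁆ = 0 := by
    intro a b c
    have := lie_jacobi a b c
    rw [← lie_skew a ⁅b, c⁆, ← lie_skew b ⁅c, a⁆, ← lie_skew c ⁅a, b⁆] at this
    rw [← neg_eq_zero, ← this]; abel
  rw [key, key, key]
  have h1 := jac (u - D.T u) (v - D.T v) (w - D.T w)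
  have h2 := jac (D.T u) (D.T v) (D.T w)
  rw [← add_zero (0 : L)]
  nth_rw 1 [← h1]
  rw [← h2]
  abel

variable {D} {d : I → k} {B : L →ₗ[k] L →ₗ[k] k}

namespace IsForm

variable (hF : D.IsForm d B)
include hF

lemma nondeg' (x : L) (h : ∀ y, B y x = 0) : x = 0 :=
  hF.nondeg x fun y => by rw [hF.symm, h]

lemma inv_left (x y z : L) : B ⁅x, y⁆ z = -B y ⁅x, z⁆ := by
  rw [← lie_skew, map_neg, LinearMap.neg_apply, hF.inv]

lemma scale_adjoint (w : (I →₀ ℤ) → k) (u v : L) :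
    B (D.scale w u) v = B u (D.scale (fun γ => w (-γ)) v) := by
  induction u using D.hom_induction with
  | hadd a b ha hb => simp only [map_add, LinearMap.add_apply, ha, hb]
  | hW a u hu =>
  induction v using D.hom_induction with
  | hadd a b ha hb => simp only [map_add, ha, hb]
  | hW c v hv =>
  rw [D.scale_apply _ hu, D.scale_apply _ hv, map_smul, map_smul, LinearMap.smul_apply]
  by_cases hac : a + c = 0
  · rw [eq_neg_of_add_eq_zero_left hac]
  · rw [hF.ortho a c hac u hu v hv]; simp

lemma proj_adjoint (A : Set (I →₀ ℤ)) (u v : L) :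
    B (D.proj A u) v = B u (D.proj (-A) v) := by
  rw [proj, hF.scale_adjoint, proj]
  congr 3

/-- `B` pairs opposite weights, and wT γ + wT (-γ) = 1 on every weight that occurs. So the adjoint
of `T` is 1 - `T`. -/
lemma T_adjoint (u v : L) : B (D.T u) v = B u (v - D.T v) := by
  induction u using D.hom_induction with
  | hadd a b ha hb => simp only [map_add, LinearMap.add_apply, ha, hb]
  | hW a u hu =>
  induction v using D.hom_induction with
  | hadd a b ha hb => simp only [map_add, add_sub_add_comm, ha, hb]
  | hW c v hv =>
  rw [T, D.scale_apply _ hu, D.scale_apply _ hv, map_sub, map_smul, map_smul, LinearMap.smul_apply]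
  by_cases hac : a + c = 0
  · rw [add_comm] at hac
    rw [eq_neg_of_add_eq_zero_left hac]
    rcases D.W_sign hu with h | h | h | h
    · subst h; simp
    · rw [wT_pos h, wT_neg (neg_neg_of_pos h)]; module
    · subst h; rw [neg_zero, wT_zero]; module
    · rw [wT_neg h, wT_pos (neg_pos.2 h)]; module
  · rw [hF.ortho a c hac u hu v hv]; simp

lemma star_apply (u v x : L) : B (D.star u v) x = B u (⁅x, D.T v⁆ - D.T ⁅x, v⁆) := by
  rw [star_eq, map_sub, map_sub, LinearMap.sub_apply, LinearMap.sub_apply, hF.inv, hF.inv, hF.inv,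
    hF.T_adjoint, ← lie_skew x, ← lie_skew x v, map_neg]
  simp only [map_sub, map_neg]
  ring

lemma pair_lie (u v x : L) (t : L ⊗[k] L) : tensorDual (B u) (B v) ⁅x, t⁆
    = -tensorDual (B ⁅x, u⁆) (B v) t - tensorDual (B u) (B ⁅x, v⁆) t := by
  induction t using TensorProduct.induction_on with
  | zero => simp
  | add a b ha hb => simp only [lie_add, map_add, ha, hb]; ring
  | tmul a b =>
    rw [TensorProduct.LieModule.lie_tmul_right, map_add]
    simp only [tensorDual_tmul, hF.inv_left]
    ring

/-- By `star_apply` the pairing is B(u, [ad x, T] v), and x ↦ [ad x, T] is an inner 1-cocycle. This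
is the cocycle law of the cobracket in dual form. -/
lemma star_apply_lie (u v x y : L) : B (D.star u v) ⁅x, y⁆
    = -B (D.star ⁅x, u⁆ v) y - B (D.star u ⁅x, v⁆) y
      + B (D.star ⁅y, u⁆ v) x + B (D.star u ⁅y, v⁆) x := by
  simp only [hF.star_apply, hF.inv_left]
  rw [← map_neg, ← map_neg, ← map_neg, ← map_sub, ← map_add, ← map_add]
  congr 1
  simp only [lie_lie, lie_sub, map_sub]
  abel

/-- Adding α_i to a weight changes `wT` only at weights 0 and -α_i, each time by 1/2. The commutator
therefore has finite rank, and its two terms are those of (d_i/2) e_i ∧ h_i. -/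
lemma T_comm_e (i : I) (v : L) : ⁅D.e i, D.T v⁆ - D.T ⁅D.e i, v⁆
    = (d i / 2) • (B v (D.h (D.coroot i)) • D.e i - B v (D.e i) • D.h (D.coroot i)) := by
  induction v using D.hom_induction with
  | hadd a b ha hb =>
    simp only [map_add, LinearMap.add_apply, lie_add, add_sub_add_comm, ha, hb]; module
  | hW c v hv =>
  have hev := D.lie_mem_W (D.e_mem i) hv
  rw [T, D.scale_apply _ hv, D.scale_apply _ hev, lie_smul]
  by_cases h0 : c = 0
  · subst h0
    obtain ⟨y, rfl⟩ := D.W_zero hv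
    have h1 : B (D.h y) (D.e i) = 0 :=
      hF.ortho 0 _ (by simp) _ hv _ (D.e_mem i)
    have h2 := hF.coroot i y
    rw [h1, hF.symm (D.h y), add_zero, wT_zero, wT_pos (single_pos i), ← lie_skew, D.he, ← h2]
    module
  have h1 : B v (D.h (D.coroot i)) = 0 := hF.ortho c 0 (by simpa using h0) _ hv _ (D.h_mem _)
  rw [h1]
  by_cases hi : c = -Finsupp.single i 1
  · subst hi
    obtain ⟨c', rfl⟩ := D.W_neg_single hv
    have h2 := hF.ef i
    rw [lie_smul, D.ef_same, add_neg_cancel, wT_zero, wT_neg, hF.symm, map_smul, smul_eq_mul]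
    · rw [show (d i / 2) • ((0 : k) • D.e i - (c' * B (D.e i) (D.f i)) • D.h (D.coroot i))
        = -(c' * (d i * B (D.e i) (D.f i)) / 2) • D.h (D.coroot i) by module, h2]
      module
    · exact neg_neg_of_pos (single_pos i)
  have h2 : B v (D.e i) = 0 :=
    hF.ortho c _ (by rwa [Ne, add_eq_zero_iff_eq_neg]) _ hv _ (D.e_mem i)
  rw [h2]
  rcases D.W_sign hv with h | h | h | h
  · subst h; simp
  · rw [wT_pos h, wT_pos (add_pos (single_pos i) h)]; simp
  · exact absurd h h0
  · rcases D.W_sign hev with h' | h' | h' | h'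
    · rw [h']; simp
    · have e1 := ht_pos (neg_pos.2 h)
      have e2 := ht_pos h'
      rw [map_add, ht_single] at e2
      rw [map_neg] at e1
      omega
    · exact absurd (by rw [add_comm] at h'; exact eq_neg_of_add_eq_zero_left h') hi
    · rw [wT_neg h, wT_neg h']; simp

lemma mirror : D.mirror.IsForm d B where
  symm := hF.symm
  inv := hF.inv
  ortho := by
    intro γ γ' h x hx y hy
    rw [mirror_W] at hx hy
    exact hF.ortho _ _ (by rw [← neg_add]; exact neg_ne_zero.2 h) x hx y hy
  ef i := by rw [hF.symm]; exact hF.ef i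
  coroot i y := by simpa using hF.coroot i y
  lie_eq := by
    intro γ h x hx y hy
    rw [mirror_W] at hx hy
    rw [hF.lie_eq (-γ) (neg_ne_zero.2 h) x hx y hy, nu_neg, mirror_nu]
    simp
  nondeg := hF.nondeg

omit hF in
lemma _root_.KacMoody.KMData.mirror_T (v : L) : D.mirror.T v = v - D.T v := by
  induction v using D.hom_induction with
  | hadd a b ha hb => simp only [map_add, add_sub_add_comm, ha, hb]
  | hW c v hv =>
  have hv' : v ∈ D.mirror.W (-c) := by rw [mirror_W, neg_neg]; exact hv
  rw [T, T, D.scale_apply _ hv, D.mirror.scale_apply _ hv']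
  rcases D.W_sign hv with h | h | h | h
  · subst h; simp
  · rw [wT_pos h, wT_neg (neg_neg_of_pos h)]; module
  · subst h; rw [neg_zero, wT_zero]; module
  · rw [wT_neg h, wT_pos (neg_pos.2 h)]; module

lemma T_comm_f (i : I) (v : L) : ⁅D.f i, D.T v⁆ - D.T ⁅D.f i, v⁆
    = (d i / 2) • (B v (D.h (D.coroot i)) • D.f i - B v (D.f i) • D.h (D.coroot i)) := by
  have := (hF.mirror).T_comm_e i v
  rw [mirror_T, mirror_T, mirror_e, mirror_h, mirror_coroot, LinearMap.neg_apply, map_neg, lie_sub]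
    at this
  rw [← neg_inj, ← sub_eq_zero]
  rw [← sub_eq_zero] at this
  rw [← this]
  module

lemma T_comm_h (y : H) (v : L) : ⁅D.h y, D.T v⁆ - D.T ⁅D.h y, v⁆ = 0 := by
  induction v using D.hom_induction with
  | hadd a b ha hb => simp only [map_add, lie_add, add_sub_add_comm, ha, hb, add_zero]
  | hW c v hv =>
  rw [T, D.scale_apply _ hv, lie_smul, hv, map_smul, D.scale_apply _ hv, smul_comm, sub_self]

/-- When `L` is infinite-dimensional the transpose of `star` need not a priori land in `L ⊗ L`. It
does on generators by the finite-rank commutators, and `star_apply_lie` supplies the tensor for a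
bracket from those of its factors. -/
lemma exists_cobracket_aux (x : L) :
    ∃ t : L ⊗[k] L, ∀ u v, tensorDual (B u) (B v) t = B (D.star u v) x := by
  induction x using D.gen_induction with
  | he i =>
    refine ⟨(d i / 2) • wedge (D.e i) (D.h (D.coroot i)), fun u v => ?_⟩
    rw [hF.star_apply, hF.T_comm_e, wedge]
    simp only [map_smul, map_sub, tensorDual_tmul, smul_eq_mul]
    ring
  | hf i =>
    refine ⟨(d i / 2) • wedge (D.f i) (D.h (D.coroot i)), fun u v => ?_⟩
    rw [hF.star_apply, hF.T_comm_f, wedge]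
    simp only [map_smul, map_sub, tensorDual_tmul, smul_eq_mul]
    ring
  | hh y => exact ⟨0, fun u v => by rw [hF.star_apply, hF.T_comm_h]; simp⟩
  | h0 => exact ⟨0, by simp⟩
  | hadd a b ha hb =>
    obtain ⟨s, hs⟩ := ha
    obtain ⟨t, ht⟩ := hb
    exact ⟨s + t, fun u v => by rw [map_add, map_add, hs, ht]⟩
  | hsmul c a ha =>
    obtain ⟨s, hs⟩ := ha
    exact ⟨c • s, fun u v => by rw [map_smul, map_smul, hs]⟩
  | hlie a b ha hb =>
    obtain ⟨s, hs⟩ := ha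
    obtain ⟨t, ht⟩ := hb
    refine ⟨⁅a, t⁆ - ⁅b, s⁆, fun u v => ?_⟩
    rw [map_sub, hF.pair_lie, hF.pair_lie, hs, hs, ht, ht, hF.star_apply_lie]
    ring

lemma pair_ext {t t' : L ⊗[k] L}
    (h : ∀ u v, tensorDual (B u) (B v) t = tensorDual (B u) (B v) t') : t = t' :=
  tensor_ext (F := B) (G := B) hF.nondeg' hF.nondeg' h

/-- The cobracket dual to `star`. -/
theorem exists_cobracket : ∃ δ : L →ₗ[k] L ⊗[k] L,
    ∀ u v x, tensorDual (B u) (B v) (δ x) = B (D.star u v) x := by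
  choose t ht using hF.exists_cobracket_aux
  refine ⟨{ toFun := t, map_add' := fun x y => hF.pair_ext fun u v => ?_,
            map_smul' := fun c x => hF.pair_ext fun u v => ?_ }, fun u v x => ht x u v⟩
  · rw [map_add, ht, ht, ht, map_add]
  · rw [RingHom.id_apply, map_smul, ht, ht, map_smul]

variable {δ : L →ₗ[k] L ⊗[k] L}

lemma isLieBialgebra (hδ : ∀ u v x, tensorDual (B u) (B v) (δ x) = B (D.star u v) x) :
    IsLieBialgebra δ where
  coalgebra := isLieCoalgebra_of_pairing (F := B) hF.nondeg' D.star hδ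
    (fun u v x => by rw [D.star_skew u v, map_neg]; simp)
    (fun u v w x => by
      rw [← LinearMap.add_apply, ← LinearMap.add_apply, ← map_add, ← map_add, D.star_jacobi]; simp)
  cocycle x y := hF.pair_ext fun u v => by
    rw [map_sub, hF.pair_lie, hF.pair_lie, hδ, hδ, hδ, hδ, hδ, hF.star_apply_lie]
    ring

lemma cobracket_e (hδ : ∀ u v x, tensorDual (B u) (B v) (δ x) = B (D.star u v) x) (i : I) :
    δ (D.e i) = (d i / 2) • wedge (D.e i) (D.h (D.coroot i)) := hF.pair_ext fun u v => by
  rw [hδ, hF.star_apply, hF.T_comm_e, wedge]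
  simp only [map_smul, map_sub, tensorDual_tmul, smul_eq_mul]
  ring

lemma cobracket_f
    (hδ : ∀ u v x, tensorDual (B u) (B v) (δ x) = B (D.star u v) x) (i : I) :
    δ (D.f i) = (d i / 2) • wedge (D.f i) (D.h (D.coroot i)) := hF.pair_ext fun u v => by
  rw [hδ, hF.star_apply, hF.T_comm_f, wedge]
  simp only [map_smul, map_sub, tensorDual_tmul, smul_eq_mul]
  ring

lemma cobracket_h (hδ : ∀ u v x, tensorDual (B u) (B v) (δ x) = B (D.star u v) x) (y : H) :
    δ (D.h y) = 0 := hF.pair_ext fun u v => by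
  rw [hδ, hF.star_apply, hF.T_comm_h]
  simp

end IsForm

end KMData

/-! ### L̃(C) and L(C): highest weight modules and the embedding of H -/

section Tilde

attribute [local instance] LieRing.ofAssociativeRing

variable {k : Type*} [Field k] {I : Type*} [Fintype I] {C : Matrix I I ℤ}
  {H : Type*} [AddCommGroup H] [Module k H] (R : RootDatum k C H)

/-- The operator of `f i` on the free module on words. -/
def wordF (k : Type*) [Field k] {I : Type*} (i : I) : (List I →₀ k) →ₗ[k] (List I →₀ k) :=
  Finsupp.lmapDomain k k (List.cons i)

lemma wordF_single (i : I) (l : List I) (c : k) :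
    wordF k i (Finsupp.single l c) = Finsupp.single (i :: l) c := by
  simp [wordF]

/-- The weight of a word in the module of highest weight `lam`. -/
def wordWt (lam : Module.Dual k H) : List I → Module.Dual k H
  | [] => lam
  | j :: l => wordWt lam l - R.root j

/-- The operator of `h y` on the free module on words. -/
def wordH (lam : Module.Dual k H) : H →ₗ[k] Module.End k (List I →₀ k) where
  toFun y := Finsupp.lsum k fun l => wordWt R lam l y • Finsupp.lsingle l
  map_add' y z := by ext l; simp
  map_smul' c y := by ext l; simp

lemma wordH_single (lam : Module.Dual k H) (y : H) (l : List I) (c : k) :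
    wordH R lam y (Finsupp.single l c) = wordWt R lam l y • Finsupp.single l c := by
  simp [wordH]

open Classical in
/-- The image of a word under `e i`. -/
def wordEAux (lam : Module.Dual k H) (i : I) : List I → (List I →₀ k)
  | [] => 0
  -- Forced by e_i f_j = f_j e_i + δ_ij h_i, the empty word being a highest weight vector.
  | j :: l => wordF k j (wordEAux lam i l) +
      if i = j then Finsupp.single l (wordWt R lam l (R.coroot i)) else 0

/-- The operator of `e i` on the free module on words. -/
def wordE (lam : Module.Dual k H) (i : I) : Module.End k (List I →₀ k) :=
  Finsupp.lsum k fun l => LinearMap.toSpanSingleton k _ (wordEAux R lam i l)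

lemma wordE_single (lam : Module.Dual k H) (i : I) (l : List I) :
    wordE R lam i (Finsupp.single l 1) = wordEAux R lam i l := by
  simp [wordE]

lemma wordH_wordF (lam : Module.Dual k H) (y : H) (i : I) (w : List I →₀ k) :
    wordH R lam y (wordF k i w) = wordF k i (wordH R lam y w) - R.root i y • wordF k i w := by
  induction w using Finsupp.induction_linear with
  | zero => simp
  | add a b ha hb => simp only [map_add, ha, hb, smul_add]; abel
  | single l c =>
    rw [wordF_single, wordH_single, wordH_single, map_smul, wordF_single, wordWt]
    simp only [LinearMap.sub_apply]
    module

lemma wordH_wordEAux (lam : Module.Dual k H) (y : H) (i : I) (l : List I) :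
    wordH R lam y (wordEAux R lam i l)
      = (wordWt R lam l y + R.root i y) • wordEAux R lam i l := by
  induction l with
  | nil => simp [wordEAux]
  | cons j l ih =>
    rw [wordEAux, map_add, wordH_wordF, ih, map_smul]
    split_ifs with h
    · subst h
      rw [wordH_single, wordWt, LinearMap.sub_apply]
      module
    · rw [wordWt, LinearMap.sub_apply, map_zero]
      module

/-- The action of the generators on the free module on words. -/
def wordGen (lam : Module.Dual k H) : Gen I H → Module.End k (List I →₀ k)
  | .e i => wordE R lam i
  | .f i => wordF k i
  | .h y => wordH R lam y

/-- The representation of the free Lie algebra on the free module on words. -/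
def wordRep (lam : Module.Dual k H) :
    FreeLieAlgebra k (Gen I H) →ₗ⁅k⁆ Module.End k (List I →₀ k) :=
  FreeLieAlgebra.lift k (wordGen R lam)

lemma wordRep_gen (lam : Module.Dual k H) (t : Gen I H) :
    wordRep R lam (freeGen R t) = wordGen R lam t := by
  simp [wordRep, freeGen]

lemma wordRep_rel (lam : Module.Dual k H) {x : FreeLieAlgebra k (Gen I H)} (hx : DefRel R x) :
    wordRep R lam x = 0 := by
  cases hx with
  | linear a b y z =>
    simp only [map_sub, map_add, map_smul, wordRep_gen, wordGen, sub_self]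
  | hh x y =>
    rw [LieHom.map_lie, wordRep_gen, wordRep_gen]
    refine Finsupp.lhom_ext' fun l => LinearMap.ext_ring ?_
    simp only [wordGen, LieRing.of_associative_ring_bracket, LinearMap.comp_apply,
      LinearMap.sub_apply, Module.End.mul_apply, Finsupp.lsingle_apply, wordH_single, map_smul]
    rw [smul_comm, sub_self]; simp
  | ef_same i =>
    rw [map_sub, LieHom.map_lie, wordRep_gen, wordRep_gen, wordRep_gen]
    refine Finsupp.lhom_ext' fun l => LinearMap.ext_ring ?_
    simp only [wordGen, LieRing.of_associative_ring_bracket, LinearMap.comp_apply,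
      LinearMap.sub_apply, Module.End.mul_apply, Finsupp.lsingle_apply, wordH_single,
      wordF_single, wordE_single, wordEAux, if_true]
    simp
  | ef_ne i j hij =>
    rw [LieHom.map_lie, wordRep_gen, wordRep_gen]
    refine Finsupp.lhom_ext' fun l => LinearMap.ext_ring ?_
    simp only [wordGen, LieRing.of_associative_ring_bracket, LinearMap.comp_apply,
      LinearMap.sub_apply, Module.End.mul_apply, Finsupp.lsingle_apply,
      wordF_single, wordE_single, wordEAux, if_neg hij]
    simp
  | he y i =>
    rw [map_sub, map_smul, LieHom.map_lie, wordRep_gen, wordRep_gen]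
    refine Finsupp.lhom_ext' fun l => LinearMap.ext_ring ?_
    simp only [wordGen, LieRing.of_associative_ring_bracket, LinearMap.comp_apply,
      LinearMap.sub_apply, LinearMap.smul_apply, Module.End.mul_apply, Finsupp.lsingle_apply,
      wordE_single, wordH_single, map_smul, wordH_wordEAux]
    rw [LinearMap.zero_apply]
    module
  | hf y i =>
    rw [map_add, map_smul, LieHom.map_lie, wordRep_gen, wordRep_gen]
    refine Finsupp.lhom_ext' fun l => LinearMap.ext_ring ?_
    simp only [wordGen, LieRing.of_associative_ring_bracket, LinearMap.comp_apply,
      LinearMap.sub_apply, LinearMap.add_apply, LinearMap.smul_apply, Module.End.mul_apply,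
      Finsupp.lsingle_apply, wordH_wordF]
    rw [LinearMap.zero_apply]
    abel

/-- The projection of the free Lie algebra onto `L̃(C)`. -/
def tildeMk : FreeLieAlgebra k (Gen I H) →ₗ⁅k⁆ TildeL R where
  toFun x := LieSubmodule.Quotient.mk x
  map_add' _ _ := rfl
  map_smul' _ _ := rfl
  map_lie' := rfl

lemma tildeMk_surjective : Function.Surjective (tildeMk R) := Quotient.mk''_surjective

lemma tildeMk_gen (t : Gen I H) : tildeMk R (freeGen R t) = tildeGen R t := rfl

lemma tildeMk_eq_zero {x : FreeLieAlgebra k (Gen I H)} : tildeMk R x = 0 ↔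
    x ∈ LieSubmodule.lieSpan k (FreeLieAlgebra k (Gen I H)) {x | DefRel R x} :=
  LieSubmodule.Quotient.mk_eq_zero'

lemma tildeMk_rel {x : FreeLieAlgebra k (Gen I H)} (hx : DefRel R x) : tildeMk R x = 0 :=
  (tildeMk_eq_zero R).2 (LieSubmodule.subset_lieSpan hx)

/-- In the word module of highest weight `lam` the element h̃ acts on the empty word by `lam y`, and
`lam` is an arbitrary functional. -/
lemma tilde_h_eq_zero {y : H} (hy : tildeGen R (.h y) = 0) : y = 0 := by
  rw [← tildeMk_gen, tildeMk_eq_zero] at hy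
  refine (Module.forall_dual_apply_eq_zero_iff k y).1 fun lam => ?_
  have h1 : LieSubmodule.lieSpan k (FreeLieAlgebra k (Gen I H)) {x | DefRel R x}
      ≤ (wordRep R lam).ker := by
    rw [LieSubmodule.lieSpan_le]
    intro x hx
    exact (LieHom.mem_ker).2 (wordRep_rel R lam hx)
  have h2 := LieHom.mem_ker.1 (h1 hy)
  rw [wordRep_gen] at h2
  have h3 := LinearMap.congr_fun h2 (Finsupp.single [] 1)
  rw [wordGen, wordH_single, wordWt] at h3
  have := DFunLike.congr_fun h3 []
  simpa using this

lemma tilde_gen_top : LieSubalgebra.lieSpan k (TildeL R) (Set.range (tildeGen R)) = ⊤ := by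
  rw [eq_top_iff]
  rintro x -
  obtain ⟨z, rfl⟩ := tildeMk_surjective R x
  let S := LieSubalgebra.lieSpan k (TildeL R) (Set.range (tildeGen R))
  let g : FreeLieAlgebra k (Gen I H) →ₗ⁅k⁆ S :=
    FreeLieAlgebra.lift k fun t => ⟨tildeGen R t, LieSubalgebra.subset_lieSpan ⟨t, rfl⟩⟩
  have h1 : S.incl.comp g = tildeMk R := by
    refine FreeLieAlgebra.hom_ext fun t => ?_
    simp [g]
    rfl
  rw [← h1]
  exact (g z).2

/-- `h ↦ h̃` as a linear map to `L̃(C)`. -/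
def tildeHLin : H →ₗ[k] TildeL R where
  toFun y := tildeGen R (.h y)
  map_add' y z := by
    have := tildeMk_rel R (DefRel.linear 1 1 y z)
    simpa [sub_eq_zero, tildeMk_gen] using this
  map_smul' c y := by
    have := tildeMk_rel R (DefRel.linear c 0 y 0)
    simpa [sub_eq_zero, tildeMk_gen] using this

/-- `L̃(C)` with its generators. -/
def tildeData : KMData k I H (TildeL R) where
  root := R.root
  coroot := R.coroot
  e i := tildeGen R (.e i)
  f i := tildeGen R (.f i)
  h := tildeHLin R
  root_indep := R.root_indep
  h_inj := by
    rw [← LinearMap.ker_eq_bot, LinearMap.ker_eq_bot']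
    intro y hy
    exact tilde_h_eq_zero R hy
  hh x y := by
    have := tildeMk_rel R (DefRel.hh x y)
    rwa [LieHom.map_lie] at this
  he x i := by
    have := tildeMk_rel R (DefRel.he x i)
    rwa [map_sub, sub_eq_zero, map_smul, LieHom.map_lie] at this
  hf x i := by
    have := tildeMk_rel R (DefRel.hf x i)
    rwa [map_add, add_eq_zero_iff_eq_neg, map_smul, LieHom.map_lie] at this
  ef_same i := by
    have := tildeMk_rel R (DefRel.ef_same i)
    rwa [map_sub, sub_eq_zero, LieHom.map_lie] at this
  ef_ne i j hij := by
    have := tildeMk_rel R (DefRel.ef_ne i j hij)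
    rwa [LieHom.map_lie] at this
  gen := by
    rw [eq_top_iff, ← tilde_gen_top R]
    refine LieSubalgebra.lieSpan_mono ?_
    rintro _ ⟨t, rfl⟩
    cases t with
    | e i => exact Or.inl (Or.inl ⟨i, rfl⟩)
    | f i => exact Or.inl (Or.inr ⟨i, rfl⟩)
    | h y => exact Or.inr ⟨y, rfl⟩

lemma mem_tildeH {x : TildeL R} (hx : x ∈ tildeH R) : ∃ y, tildeHLin R y = x := by
  let S : LieSubalgebra k (TildeL R) :=
    { LinearMap.range (tildeHLin R) with
      lie_mem' := by
        rintro _ _ ⟨y, rfl⟩ ⟨z, rfl⟩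
        exact ⟨0, by rw [map_zero]; exact ((tildeData R).hh y z).symm⟩ }
  have : tildeH R ≤ S := by
    rw [tildeH, LieSubalgebra.lieSpan_le]
    rintro _ ⟨y, rfl⟩
    exact ⟨y, rfl⟩
  exact this hx

variable [CharZero k]

/-- An ideal is graded by weights, so one that meets H trivially has no component of weight 0.
Having no such component is a linear condition and so passes to the sum of all these ideals. -/
lemma tildeH_inf_maxIdeal {y : H} (hy : tildeHLin R y ∈ maxIdeal R) : y = 0 := by
  let D := tildeData R
  have h1 : LieSubmodule.toSubmodule (maxIdeal R) ≤ LinearMap.ker (D.proj {0}) := by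
    rw [maxIdeal, LieSubmodule.sSup_toSubmodule]
    refine sSup_le ?_
    rintro _ ⟨𝔞, h𝔞, rfl⟩ x hx
    have h2 : D.proj {0} x ∈ LieSubmodule.toSubmodule 𝔞 :=
      D.proj_mem_of_stable (fun y z hz => lie_mem_right k (TildeL R) 𝔞 _ z hz) {0} hx
    have h3 : D.proj {0} x ∈ LinearMap.range D.h :=
      D.proj_mem {0} (N := LinearMap.range D.h) (fun l i h => absurd h (KMData.lwt_pos l i).ne')
        (fun l i h => absurd (neg_eq_zero.1 h) (KMData.lwt_pos l i).ne') (fun _ y => ⟨y, rfl⟩) x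
    obtain ⟨z, hz⟩ := h3
    rw [LinearMap.mem_ker]
    refine h𝔞 _ h2 ?_
    rw [← hz]
    exact LieSubalgebra.subset_lieSpan ⟨z, rfl⟩
  have h2 := h1 hy
  rw [LinearMap.mem_ker] at h2
  have h3 : D.proj {0} (D.h y) = D.h y := D.proj_of_mem (D.h_mem y) (Set.mem_singleton 0)
  exact D.h_inj ((h3.symm.trans h2).trans (map_zero D.h).symm)

/-- The projection of `L̃(C)` onto `L(C)`. -/
def algMk : TildeL R →ₗ⁅k⁆ Alg R where
  toFun x := (LieSubmodule.Quotient.mk x : TildeL R ⧸ maxIdeal R)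
  map_add' _ _ := rfl
  map_smul' _ _ := rfl
  map_lie' := rfl

lemma algMk_surjective : Function.Surjective (algMk R) := Quotient.mk''_surjective

lemma algMk_eq_zero {x : TildeL R} : algMk R x = 0 ↔ x ∈ maxIdeal R :=
  LieSubmodule.Quotient.mk_eq_zero'

/-- `L(C)` with its generators. -/
def data : KMData k I H (Alg R) where
  root := R.root
  coroot := R.coroot
  e := e R
  f := f R
  h := (algMk R : TildeL R →ₗ[k] Alg R) ∘ₗ tildeHLin R
  root_indep := R.root_indep
  h_inj := by
    rw [← LinearMap.ker_eq_bot, LinearMap.ker_eq_bot']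
    intro y hy
    exact tildeH_inf_maxIdeal R ((algMk_eq_zero R).1 hy)
  hh x y := by
    have := congrArg (algMk R) ((tildeData R).hh x y)
    rwa [LieHom.map_lie, map_zero] at this
  he x i := by
    have := congrArg (algMk R) ((tildeData R).he x i)
    rwa [LieHom.map_lie, map_smul] at this
  hf x i := by
    have := congrArg (algMk R) ((tildeData R).hf x i)
    rwa [LieHom.map_lie, map_neg, map_smul] at this
  ef_same i := by
    have := congrArg (algMk R) ((tildeData R).ef_same i)
    rwa [LieHom.map_lie] at this
  ef_ne i j hij := by
    have := congrArg (algMk R) ((tildeData R).ef_ne i j hij)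
    rwa [LieHom.map_lie, map_zero] at this
  gen := by
    rw [eq_top_iff]
    rintro x -
    obtain ⟨z, rfl⟩ := algMk_surjective R x
    let S := LieSubalgebra.lieSpan k (Alg R) (Set.range (e R) ∪ Set.range (f R) ∪
      Set.range ((algMk R : TildeL R →ₗ[k] Alg R) ∘ₗ tildeHLin R))
    change algMk R z ∈ S
    induction z using (tildeData R).gen_induction with
    | he i => exact LieSubalgebra.subset_lieSpan (Or.inl (Or.inl ⟨i, rfl⟩))
    | hf i => exact LieSubalgebra.subset_lieSpan (Or.inl (Or.inr ⟨i, rfl⟩))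
    | hh y => exact LieSubalgebra.subset_lieSpan (Or.inr ⟨y, rfl⟩)
    | h0 => rw [map_zero]; exact S.zero_mem
    | hadd a b ha hb => rw [map_add]; exact S.add_mem ha hb
    | hsmul c a ha => rw [map_smul]; exact S.smul_mem c ha
    | hlie a b ha hb => rw [LieHom.map_lie]; exact S.lie_mem ha hb

@[simp] lemma data_e (i : I) : (data R).e i = e R i := rfl
@[simp] lemma data_f (i : I) : (data R).f i = f R i := rfl
@[simp] lemma data_h (y : H) : (data R).h y = h R y := rfl

/-- Ideals of `L(C)` that meet `H` trivially vanish. -/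
lemma data_ideal (N : Submodule k (Alg R)) (hN : ∀ z : Alg R, ∀ x ∈ N, ⁅z, x⁆ ∈ N)
    (h0 : ∀ y, (data R).h y ∈ N → y = 0) : N = ⊥ := by
  let 𝔞 : LieIdeal k (TildeL R) :=
    { N.comap (algMk R : TildeL R →ₗ[k] Alg R) with
      lie_mem := by
        intro z x hx
        change algMk R ⁅z, x⁆ ∈ N
        rw [LieHom.map_lie]
        exact hN _ _ hx }
  have h1 : 𝔞 ≤ maxIdeal R := by
    refine le_sSup ?_
    intro x hx hx'
    obtain ⟨y, rfl⟩ := mem_tildeH R hx'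
    rw [h0 y hx, map_zero]
  rw [eq_bot_iff]
  intro x hx
  obtain ⟨z, rfl⟩ := algMk_surjective R x
  rw [Submodule.mem_bot, algMk_eq_zero]
  exact h1 hx

end Tilde

/-! ### Minimal realizations and the form on H -/

section Realization

variable {k : Type*} [Field k] {I : Type*} [Fintype I] {C : Matrix I I ℤ}
  {H : Type*} [AddCommGroup H] [Module k H] (R : RootDatum k C H)

/-- The joint kernel of the roots is spanned by coroots. -/
lemma mem_span_coroot {x : H} (hx : ∀ i, R.root i x = 0) :
    ∃ c : I → k, x = ∑ i, c i • R.coroot i := by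
  classical
  have := R.finite
  let Cm := C.map (fun z : ℤ => (z : k))
  let P : (I → k) →ₗ[k] H := Fintype.linearCombination k R.coroot
  have hPinj : Function.Injective P :=
    linearIndependent_iff_injective_fintypeLinearCombination.1 R.coroot_indep
  let K := LinearMap.ker (Matrix.mulVecLin Cm.transpose)
  let Z := (Submodule.span k (Set.range R.root)).dualCoannihilator
  have hle : K.map P ≤ Z := by
    rintro _ ⟨c, hc, rfl⟩
    rw [Submodule.mem_dualCoannihilator]
    intro φ hφ
    induction hφ using Submodule.span_induction with
    | zero => simp
    | add a b _ _ ha hb => simp [ha, hb]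
    | smul a b _ hb => simp [hb]
    | mem φ hφ =>
      obtain ⟨j, rfl⟩ := hφ
      have h1 := congrFun (LinearMap.mem_ker.1 hc) j
      rw [Matrix.mulVecLin_apply, Matrix.mulVec, dotProduct] at h1
      simp only [P, Fintype.linearCombination_apply, map_sum, map_smul, R.root_coroot, smul_eq_mul]
      rw [← show _ = (0 : k) from h1]
      refine Finset.sum_congr rfl fun i _ => ?_
      simp [Cm, mul_comm]
  -- Both dimensions are |I| - rank C: the first by rank-nullity, the second because minimality
  -- gives dim H = 2|I| - rank C and the |I| roots are independent.
  have hdim : Module.finrank k (K.map P) = Module.finrank k Z := by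
    have h1 : Module.finrank k (K.map P) = Module.finrank k K :=
      (Submodule.equivMapOfInjective P hPinj K).finrank_eq.symm
    have h2 := LinearMap.finrank_range_add_finrank_ker (Matrix.mulVecLin Cm.transpose)
    have h3 : Module.finrank k (LinearMap.range (Matrix.mulVecLin Cm.transpose)) = Cm.rank :=
      Cm.rank_transpose
    have h4 := Subspace.finrank_add_finrank_dualCoannihilator_eq
      (Submodule.span k (Set.range R.root))
    have h5 := finrank_span_eq_card R.root_indep
    have h6 := R.finrank_add_rank
    rw [Module.finrank_pi] at h2
    change _ + Module.finrank k K = _ at h2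
    change _ + Module.finrank k Z = _ at h4
    change _ + Cm.rank = _ at h6
    omega
  have hx' : x ∈ K.map P := by
    rw [Submodule.eq_of_le_of_finrank_eq hle hdim, Submodule.mem_dualCoannihilator]
    intro φ hφ
    induction hφ using Submodule.span_induction with
    | zero => simp
    | add a b _ _ ha hb => simp [ha, hb]
    | smul a b _ hb => simp [hb]
    | mem φ hφ => obtain ⟨j, rfl⟩ := hφ; exact hx j
  obtain ⟨c, -, rfl⟩ := hx'
  exact ⟨c, by simp [P, Fintype.linearCombination_apply]⟩

/-- The standard symmetric form on `H`. -/
lemma exists_form_H {d : I → k} (hd : IsSymmetrizer C d) :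
    ∃ S : H →ₗ[k] H →ₗ[k] k, (∀ x y, S x y = S y x) ∧
      (∀ i y, d i * S (R.coroot i) y = R.root i y) ∧ ∀ x, (∀ y, S x y = 0) → x = 0 := by
  classical
  obtain ⟨g, hg⟩ := LinearMap.exists_leftInverse_of_injective
    (Finsupp.linearCombination k R.coroot) (LinearMap.ker_eq_bot.2 R.coroot_indep)
  let φ : I → Module.Dual k H := fun i => Finsupp.lapply i ∘ₗ g
  have hφ : ∀ i j, φ i (R.coroot j) = if i = j then 1 else 0 := by
    intro i j
    have := LinearMap.congr_fun hg (Finsupp.single j 1)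
    rw [LinearMap.comp_apply, Finsupp.linearCombination_single, one_smul] at this
    simp [φ, this, Finsupp.single_apply, eq_comm]
  -- The first sum imposes the values of the roots on both sides; the double sum removes what is
  -- counted twice on the span of the coroots. The kernel of `g`, a complement of that span, becomes
  -- isotropic.
  let S : H →ₗ[k] H →ₗ[k] k := LinearMap.mk₂ k
    (fun x y => ∑ i, (d i)⁻¹ * (φ i x * R.root i y + φ i y * R.root i x)
      - ∑ i, ∑ j, φ i x * φ j y * ((d j)⁻¹ * C i j))
    (by intro a b c; simp only [map_add, add_mul, mul_add, Finset.sum_add_distrib]; ring)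
    (by
      intro c a b
      simp only [map_smul, smul_eq_mul, mul_sub, Finset.mul_sum]
      congr 1
      · exact Finset.sum_congr rfl fun i _ => by ring
      · exact Finset.sum_congr rfl fun i _ => Finset.sum_congr rfl fun j _ => by ring)
    (by intro a b c; simp only [map_add, add_mul, mul_add, Finset.sum_add_distrib]; ring)
    (by
      intro c a b
      simp only [map_smul, smul_eq_mul, mul_sub, Finset.mul_sum]
      congr 1
      · exact Finset.sum_congr rfl fun i _ => by ring
      · exact Finset.sum_congr rfl fun i _ => Finset.sum_congr rfl fun j _ => by ring)
  have hSa : ∀ x y, S x y = ∑ i, (d i)⁻¹ * (φ i x * R.root i y + φ i y * R.root i x)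
      - ∑ i, ∑ j, φ i x * φ j y * ((d j)⁻¹ * C i j) := fun _ _ => rfl
  have hsymm : ∀ i j, (d j)⁻¹ * (C i j : k) = (d i)⁻¹ * C j i := by
    intro i j
    have h1 := hd.symm i j
    have h2 := hd.ne_zero i
    have h3 := hd.ne_zero j
    field_simp
    linear_combination h1
  have hS : ∀ x y, S x y = S y x := by
    intro x y
    rw [hSa, hSa, Finset.sum_comm]
    congr 1
    · exact Finset.sum_congr rfl fun i _ => by ring
    · refine Finset.sum_congr rfl fun i _ => Finset.sum_congr rfl fun j _ => ?_
      rw [hsymm j i]; ring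
  have hco : ∀ i y, d i * S (R.coroot i) y = R.root i y := by
    intro m y
    have h2 := hd.ne_zero m
    rw [hSa]
    simp only [hφ, R.root_coroot, mul_add, Finset.sum_add_distrib]
    have h3 : ∑ i, ∑ j, (if i = m then (1 : k) else 0) * φ j y * ((d j)⁻¹ * C i j)
        = ∑ j, (d j)⁻¹ * (φ j y * (C m j : k)) := by
      rw [Finset.sum_eq_single m]
      · exact Finset.sum_congr rfl fun j _ => by simp; ring
      · intro b _ hb; simp [hb]
      · simp
    rw [h3, add_sub_cancel_right]
    simp [h2]
  refine ⟨S, hS, hco, fun x hx => ?_⟩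
  -- A vector of the radical is killed by all roots, hence is a combination of coroots; pairing it
  -- with `y` then gives a linear relation among the roots.
  obtain ⟨c, rfl⟩ := mem_span_coroot R (x := x) fun i => by rw [← hco, hS, hx, mul_zero]
  have h1 := Fintype.linearIndependent_iff.1 R.root_indep (fun i => c i * (d i)⁻¹) (by
    ext y
    rw [LinearMap.zero_apply, ← hx y, map_sum, LinearMap.sum_apply, LinearMap.sum_apply]
    refine Finset.sum_congr rfl fun i _ => ?_
    rw [map_smul, LinearMap.smul_apply, LinearMap.smul_apply, ← hco, smul_eq_mul, smul_eq_mul]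
    have := hd.ne_zero i
    field_simp)
  refine Finset.sum_eq_zero fun i _ => ?_
  have := h1 i
  rw [mul_eq_zero, inv_eq_zero] at this
  rw [this.resolve_right (hd.ne_zero i), zero_smul]

lemma data_symmetrizes {d : I → k} (hd : IsSymmetrizer C d) [CharZero k] :
    (data R).Symmetrizes d := by
  intro i j
  change d i * R.root j (R.coroot i) = d j * R.root i (R.coroot j)
  rw [R.root_coroot, R.root_coroot, hd.symm]

/-- The standard invariant form of `L(C)`. -/
theorem exists_isForm {d : I → k} (hd : IsSymmetrizer C d) [CharZero k] :
    ∃ B, (data R).IsForm d B := by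
  obtain ⟨S, h1, h2, h3⟩ := exists_form_H R hd
  exact KMData.exists_form (data_symmetrizes R hd) hd.ne_zero R.coroot_indep S h1 h2 h3
    (data_ideal R)

end Realization

end KacMoody

/-! ### Operators detecting direct sums, and functionals pulled back from the form -/

namespace LieBi

/-- A decomposition given by operators that separate the summands. -/
lemma isInternal_of_ops {k σ V L : Type*} [Field k] [AddCommGroup V] [Module k V]
    [AddCommGroup L] [Module k L] [DecidableEq σ] {𝒜 : σ → Submodule k V} (i : V →ₗ[k] L)
    (hi : Function.Injective i) (p : σ → L →ₗ[k] L) (h1 : ∀ n, ∀ x ∈ 𝒜 n, p n (i x) = i x)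
    (h2 : ∀ m n, m ≠ n → ∀ x ∈ 𝒜 n, p m (i x) = 0) (h3 : ∀ x, x ∈ ⨆ n, 𝒜 n) :
    DirectSum.IsInternal 𝒜 := by
  classical
  rw [DirectSum.isInternal_submodule_iff_iSupIndep_and_iSup_eq_top]
  refine ⟨?_, eq_top_iff.2 fun x _ => h3 x⟩
  apply iSupIndep_of_dfinsupp_lsum_injective
  rw [← LinearMap.ker_eq_bot, LinearMap.ker_eq_bot']
  intro m hm
  ext n
  have h4 : (p n ∘ₗ i) (DFinsupp.lsum ℕ (fun i => (𝒜 i).subtype) m) = i (m n) := by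
    rw [DFinsupp.lsum_apply_apply, DFinsupp.sumAddHom_apply, DFinsupp.sum, map_sum]
    by_cases hn : n ∈ m.support
    · rw [Finset.sum_eq_single n]
      · exact h1 n _ (m n).2
      · intro b _ hb; exact h2 n b hb.symm _ (m b).2
      · exact fun h => absurd hn h
    · rw [DFinsupp.notMem_support_iff.1 hn, Submodule.coe_zero, map_zero]
      refine Finset.sum_eq_zero fun b hb => h2 n b ?_ _ (m b).2
      rintro rfl; exact hn hb
  rw [hm, map_zero] at h4
  exact hi (h4.symm.trans (map_zero i).symm)

section

variable {k : Type*} [Field k] {V W X U : Type*} [AddCommGroup V] [Module k V]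
  [AddCommGroup W] [Module k W] [AddCommGroup U] [Module k U]

lemma apply_idTensor (ψ : Module.Dual k U) (φ : Module.Dual k V) (t : U ⊗[k] V) :
    ψ (idTensor φ t) = tensorDual ψ φ t := by
  induction t using TensorProduct.induction_on with
  | zero => simp
  | add a b ha hb => simp only [map_add, ha, hb]
  | tmul a b => simp [idTensor, mul_comm]

/-- The functionals on `V` obtained from `B` through a linear map `i : V → L`. -/
def pull {L : Type*} [AddCommGroup L] [Module k L] (B : L →ₗ[k] L →ₗ[k] k) (i : V →ₗ[k] L) :
    L →ₗ[k] Module.Dual k V := LinearMap.lcomp k k i ∘ₗ B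

@[simp] lemma pull_apply {L : Type*} [AddCommGroup L] [Module k L] (B : L →ₗ[k] L →ₗ[k] k)
    (i : V →ₗ[k] L) (u : L) (x : V) : pull B i u x = B u (i x) := rfl

lemma tensorDual_map_pull {L : Type*} [AddCommGroup L] [Module k L] (B : L →ₗ[k] L →ₗ[k] k)
    (i : V →ₗ[k] L) (j : W →ₗ[k] L) (u v : L) (t : V ⊗[k] W) :
    tensorDual (B u) (B v) (TensorProduct.map i j t) = tensorDual (pull B i u) (pull B j v) t :=
  tensorDual_map _ _ _ _ _

end

lemma tensorDual_neg_left {k V W : Type*} [Field k] [AddCommGroup V] [Module k V]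
    [AddCommGroup W] [Module k W] (φ : Module.Dual k V) (ψ : Module.Dual k W)
    (t : V ⊗[k] W) : tensorDual (-φ) ψ t = -tensorDual φ ψ t := by
  rw [eq_neg_iff_add_eq_zero, ← tensorDual_add_left, neg_add_cancel, tensorDual_zero_left]

end LieBi

namespace KacMoody

open LieBi

lemma toInt_apply {I : Type*} (β : I →₀ ℕ) (i : I) : toInt β i = β i := rfl

lemma toInt_injective {I : Type*} : Function.Injective (toInt : (I →₀ ℕ) → I →₀ ℤ) := by
  intro β β' h
  ext i
  have := DFunLike.congr_fun h i
  simpa [toInt_apply] using this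

lemma exists_toInt {I : Type*} {γ : I →₀ ℤ} (h : 0 ≤ γ) : ∃ β : I →₀ ℕ, toInt β = γ := by
  refine ⟨γ.mapRange Int.toNat (by simp), ?_⟩
  ext i
  have : 0 ≤ γ i := h i
  simp [toInt_apply, this]

lemma toInt_nonneg {I : Type*} (β : I →₀ ℕ) : 0 ≤ toInt β := fun i => by simp [toInt_apply]

lemma finite_toInt_le {I : Type*} (c : I →₀ ℤ) : {β : I →₀ ℕ | toInt β ≤ c}.Finite := by
  classical
  refine (Set.finite_Icc 0 (c.mapRange Int.toNat (by simp) : I →₀ ℕ)).subset ?_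
  refine fun β hβ => ⟨zero_le, fun i => ?_⟩
  have : (toInt β) i ≤ c i := hβ i
  rw [toInt_apply] at this
  rw [Finsupp.mapRange_apply]
  omega

/-! ### Slices of the weight decomposition and their graded duals -/

namespace KMData

variable {k I H L : Type*} [Field k] [CharZero k] [Fintype I] [AddCommGroup H] [Module k H]
  [LieRing L] [LieAlgebra k L] {D : KMData k I H L}

section projections

variable (D)

lemma proj_mem_W (γ : I →₀ ℤ) (x : L) : D.proj {γ} x ∈ D.W γ :=
  D.proj_mem {γ} (fun l i h => by rw [← Set.mem_singleton_iff.1 h]; exact D.ew_mem l i)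
    (fun l i h => by rw [← Set.mem_singleton_iff.1 h]; exact D.fw_mem l i)
    (fun h y => by rw [← Set.mem_singleton_iff.1 h]; exact D.h_mem y) x

variable {D}

lemma proj_lie {A A' A'' : Set (I →₀ ℤ)} (h : ∀ a ∈ A, ∀ b ∈ A', a + b ∈ A'') {x y : L}
    (hx : D.proj A x = x) (hy : D.proj A' y = y) : D.proj A'' ⁅x, y⁆ = ⁅x, y⁆ := by
  rw [← hx, ← hy]
  clear hx hy
  induction x using D.hom_induction with
  | hadd a b ha hb => simp only [map_add, add_lie, ha, hb]
  | hW a x hx =>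
  induction y using D.hom_induction with
  | hadd a b ha hb => simp only [map_add, lie_add, ha, hb]
  | hW b y hy =>
  by_cases ha : a ∈ A
  swap
  · rw [D.proj_of_notMem hx ha]; simp
  by_cases hb : b ∈ A'
  swap
  · rw [D.proj_of_notMem hy hb]; simp
  rw [D.proj_of_mem hx ha, D.proj_of_mem hy hb, D.proj_of_mem (D.lie_mem_W hx hy) (h a ha b hb)]

lemma proj_lie_comm {A A' : Set (I →₀ ℤ)} (h : ∀ a ∈ A, ∀ b, a + b ∈ A' ↔ b ∈ A') {x : L}
    (hx : D.proj A x = x) (y : L) : D.proj A' ⁅x, y⁆ = ⁅x, D.proj A' y⁆ := by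
  rw [← hx]
  clear hx
  induction x using D.hom_induction with
  | hadd a b ha hb => simp only [map_add, add_lie, ha, hb]
  | hW a x hx =>
  induction y using D.hom_induction with
  | hadd a b ha hb => simp only [map_add, lie_add, ha, hb]
  | hW b y hy =>
  by_cases ha : a ∈ A
  swap
  · rw [D.proj_of_notMem hx ha]; simp
  rw [D.proj_of_mem hx ha]
  have h1 := D.lie_mem_W hx hy
  by_cases hb : b ∈ A'
  · rw [D.proj_of_mem hy hb, D.proj_of_mem h1 ((h a ha b).2 hb)]
  · rw [D.proj_of_notMem hy hb, D.proj_of_notMem h1 (fun h' => hb ((h a ha b).1 h')), lie_zero]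

lemma proj_disjoint {A A' : Set (I →₀ ℤ)} (h : Disjoint A A') {x : L} (hx : D.proj A x = x) :
    D.proj A' x = 0 := by
  rw [← hx, proj_proj, Set.inter_comm, h.inter_eq]
  clear hx
  induction x using D.hom_induction with
  | hadd a b ha hb => rw [map_add, ha, hb, add_zero]
  | hW a x hx => exact D.proj_of_notMem hx (Set.notMem_empty a)

lemma proj_idem (A : Set (I →₀ ℤ)) (x : L) : D.proj A (D.proj A x) = D.proj A x := by
  rw [proj_proj, Set.inter_self]

lemma proj_subset {A A' : Set (I →₀ ℤ)} (h : A ⊆ A') {x : L} (hx : D.proj A x = x) :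
    D.proj A' x = x := by
  rw [← hx, proj_proj, Set.inter_eq_right.2 h]

lemma T_proj (A : Set (I →₀ ℤ)) (x : L) : D.T (D.proj A x) = D.proj A (D.T x) := by
  rw [T, proj, scale_scale, scale_scale]
  congr 2
  funext γ
  rw [mul_comm]

end projections

/-- `V` is embedded by `i` as the sum of the weight spaces with weights in `A`, with the
corresponding retraction `j`. -/
structure Slice {V : Type*} [AddCommGroup V] [Module k V] (D : KMData k I H L)
    (A : Set (I →₀ ℤ)) (i : V →ₗ[k] L) (j : L →ₗ[k] V) : Prop where
  j_i : ∀ x, j (i x) = x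
  i_j : ∀ x, i (j x) = D.proj A x

lemma exists_slice {V : Type*} [AddCommGroup V] [Module k V] {A : Set (I →₀ ℤ)} {i : V →ₗ[k] L}
    (hi : Function.Injective i) (h : ∀ y, (∃ x, i x = y) ↔ D.proj A y = y) :
    ∃ j, D.Slice A i j := by
  have hr : ∀ y, D.proj A y ∈ LinearMap.range i := fun y => (h _).2 (D.proj_idem A y)
  let E := LinearEquiv.ofInjective i hi
  have hE : ∀ y : LinearMap.range i, i (E.symm y) = y := by
    intro y
    obtain ⟨z, hz⟩ := E.surjective y
    rw [← hz, E.symm_apply_apply]; rfl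
  have hij : ∀ x, i ((E.symm.toLinearMap ∘ₗ (D.proj A).codRestrict _ hr) x) = D.proj A x := by
    intro x
    simp only [LinearMap.comp_apply, LinearEquiv.coe_coe, hE]
    rfl
  exact ⟨_, fun x => hi (by rw [hij]; exact (h _).1 ⟨x, rfl⟩), hij⟩

namespace Slice

variable {V : Type*} [AddCommGroup V] [Module k V] {A : Set (I →₀ ℤ)} {i : V →ₗ[k] L}
  {j : L →ₗ[k] V} (S : D.Slice A i j)
include S

lemma injective : Function.Injective i := Function.LeftInverse.injective S.j_i

lemma proj_i (x : V) : D.proj A (i x) = i x := by rw [← S.i_j, S.j_i]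

lemma exists_iff (y : L) : (∃ x, i x = y) ↔ D.proj A y = y :=
  ⟨by rintro ⟨x, rfl⟩; exact S.proj_i x, fun h => ⟨j y, by rw [S.i_j, h]⟩⟩

lemma internal [DecidableEq (I →₀ ℤ)] : DirectSum.IsInternal fun γ => (D.W γ).comap i := by
  refine isInternal_of_ops i S.injective (fun γ => D.proj {γ})
    (fun γ x hx => D.proj_of_mem hx (Set.mem_singleton _))
    (fun γ γ' h x hx => D.proj_of_notMem hx (by simpa using h.symm)) ?_
  intro x
  rw [← S.j_i x]
  generalize i x = y
  induction y using D.hom_induction with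
  | hadd a b ha hb => rw [map_add]; exact add_mem ha hb
  | hW γ y hy =>
    refine Submodule.mem_iSup_of_mem γ ?_
    rw [Submodule.mem_comap, S.i_j]
    exact D.scale_mem _ hy

lemma finite [Module.Finite k H] (γ : I →₀ ℤ) : Module.Finite k ((D.W γ).comap i) := by
  have : Function.Injective (i.restrict (p := (D.W γ).comap i) (q := D.W γ) fun x hx => hx) := by
    intro x y hxy
    exact Subtype.ext (S.injective (congrArg Subtype.val hxy))
  exact FiniteDimensional.of_injective _ this

variable {d : I → k} {B : L →ₗ[k] L →ₗ[k] k} (hF : D.IsForm d B)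
include hF

lemma pull_sep (x : V) (h : ∀ u, pull B i u x = 0) : x = 0 := by
  apply S.injective
  rw [map_zero]
  exact hF.nondeg' _ h

lemma pull_proj (u : L) : pull B i (D.proj (-A) u) = pull B i u := by
  ext x
  rw [pull_apply, pull_apply, hF.proj_adjoint, neg_neg, S.proj_i]

end Slice

namespace IsForm

variable {d : I → k} {B : L →ₗ[k] L →ₗ[k] k} (hF : D.IsForm d B)
include hF

/-- Nondegeneracy embeds each of `W γ` and `W (-γ)` into the dual of the other. Both are
finite-dimensional, so the embeddings are bijective. -/
lemma repr [Module.Finite k H] (γ : I →₀ ℤ) (φ : Module.Dual k (D.W γ)) :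
    ∃ u ∈ D.W (-γ), ∀ x : D.W γ, B u x = φ x := by
  have inj : ∀ γ, Function.Injective (pull B (D.W γ).subtype ∘ₗ (D.W (-γ)).subtype) := by
    intro γ
    rw [← LinearMap.ker_eq_bot, LinearMap.ker_eq_bot']
    intro u hu
    apply Subtype.ext
    refine hF.nondeg _ fun y => ?_
    induction y using D.hom_induction with
    | hadd a b ha hb => rw [map_add, ha, hb, add_zero]
    | hW c y hy =>
      by_cases h : -γ + c = 0
      · have hc : c = γ := by rwa [neg_add_eq_zero, eq_comm] at h
        subst hc
        exact LinearMap.congr_fun hu ⟨y, hy⟩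
      · exact hF.ortho _ _ h _ u.2 _ hy
  have h1 := LinearMap.finrank_le_finrank_of_injective (inj γ)
  have h2 := LinearMap.finrank_le_finrank_of_injective (inj (-γ))
  rw [Subspace.dual_finrank_eq] at h1 h2
  rw [neg_neg] at h2
  have h3 : Module.finrank k (D.W (-γ)) = Module.finrank k (Module.Dual k (D.W γ)) := by
    rw [Subspace.dual_finrank_eq]; exact le_antisymm h1 h2
  obtain ⟨u, hu⟩ := (LinearMap.injective_iff_surjective_of_finrank_eq_finrank h3).1 (inj γ) φ
  exact ⟨u, u.2, fun x => LinearMap.congr_fun hu x⟩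

variable {V : Type*} [AddCommGroup V] [Module k V] {A : Set (I →₀ ℤ)} {i : V →ₗ[k] L}
  {j : L →ₗ[k] V}

lemma mem_gradedDual (u : L) :
    pull B i u ∈ gradedDual fun γ => (D.W γ).comap i := by
  change {γ | ∃ x ∈ (D.W γ).comap i, pull B i u x ≠ 0}.Finite
  induction u using D.hom_induction with
  | hadd a b ha hb =>
    refine (ha.union hb).subset ?_
    rintro γ ⟨x, hx, hne⟩
    by_contra hc
    simp only [Set.mem_union, not_or] at hc
    refine hne ?_
    have h1 : pull B i a x = 0 := by by_contra h; exact hc.1 ⟨x, hx, h⟩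
    have h2 : pull B i b x = 0 := by by_contra h; exact hc.2 ⟨x, hx, h⟩
    rw [map_add, LinearMap.add_apply, h1, h2, add_zero]
  | hW c u hu =>
    refine (Set.finite_singleton (-c)).subset ?_
    rintro γ ⟨x, hx, hne⟩
    by_contra hc
    exact hne (hF.ortho c γ (fun h => hc (eq_neg_of_add_eq_zero_right h)) _ hu _ hx)

/-- A functional in the graded dual involves finitely many weights; the sum of the vectors
representing its restrictions to these, projected to `-A`, represents it. No completion of `L` is
needed. -/
lemma exists_of_mem_gradedDual [Module.Finite k H] (S : D.Slice A i j) {φ : Module.Dual k V}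
    (hφ : φ ∈ gradedDual fun γ => (D.W γ).comap i) :
    ∃ u, D.proj (-A) u = u ∧ φ = pull B i u := by
  classical
  have hfin : {γ | ∃ x ∈ (D.W γ).comap i, φ x ≠ 0}.Finite := hφ
  have hrep := fun γ => hF.repr γ (φ ∘ₗ j ∘ₗ (D.W γ).subtype)
  choose u hu hu' using hrep
  have h1 : φ = pull B i (∑ γ ∈ hfin.toFinset, u γ) := by
    have h2 : φ ∘ₗ j = pull B i (∑ γ ∈ hfin.toFinset, u γ) ∘ₗ j := by
      refine D.hom_ext fun γ x hx => ?_
      have hjx : j x ∈ (D.W γ).comap i := by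
        rw [Submodule.mem_comap, S.i_j]; exact D.scale_mem _ hx
      have h3 : ∀ γ', γ' ≠ γ → B (u γ') (i (j x)) = 0 := fun γ' h =>
        hF.ortho _ _ (by rw [Ne, neg_add_eq_zero]; exact h) _ (hu γ') _ hjx
      have h4 : B (u γ) (i (j x)) = φ (j x) := by
        have := hu' γ ⟨i (j x), hjx⟩
        simpa [S.j_i] using this
      rw [LinearMap.comp_apply, LinearMap.comp_apply, pull_apply, map_sum, LinearMap.sum_apply]
      by_cases hγ : γ ∈ hfin.toFinset
      · rw [Finset.sum_eq_single γ (fun b _ hb => h3 b hb) (fun h => absurd hγ h), h4]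
      · rw [Finset.sum_eq_zero fun b hb => h3 b (by rintro rfl; exact hγ hb)]
        by_contra h
        exact hγ (hfin.mem_toFinset.2 ⟨j x, hjx, h⟩)
    ext x
    have := LinearMap.congr_fun h2 (i x)
    simpa [S.j_i] using this
  exact ⟨D.proj (-A) _, D.proj_idem _ _, by rw [S.pull_proj hF, ← h1]⟩

end IsForm

end KMData

/-! ### The degree decomposition of the dual bracket -/

/-- The weights of degree zero. -/
def zeroSet {I : Type*} (ω : (I →₀ ℤ) →+ ℤ) : Set (I →₀ ℤ) := {γ | ω γ = 0}
/-- The weights of negative degree. -/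
def negSet {I : Type*} (ω : (I →₀ ℤ) →+ ℤ) : Set (I →₀ ℤ) := {γ | ω γ < 0}
/-- The weights of positive degree. -/
def posSet {I : Type*} (ω : (I →₀ ℤ) →+ ℤ) : Set (I →₀ ℤ) := {γ | 0 < ω γ}

section sets

variable {I : Type*} {ω : (I →₀ ℤ) →+ ℤ}

lemma mem_zeroSet {γ : I →₀ ℤ} : γ ∈ zeroSet ω ↔ ω γ = 0 := Iff.rfl
lemma mem_negSet {γ : I →₀ ℤ} : γ ∈ negSet ω ↔ ω γ < 0 := Iff.rfl
lemma mem_posSet {γ : I →₀ ℤ} : γ ∈ posSet ω ↔ 0 < ω γ := Iff.rfl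
lemma neg_zeroSet : -zeroSet ω = zeroSet ω := by ext γ; simp [mem_zeroSet]
lemma neg_negSet : -negSet ω = posSet ω := by ext γ; simp [mem_negSet, mem_posSet]
lemma neg_posSet : -posSet ω = negSet ω := by ext γ; simp [mem_negSet, mem_posSet]

end sets

/-- The extension of the cobracket of `L` to a bracket-compatible operation: `i` a Lie map. -/
lemma map_lie_tensor {k g L : Type*} [Field k] [LieRing g] [LieAlgebra k g] [LieRing L]
    [LieAlgebra k L] (i : g →ₗ[k] L) (hi : ∀ x y, i ⁅x, y⁆ = ⁅i x, i y⁆) (x : g) (t : g ⊗[k] g) :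
    TensorProduct.map i i ⁅x, t⁆ = ⁅i x, TensorProduct.map i i t⁆ := by
  induction t using TensorProduct.induction_on with
  | zero => simp
  | add a b ha hb => simp only [lie_add, map_add, ha, hb]
  | tmul a b => simp [TensorProduct.LieModule.lie_tmul_right, hi]

namespace KMData

variable {k I H L : Type*} [Field k] [CharZero k] [Fintype I] [AddCommGroup H] [Module k H]
  [LieRing L] [LieAlgebra k L] {D : KMData k I H L}

lemma star_hom {a b : I →₀ ℤ} {u v : L} (hu : u ∈ D.W a) (hv : v ∈ D.W b) :
    D.star u v = (1 - wT k a - wT k b) • ⁅u, v⁆ := by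
  rw [star_eq, T, D.scale_apply _ hu, D.scale_apply _ hv, smul_lie, lie_smul]; module

lemma mirror_proj (A : Set (I →₀ ℤ)) (x : L) : D.mirror.proj A x = D.proj (-A) x := by
  induction x using D.hom_induction with
  | hadd a b ha hb => rw [map_add, map_add, ha, hb]
  | hW a x hx =>
  have hx' : x ∈ D.mirror.W (-a) := by rw [mirror_W, neg_neg]; exact hx
  by_cases h : -a ∈ A
  · rw [D.proj_of_mem hx (Set.mem_neg.2 h), D.mirror.proj_of_mem hx' h]
  · rw [D.proj_of_notMem hx (fun h' => h (Set.mem_neg.1 h')), D.mirror.proj_of_notMem hx' h]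

lemma mirror_star (u v : L) : D.mirror.star u v = -D.star u v := by
  simp only [star, mirror_T, sub_sub_cancel, neg_sub]

section degree

variable {ω : (I →₀ ℤ) →+ ℤ} (hω : ∀ γ, 0 ≤ γ → 0 ≤ ω γ)
include hω

/-- A weight that occurs has a sign, and `ω` is nonnegative on nonnegative weights, so positive
degree forces a positive weight. -/
lemma wT_of_pos {a : I →₀ ℤ} {u : L} (hu : u ∈ D.W a) (h : 0 < ω a) : u = 0 ∨ wT k a = 1 := by
  rcases D.W_sign hu with h' | h' | h' | h'
  · exact Or.inl h'
  · exact Or.inr (wT_pos h')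
  · rw [h', map_zero] at h; omega
  · have := hω (-a) (neg_nonneg.2 h'.le)
    rw [map_neg] at this; omega

lemma wT_of_neg {a : I →₀ ℤ} {u : L} (hu : u ∈ D.W a) (h : ω a < 0) : u = 0 ∨ wT k a = 0 := by
  rcases D.W_sign hu with h' | h' | h' | h'
  · exact Or.inl h'
  · have := hω a h'.le; omega
  · rw [h', map_zero] at h; omega
  · exact Or.inr (wT_neg h')

omit hω in
lemma proj_parts (x : L) :
    D.proj (negSet ω) x + D.proj (zeroSet ω) x + D.proj (posSet ω) x = x := by
  induction x using D.hom_induction with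
  | hadd a b ha hb =>
    simp only [map_add]
    conv_rhs => rw [← ha, ← hb]
    abel
  | hW a x hx =>
  rcases lt_trichotomy (ω a) 0 with h | h | h
  · rw [D.proj_of_mem hx (mem_negSet.2 h), D.proj_of_notMem (A := zeroSet ω) hx (fun h' => h.ne h'),
      D.proj_of_notMem (A := posSet ω) hx (fun h' => h.not_gt h')]; simp
  · rw [D.proj_of_mem hx (mem_zeroSet.2 h),
      D.proj_of_notMem (A := negSet ω) hx (fun h' => (mem_negSet.1 h').ne h),
      D.proj_of_notMem (A := posSet ω) hx (fun h' => (mem_posSet.1 h').ne' h)]; simp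
  · rw [D.proj_of_mem hx (mem_posSet.2 h),
      D.proj_of_notMem (A := zeroSet ω) hx (fun h' => h.ne' (mem_zeroSet.1 h')),
      D.proj_of_notMem (A := negSet ω) hx (fun h' => h.not_gt (mem_negSet.1 h'))]; simp

lemma T_of_pos {u : L} (hu : D.proj (posSet ω) u = u) : D.T u = u := by
  rw [← hu]
  clear hu
  induction u using D.hom_induction with
  | hadd a b ha hb => rw [map_add, map_add, ha, hb]
  | hW a u hu =>
  by_cases h : 0 < ω a
  · rw [D.proj_of_mem hu (mem_posSet.2 h), T, D.scale_apply _ hu]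
    rcases wT_of_pos hω hu h with h' | h'
    · rw [h', smul_zero]
    · rw [h', one_smul]
  · rw [D.proj_of_notMem hu h, map_zero]

lemma T_of_neg {u : L} (hu : D.proj (negSet ω) u = u) : D.T u = 0 := by
  rw [← hu]
  clear hu
  induction u using D.hom_induction with
  | hadd a b ha hb => rw [map_add, map_add, ha, hb, add_zero]
  | hW a u hu =>
  by_cases h : ω a < 0
  · rw [D.proj_of_mem hu (mem_negSet.2 h), T, D.scale_apply _ hu]
    rcases wT_of_neg hω hu h with h' | h'
    · rw [h', smul_zero]
    · rw [h', zero_smul]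
  · rw [D.proj_of_notMem hu h, map_zero]

lemma star_of_pos {u v : L} (hu : D.proj (posSet ω) u = u) (hv : D.proj (posSet ω) v = v) :
    D.star u v = -⁅u, v⁆ := by
  simp [star, T_of_pos hω hu, T_of_pos hω hv]

lemma star_of_neg {u v : L} (hu : D.proj (negSet ω) u = u) (hv : D.proj (negSet ω) v = v) :
    D.star u v = ⁅u, v⁆ := by
  simp [star, T_of_neg hω hu, T_of_neg hω hv]

end degree

variable {d : I → k} {B : L →ₗ[k] L →ₗ[k] k}

namespace IsForm

variable (hF : D.IsForm d B)
include hF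

/-- The three terms are the transposes of the three terms of δ x in the double-bosonisation, for x
in b. Degrees must add to zero: two positive degrees give the braided cobracket, one zero and one
positive degree give the terms with `r`, and for opposite nonzero degrees the coefficient 1 - wT a -
wT b vanishes. -/
lemma star_apply_neg {ω : (I →₀ ℤ) →+ ℤ} (hω : ∀ γ, 0 ≤ γ → 0 ≤ ω γ) {x : L}
    (hx : D.proj (negSet ω) x = x) (u v : L) : B (D.star u v) x
      = -B ⁅D.proj (posSet ω) u, D.proj (posSet ω) v⁆ x + B ⁅x, v⁆ (D.T (D.proj (zeroSet ω) u))
        - B ⁅x, u⁆ (D.T (D.proj (zeroSet ω) v)) := by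
  rw [← hx]
  clear hx
  induction x using D.hom_induction with
  | hadd a b ha hb => simp only [map_add, ha, hb, add_lie, LinearMap.add_apply]; ring
  | hW c x hx =>
  by_cases hc : ω c < 0
  swap
  · rw [D.proj_of_notMem hx hc]; simp
  rw [D.proj_of_mem hx (mem_negSet.2 hc)]
  induction u using D.hom_induction with
  | hadd a b ha hb =>
    simp only [star_add_left, map_add, ha, hb, add_lie, lie_add, LinearMap.add_apply]; ring
  | hW a u hu =>
  induction v using D.hom_induction with
  | hadd a b ha hb =>
    simp only [star_add_right, map_add, ha, hb, lie_add, LinearMap.add_apply]; ring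
  | hW b v hv =>
  by_cases hs : a + b + c = 0
  swap
  · have hpu : D.proj (posSet ω) u ∈ D.W a := D.scale_mem _ hu
    have hpv : D.proj (posSet ω) v ∈ D.W b := D.scale_mem _ hv
    have hzu : D.T (D.proj (zeroSet ω) u) ∈ D.W a := D.scale_mem _ (D.scale_mem _ hu)
    have hzv : D.T (D.proj (zeroSet ω) v) ∈ D.W b := D.scale_mem _ (D.scale_mem _ hv)
    rw [star_hom hu hv, map_smul, LinearMap.smul_apply,
      hF.ortho _ _ hs _ (D.lie_mem_W hu hv) _ hx,
      hF.ortho _ _ hs _ (D.lie_mem_W hpu hpv) _ hx,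
      hF.ortho (c + b) a (by rwa [add_comm, ← add_assoc, add_right_comm]) _ (D.lie_mem_W hx hv) _
        hzu,
      hF.ortho (c + a) b (by rwa [add_comm c a, add_right_comm]) _ (D.lie_mem_W hx hu) _ hzv]
    simp
  have hs' : ω a + ω b + ω c = 0 := by rw [← map_add, ← map_add, hs, map_zero]
  have e1 : B ⁅x, u⁆ v = B ⁅u, v⁆ x := by rw [hF.inv, hF.symm]
  have e2 : B ⁅x, v⁆ u = -B ⁅u, v⁆ x := by
    rw [hF.inv, hF.symm, ← lie_skew, map_neg, LinearMap.neg_apply]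
  have z0 : ∀ {a : I →₀ ℤ} {u : L}, u ∈ D.W a → ω a ≠ 0 → D.proj (zeroSet ω) u = 0 :=
    fun hu h => D.proj_of_notMem hu h
  have z1 : ∀ {a : I →₀ ℤ} {u : L}, u ∈ D.W a → ω a ≤ 0 → D.proj (posSet ω) u = 0 :=
    fun hu h => D.proj_of_notMem hu (fun h' => h.not_gt (mem_posSet.1 h'))
  rw [star_hom hu hv]
  rcases lt_trichotomy (ω a) 0 with ha | ha | ha
  · have hb : 0 < ω b := by omega
    rw [z1 hu ha.le, z0 hu ha.ne, z0 hv hb.ne']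
    rcases wT_of_neg hω hu ha with h | h
    · subst h; simp
    rcases wT_of_pos hω hv hb with h' | h'
    · subst h'; simp
    rw [h, h']; simp
  · have hb : 0 < ω b := by omega
    rw [z1 hu ha.le, D.proj_of_mem hu (mem_zeroSet.2 ha), z0 hv hb.ne', T, D.scale_apply _ hu,
      map_smul, map_smul, LinearMap.smul_apply, e2]
    rcases wT_of_pos hω hv hb with h' | h'
    · subst h'; simp
    rw [h']; simp
  · rw [D.proj_of_mem hu (mem_posSet.2 ha), z0 hu ha.ne']
    rcases wT_of_pos hω hu ha with h | h
    · subst h; simp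
    rcases lt_trichotomy (ω b) 0 with hb | hb | hb
    · rw [z1 hv hb.le, z0 hv hb.ne]
      rcases wT_of_neg hω hv hb with h' | h'
      · subst h'; simp
      rw [h, h']; simp
    · rw [z1 hv hb.le, D.proj_of_mem hv (mem_zeroSet.2 hb),
        T, D.scale_apply _ hv, map_smul, map_smul, LinearMap.smul_apply, e1, h]
      simp
    · rw [D.proj_of_mem hv (mem_posSet.2 hb), z0 hv hb.ne']
      rcases wT_of_pos hω hv hb with h' | h'
      · subst h'; simp
      rw [h, h', map_smul, LinearMap.smul_apply]
      simp only [smul_eq_mul, map_zero]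
      ring

/-- The mirror image of `star_apply_neg`. Mirroring replaces `T` by 1 - `T`, and taking adjoints
brings `T` back. -/
lemma star_apply_pos {ω : (I →₀ ℤ) →+ ℤ} (hω : ∀ γ, 0 ≤ γ → 0 ≤ ω γ) {x : L}
    (hx : D.proj (posSet ω) x = x) (u v : L) : B (D.star u v) x
      = B ⁅D.proj (negSet ω) u, D.proj (negSet ω) v⁆ x + B v (D.T (D.proj (zeroSet ω) ⁅x, u⁆))
        - B u (D.T (D.proj (zeroSet ω) ⁅x, v⁆)) := by
  have h1 := hF.mirror.star_apply_neg hω (x := x) (by rw [mirror_proj, neg_negSet, hx]) u v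
  rw [mirror_star, mirror_proj, mirror_proj, mirror_proj, mirror_proj, neg_posSet, neg_zeroSet,
    mirror_T, mirror_T, map_neg, LinearMap.neg_apply] at h1
  have h2 : ∀ u v, B u (D.T (D.proj (zeroSet ω) v))
      = B v (D.proj (zeroSet ω) u - D.T (D.proj (zeroSet ω) u)) := by
    intro u v
    rw [T_proj, hF.symm, hF.proj_adjoint, neg_zeroSet, hF.T_adjoint, T_proj]
  rw [h2, h2]
  linear_combination -h1

end IsForm

end KMData

/-! ### Restricted cobrackets and the formal quasitriangular structure -/

namespace KMData

variable {k I H L : Type*} [Field k] [CharZero k] [Fintype I] [AddCommGroup H] [Module k H]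
  [LieRing L] [LieAlgebra k L] {D : KMData k I H L}

variable {d : I → k} {B : L →ₗ[k] L →ₗ[k] k}

namespace IsForm

variable (hF : D.IsForm d B)
include hF

/-- A criterion for the vectors with weights in `A` to be closed under the cobracket. Only weights
`a`, `b` with sum in `-A` are seen, and if they are not both in `-A`, the condition wT a + wT b = 1
makes the star product vanish. -/
lemma star_proj {A : Set (I →₀ ℤ)}
    (hA : ∀ a b, a + b ∈ -A → ∀ u ∈ D.W a, ∀ v ∈ D.W b, u = 0 ∨ v = 0 ∨ (a ∈ -A ∧ b ∈ -A) ∨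
      (¬(a ∈ -A ∧ b ∈ -A) ∧ wT k a + wT k b = 1)) {x : L} (hx : D.proj A x = x) (u v : L) :
    B (D.star (D.proj (-A) u) (D.proj (-A) v)) x = B (D.star u v) x := by
  rw [← hx]
  clear hx
  induction x using D.hom_induction with
  | hadd a b ha hb => simp only [map_add, ha, hb]
  | hW c x hx =>
  by_cases hc : c ∈ A
  swap
  · rw [D.proj_of_notMem hx hc]; simp
  rw [D.proj_of_mem hx hc]
  induction u using D.hom_induction with
  | hadd a b ha hb => simp only [star_add_left, map_add, LinearMap.add_apply, ha, hb]
  | hW a u hu =>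
  induction v using D.hom_induction with
  | hadd a b ha hb => simp only [star_add_right, map_add, LinearMap.add_apply, ha, hb]
  | hW b v hv =>
  by_cases hs : a + b + c = 0
  swap
  · have h1 : D.proj (-A) u ∈ D.W a := D.scale_mem _ hu
    have h2 : D.proj (-A) v ∈ D.W b := D.scale_mem _ hv
    rw [star_hom hu hv, star_hom h1 h2, map_smul, map_smul, LinearMap.smul_apply,
      LinearMap.smul_apply, hF.ortho _ _ hs _ (D.lie_mem_W hu hv) _ hx,
      hF.ortho _ _ hs _ (D.lie_mem_W h1 h2) _ hx]
  rcases hA a b (by rw [Set.mem_neg, neg_eq_of_add_eq_zero_right hs]; exact hc) u hu v hv with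
    h | h | h | h
  · subst h; simp [star_zero_left]
  · subst h; simp [star_zero_right]
  · rw [D.proj_of_mem hu h.1, D.proj_of_mem hv h.2]
  · have h0 : D.star u v = 0 := by rw [star_hom hu hv, sub_sub, h.2, sub_self, zero_smul]
    rw [h0]
    by_cases ha : a ∈ -A
    · rw [D.proj_of_notMem hv (fun hb => h.1 ⟨ha, hb⟩), star_zero_right]
    · rw [D.proj_of_notMem hu ha, star_zero_left]

lemma star_proj_zeroSet {ω : (I →₀ ℤ) →+ ℤ} (hω : ∀ γ, 0 ≤ γ → 0 ≤ ω γ) {x : L}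
    (hx : D.proj (zeroSet ω) x = x) (u v : L) :
    B (D.star (D.proj (zeroSet ω) u) (D.proj (zeroSet ω) v)) x = B (D.star u v) x := by
  have := hF.star_proj (A := zeroSet ω) ?_ hx u v
  · rwa [neg_zeroSet] at this
  rw [neg_zeroSet]
  intro a b hab u hu v hv
  rw [mem_zeroSet, map_add] at hab
  rcases lt_trichotomy (ω a) 0 with ha | ha | ha
  · rcases wT_of_neg hω hu ha with h | h
    · exact Or.inl h
    rcases wT_of_pos hω hv (by omega) with h' | h'
    · exact Or.inr (Or.inl h')
    · exact Or.inr (Or.inr (Or.inr ⟨fun h => ha.ne (mem_zeroSet.1 h.1), by rw [h, h', zero_add]⟩))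
  · exact Or.inr (Or.inr (Or.inl ⟨ha, by rw [mem_zeroSet]; omega⟩))
  · rcases wT_of_pos hω hu ha with h | h
    · exact Or.inl h
    rcases wT_of_neg hω hv (by omega) with h' | h'
    · exact Or.inr (Or.inl h')
    · exact Or.inr (Or.inr (Or.inr ⟨fun h => ha.ne' (mem_zeroSet.1 h.1), by rw [h, h', add_zero]⟩))

lemma star_proj_nonpos {x : L} (hx : D.proj {γ | γ ≤ 0} x = x) (u v : L) :
    B (D.star (D.proj {γ | 0 ≤ γ} u) (D.proj {γ | 0 ≤ γ} v)) x = B (D.star u v) x := by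
  have hA : -{γ : I →₀ ℤ | γ ≤ 0} = {γ | 0 ≤ γ} := by ext γ; simp
  have := hF.star_proj (A := {γ | γ ≤ 0}) ?_ hx u v
  · rwa [hA] at this
  rw [hA]
  intro a b (hab : 0 ≤ a + b) u hu v hv
  by_cases h : 0 ≤ a ∧ 0 ≤ b
  · exact Or.inr (Or.inr (Or.inl h))
  have key : ∀ {a b : I →₀ ℤ}, 0 ≤ a + b → a < 0 → 0 < b := fun {a b} h1 h2 =>
    (neg_pos.2 h2).trans_le (by rwa [neg_le_iff_add_nonneg, add_comm])
  rcases D.W_sign hu with h1 | h1 | h1 | h1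
  · exact Or.inl h1
  · rcases D.W_sign hv with h2 | h2 | h2 | h2
    · exact Or.inr (Or.inl h2)
    · exact absurd ⟨h1.le, h2.le⟩ h
    · exact absurd ⟨h1.le, h2.ge⟩ h
    · exact Or.inr (Or.inr (Or.inr ⟨h, by rw [wT_pos h1, wT_neg h2, add_zero]⟩))
  · refine absurd ⟨h1.ge, ?_⟩ h
    rwa [h1, zero_add] at hab
  · exact Or.inr (Or.inr (Or.inr ⟨h, by rw [wT_pos (key hab h1), wT_neg h1, zero_add]⟩))

section restricted

variable {g : Type*} [LieRing g] [LieAlgebra k g] {A : Set (I →₀ ℤ)} {i : g →ₗ[k] L}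
  {j : L →ₗ[k] g} (S : D.Slice A i j) {δ : L →ₗ[k] L ⊗[k] L}
  (hδ : ∀ u v x, tensorDual (B u) (B v) (δ x) = B (D.star u v) x)
  (hA : ∀ x, D.proj A x = x → ∀ u v,
    B (D.star (D.proj (-A) u) (D.proj (-A) v)) x = B (D.star u v) x)
include S hδ hA

/-- By `hA` the tensor δ(i x) does not see components of the test vectors outside `-A`. So it
already lies in the tensor square of the slice, and compressing by `j` loses nothing. -/
lemma restricted_map (x : g) : TensorProduct.map i i (TensorProduct.map j j (δ (i x))) = δ (i x) := by
  refine hF.pair_ext fun u v => ?_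
  rw [← LinearMap.comp_apply (f := TensorProduct.map i i), ← TensorProduct.map_comp, tensorDual_map]
  have h1 : ∀ u, B u ∘ₗ i ∘ₗ j = B (D.proj (-A) u) := by
    intro u
    ext x
    simp only [LinearMap.comp_apply]
    rw [S.i_j, hF.proj_adjoint, neg_neg]
  rw [h1, h1, hδ, hδ, hA _ (S.proj_i x)]

lemma restricted_pairing (u v : L) (x : g) :
    tensorDual (pull B i u) (pull B i v) (TensorProduct.map j j (δ (i x)))
      = B (D.star u v) (i x) := by
  rw [← tensorDual_map_pull, hF.restricted_map S hδ hA, hδ]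

lemma restricted_isLieBialgebra (hi : ∀ x y, i ⁅x, y⁆ = ⁅i x, i y⁆) :
    IsLieBialgebra (TensorProduct.map j j ∘ₗ δ ∘ₗ i) where
  coalgebra := isLieCoalgebra_of_pairing (F := pull B i) (S.pull_sep hF) D.star
    (fun u v x => hF.restricted_pairing S hδ hA u v x)
    (fun u v x => by
      rw [pull_apply, pull_apply, D.star_skew u v, map_neg]; simp)
    (fun u v w x => by
      simp only [pull_apply]
      rw [← LinearMap.add_apply, ← LinearMap.add_apply, ← map_add, ← map_add, D.star_jacobi]; simp)
  cocycle x y := by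
    refine tensor_ext (S.pull_sep hF) (S.pull_sep hF) fun u v => ?_
    rw [← tensorDual_map_pull, ← tensorDual_map_pull]
    congr 1
    simp only [LinearMap.comp_apply, map_sub]
    rw [map_lie_tensor i hi, map_lie_tensor i hi, hF.restricted_map S hδ hA,
      hF.restricted_map S hδ hA, hF.restricted_map S hδ hA, hi, (hF.isLieBialgebra hδ).cocycle]

end restricted

section quasitriangular

variable {ω : (I →₀ ℤ) →+ ℤ}
variable {g : Type*} [LieRing g] [LieAlgebra k g] {i : g →ₗ[k] L} {j : L →ₗ[k] g}

/-- For `γ` of degree zero the tensor is `c` times the canonical element of the pairing, a basis of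
`W γ` against the dual basis of `W (-γ)`. For other `γ` it is zero. -/
lemma exists_component [Module.Finite k H] (S : D.Slice (zeroSet ω) i j) (γ : I →₀ ℤ) (c : k) :
    ∃ t : g ⊗[k] g, (∀ u v, tensorDual (pull B i u) (pull B i v) t
      = c * B u (D.proj {γ} (D.proj (zeroSet ω) v))) ∧
      t ∈ LinearMap.range (TensorProduct.map ((D.W γ).comap i).subtype
        ((D.W (-γ)).comap i).subtype) := by
  by_cases hγ : ω γ = 0
  swap
  · refine ⟨0, fun u v => ?_, zero_mem _⟩
    rw [proj_proj, show {γ} ∩ zeroSet ω = ∅ by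
      ext γ'; simp only [Set.mem_inter_iff, Set.mem_singleton_iff, mem_zeroSet, Set.mem_empty_iff_false,
        iff_false]; rintro ⟨rfl, h⟩; exact hγ h]
    have : D.proj ∅ v = 0 := by
      have h1 := D.proj_disjoint (A := Set.univ) (A' := ∅) (by simp) (x := v) (by
        induction v using D.hom_induction with
        | hadd a b ha hb => rw [map_add, ha, hb]
        | hW a v hv => exact D.proj_of_mem hv (Set.mem_univ _))
      exact h1
    simp [this]
  let b := Module.finBasis k (D.W γ)
  have hrep := fun m => hF.repr γ (b.coord m)
  choose y hy hy' using hrep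
  have hij : ∀ {γ' x}, ω γ' = 0 → x ∈ D.W γ' → i (j x) = x := fun h hx => by
    rw [S.i_j, D.proj_of_mem hx (mem_zeroSet.2 h)]
  have hγ' : ω (-γ) = 0 := by rw [map_neg, hγ, neg_zero]
  refine ⟨c • ∑ m, j (b m : L) ⊗ₜ[k] j (y m), fun u v => ?_, ?_⟩
  · have h1 : ∀ m, B v (y m) = b.coord m ⟨D.proj {γ} v, D.proj_mem_W γ v⟩ := by
      intro m
      rw [← hy' m, hF.symm (y m), hF.proj_adjoint, Set.neg_singleton,
        D.proj_of_mem (hy m) (Set.mem_singleton _)]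
    have h2 : D.proj {γ} (D.proj (zeroSet ω) v) = D.proj {γ} v := by
      rw [proj_proj, Set.inter_eq_left.2]
      rintro _ rfl; exact hγ
    rw [map_smul, map_sum, smul_eq_mul, h2]
    congr 1
    simp only [tensorDual_tmul, pull_apply, hij hγ (b _).2, hij hγ' (hy _), h1]
    have h3 := congrArg Subtype.val (b.sum_repr ⟨D.proj {γ} v, D.proj_mem_W γ v⟩)
    rw [Submodule.coe_sum] at h3
    dsimp only at h3
    conv_rhs => rw [← h3]
    rw [map_sum]
    refine Finset.sum_congr rfl fun m _ => ?_
    rw [Submodule.coe_smul, map_smul, smul_eq_mul, mul_comm]; rfl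
  · refine Submodule.smul_mem _ _ (Submodule.sum_mem _ fun m _ => ?_)
    exact ⟨⟨j (b m), by rw [Submodule.mem_comap, hij hγ (b m).2]; exact (b m).2⟩ ⊗ₜ[k]
      ⟨j (y m), by rw [Submodule.mem_comap, hij hγ' (hy m)]; exact hy m⟩, by simp⟩

/-- The defining property of the family `r` pairing a vector with the positive part of another. -/
def _root_.KacMoody.IsRFamily (D : KMData k I H L) (ω : (I →₀ ℤ) →+ ℤ) (B : L →ₗ[k] L →ₗ[k] k)
    (i : g →ₗ[k] L) (r : (I →₀ ℕ) → g ⊗[k] g) : Prop :=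
  ∀ β u v, tensorDual (pull B i u) (pull B i v) (r β)
    = wT k (toInt β) * B u (D.proj {toInt β} (D.proj (zeroSet ω) v))

variable {r : (I →₀ ℕ) → g ⊗[k] g} (hr : IsRFamily D ω B i r)
include hr

omit hF in
lemma finite_r (u v : L) : {β | tensorDual (pull B i u) (pull B i v) (r β) ≠ 0}.Finite := by
  induction v using D.hom_induction with
  | hadd a b ha hb =>
    refine (ha.union hb).subset fun β hβ => ?_
    by_contra hc
    simp only [Set.mem_union, Set.mem_ofPred_eq, not_or, not_not] at hc
    refine hβ ?_
    rw [map_add, tensorDual_add_right, hc.1, hc.2, add_zero]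
  | hW a v hv =>
    refine Set.Subsingleton.finite (s := _) (fun β hβ β' hβ' => toInt_injective ?_)
    have key : ∀ β, tensorDual (pull B i u) (pull B i v) (r β) ≠ 0 → toInt β = a := by
      intro β hβ
      by_contra hne
      refine hβ ?_
      have hz : D.proj (zeroSet ω) v ∈ D.W a := D.scale_mem _ hv
      rw [hr, D.proj_of_notMem hz (fun h => hne (Set.mem_singleton_iff.1 h).symm)]
      simp
    rw [key β hβ, key β' hβ']

omit hF in
-- The sum runs over nonnegative weights with the scalars `wT`. Negative weights, which are missing,
-- are exactly those on which `T` vanishes. So `r` represents `T` on the degree-zero part.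
lemma finsum_r (u v : L) : ∑ᶠ β, tensorDual (pull B i u) (pull B i v) (r β)
    = B u (D.T (D.proj (zeroSet ω) v)) := by
  induction v using D.hom_induction with
  | hadd a b ha hb =>
    simp only [map_add, tensorDual_add_right]
    rw [finsum_add_distrib (finite_r hr u a) (finite_r hr u b), ha, hb]
  | hW a v hv =>
    have hz : D.proj (zeroSet ω) v ∈ D.W a := D.scale_mem _ hv
    by_cases ha : ∃ β, toInt β = a
    · obtain ⟨β, rfl⟩ := ha
      rw [finsum_eq_single _ β, hr, D.proj_of_mem hz (Set.mem_singleton _), T,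
        D.scale_apply _ hz, map_smul, smul_eq_mul]
      intro β' hβ'
      rw [hr, D.proj_of_notMem hz (fun h => hβ' (toInt_injective h.symm))]; simp
    · have : ∀ β, tensorDual (pull B i u) (pull B i v) (r β) = 0 := by
        intro β
        rw [hr, D.proj_of_notMem hz (fun h => ha ⟨β, h.symm⟩)]; simp
      simp only [this, finsum_zero]
      rw [T, D.scale_apply _ hz]
      rcases D.W_sign hv with h | h | h | h
      · simp [h]
      · exact absurd (exists_toInt h.le) ha
      · exact absurd (exists_toInt h.ge) ha
      · rw [wT_neg h]; simp

lemma finite_twiceSym (u v : L) :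
    {β | tensorDual (pull B i u) (pull B i v) (twiceSym (r β)) ≠ 0}.Finite := by
  refine ((finite_r hr u v).union (finite_r hr v u)).subset fun β hβ => ?_
  by_contra hc
  simp only [Set.mem_union, Set.mem_ofPred_eq, not_or, not_not] at hc
  exact hβ (by rw [twiceSym, map_add, tensorDual_comm, hc.1, hc.2, add_zero])

/-- As `T` plus its adjoint is the identity, symmetrizing `r` yields the canonical element of `B` on
degree zero. -/
lemma finsum_twiceSym (u v : L) : ∑ᶠ β, tensorDual (pull B i u) (pull B i v) (twiceSym (r β))
    = B u (D.proj (zeroSet ω) v) := by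
  simp only [twiceSym, map_add, tensorDual_comm]
  rw [finsum_add_distrib (finite_r hr u v) (finite_r hr v u), finsum_r hr, finsum_r hr,
    hF.symm v, hF.T_adjoint, hF.proj_adjoint, neg_zeroSet, map_sub, map_sub, T_proj]
  ring

lemma idTensor_r (v : L) (β : I →₀ ℕ) :
    i (idTensor (pull B i v) (r β)) = D.proj {toInt β} (D.proj (zeroSet ω) (D.T v)) := by
  rw [← sub_eq_zero]
  refine hF.nondeg' _ fun u => ?_
  rw [map_sub, sub_eq_zero, ← pull_apply, apply_idTensor, hr]
  induction v using D.hom_induction with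
  | hadd a b ha hb => simp only [map_add, mul_add, ha, hb]
  | hW a v hv =>
    have hz : D.proj (zeroSet ω) v ∈ D.W a := D.scale_mem _ hv
    rw [T, D.scale_apply _ hv, map_smul, map_smul, map_smul, smul_eq_mul]
    by_cases h : a = toInt β
    · rw [h]
    · rw [D.proj_of_notMem hz h]; simp

omit hF hr in
-- The image of `T` has nonnegative weights only. For these the degree of a sum is zero only if both
-- degrees are, so projection to degree zero is multiplicative, and weight `β` splits over the
-- antidiagonal.
lemma _root_.KacMoody.KMData.proj_lie_T [DecidableEq I] (hω : ∀ γ, 0 ≤ γ → 0 ≤ ω γ) (u v : L) (β : I →₀ ℕ) :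
    D.proj {toInt β} (D.proj (zeroSet ω) ⁅D.T u, D.T v⁆)
      = ∑ p ∈ Finset.HasAntidiagonal.antidiagonal β,
        ⁅D.proj {toInt p.1} (D.proj (zeroSet ω) (D.T u)),
          D.proj {toInt p.2} (D.proj (zeroSet ω) (D.T v))⁆ := by
  induction u using D.hom_induction with
  | hadd a b ha hb => simp only [map_add, add_lie, ha, hb, Finset.sum_add_distrib]
  | hW a u hu =>
  induction v using D.hom_induction with
  | hadd a b ha hb => simp only [map_add, lie_add, ha, hb, Finset.sum_add_distrib]
  | hW b v hv =>
  have pos : ∀ {a : I →₀ ℤ} {u : L}, u ∈ D.W a → D.T u = 0 ∨ ∃ p, toInt p = a := by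
    intro a u hu
    rcases D.W_sign hu with h | h | h | h
    · simp [h]
    · exact Or.inr (exists_toInt h.le)
    · exact Or.inr (exists_toInt h.ge)
    · left; rw [T, D.scale_apply _ hu, wT_neg h, zero_smul]
  rcases pos hu with h | ⟨p, rfl⟩
  · rw [h]; simp
  rcases pos hv with h | ⟨q, rfl⟩
  · rw [h]; simp
  have hTu : D.T u ∈ D.W (toInt p) := D.scale_mem _ hu
  have hTv : D.T v ∈ D.W (toInt q) := D.scale_mem _ hv
  have hzu : D.proj (zeroSet ω) (D.T u) ∈ D.W (toInt p) := D.scale_mem _ hTu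
  have hzv : D.proj (zeroSet ω) (D.T v) ∈ D.W (toInt q) := D.scale_mem _ hTv
  have huv := D.lie_mem_W hTu hTv
  have hadd : toInt p + toInt q = toInt (p + q) := by
    ext i; simp [toInt_apply]
  have e1 : D.proj (zeroSet ω) ⁅D.T u, D.T v⁆
      = ⁅D.proj (zeroSet ω) (D.T u), D.proj (zeroSet ω) (D.T v)⁆ := by
    have hp := hω _ (toInt_nonneg p)
    have hq := hω _ (toInt_nonneg q)
    by_cases h1 : ω (toInt p) = 0
    · by_cases h2 : ω (toInt q) = 0
      · rw [D.proj_of_mem huv (by rw [mem_zeroSet, map_add]; omega), D.proj_of_mem hTu h1,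
          D.proj_of_mem hTv h2]
      · rw [D.proj_of_notMem huv (by rw [mem_zeroSet, map_add]; omega),
          D.proj_of_notMem hTv h2, lie_zero]
    · rw [D.proj_of_notMem huv (by rw [mem_zeroSet, map_add]; omega),
          D.proj_of_notMem hTu h1, zero_lie]
  rw [e1]
  have hz := D.lie_mem_W hzu hzv
  rw [hadd] at hz
  by_cases hpq : p + q = β
  · rw [← hpq, D.proj_of_mem hz (Set.mem_singleton _), Finset.sum_eq_single (p, q)]
    · rw [D.proj_of_mem hzu (Set.mem_singleton _), D.proj_of_mem hzv (Set.mem_singleton _)]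
    · rintro ⟨p', q'⟩ _ hne
      by_cases h : p' = p
      · rw [D.proj_of_notMem hzv (A := {toInt q'}), lie_zero]
        intro h'
        exact hne (by rw [h, toInt_injective h'])
      · rw [D.proj_of_notMem hzu (A := {toInt p'}), zero_lie]
        exact fun h' => h (toInt_injective h').symm
    · intro h
      rw [Finset.HasAntidiagonal.mem_antidiagonal] at h
      exact absurd rfl h
  · rw [D.proj_of_notMem hz (fun h => hpq (toInt_injective h))]
    symm
    refine Finset.sum_eq_zero ?_
    rintro ⟨p', q'⟩ h
    rw [Finset.HasAntidiagonal.mem_antidiagonal] at h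
    by_cases hp : p' = p
    · rw [D.proj_of_notMem hzv (A := {toInt q'}), lie_zero]
      intro h'
      exact hpq (by rw [← h, hp, ← toInt_injective h'])
    · rw [D.proj_of_notMem hzu (A := {toInt p'}), zero_lie]
      exact fun h' => hp (toInt_injective h').symm

omit hr hF in
lemma _root_.LieBi.bracket1312_pairing (hi : ∀ x y, i ⁅x, y⁆ = ⁅i x, i y⁆) (w u v : L) (t t' : g ⊗[k] g) :
    tensorDual (pull B i w) (tensorDual (pull B i u) (pull B i v)) (bracket1312 t t')
      = B w ⁅i (idTensor (pull B i v) t), i (idTensor (pull B i u) t')⁆ := by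
  induction t using TensorProduct.induction_on with
  | zero => simp [bracket1312]
  | add a b ha hb =>
    rw [bracket1312, TensorProduct.add_tmul, map_add, map_add, map_add]
    rw [bracket1312] at ha hb
    rw [ha, hb]; simp
  | tmul a b =>
  induction t' using TensorProduct.induction_on with
  | zero => simp [bracket1312]
  | add a b ha hb =>
    rw [bracket1312, TensorProduct.tmul_add, map_add, map_add, map_add]
    rw [bracket1312] at ha hb
    rw [ha, hb]; simp
  | tmul c d =>
    simp [bracket1312, bracketMap, idTensor, hi]
    ring

lemma isFormallyQuasitriangular [Module.Finite k H] [DecidableEq I] (hω : ∀ γ, 0 ≤ γ → 0 ≤ ω γ)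
    (S : D.Slice (zeroSet ω) i j) (hi : ∀ x y, i ⁅x, y⁆ = ⁅i x, i y⁆)
    (hom : ∀ β, r β ∈ LinearMap.range (TensorProduct.map ((D.W (toInt β)).comap i).subtype
        ((D.W (-toInt β)).comap i).subtype))
    {δ : L →ₗ[k] L ⊗[k] L}
    (hδ : ∀ u v x, tensorDual (B u) (B v) (δ x) = B (D.star u v) x) :
    IsFormallyQuasitriangular (fun γ => (D.W γ).comap i) (TensorProduct.map j j ∘ₗ δ ∘ₗ i) r := by
  have hA : ∀ x, D.proj (zeroSet ω) x = x → ∀ u v,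
      B (D.star (D.proj (-zeroSet ω) u) (D.proj (-zeroSet ω) v)) x = B (D.star u v) x := by
    intro x hx u v
    rw [neg_zeroSet, hF.star_proj_zeroSet hω hx]
  refine ⟨hF.restricted_isLieBialgebra S hδ hA hi, S.internal, ?_, hom, ?_, ?_⟩
  · intro γ γ' x y hx hy
    rw [Submodule.mem_comap, hi]
    exact D.lie_mem_W hx hy
  -- The functionals come from vectors `u`, `v`. Moving ad ξ onto them turns the formal sum into the
  -- commutator of ad ξ with `T` on degree zero, which is the cobracket by `star_apply`.
  · intro ξ φ hφ ψ hψ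
    obtain ⟨u, -, rfl⟩ := hF.exists_of_mem_gradedDual S hφ
    obtain ⟨v, -, rfl⟩ := hF.exists_of_mem_gradedDual S hψ
    have h1 : ∀ β, tensorDual (pull B i u) (pull B i v) ⁅ξ, r β⁆
        = tensorDual (pull B i (-⁅i ξ, u⁆)) (pull B i v) (r β)
          + tensorDual (pull B i u) (pull B i (-⁅i ξ, v⁆)) (r β) := by
      intro β
      rw [← tensorDual_map_pull, map_lie_tensor i hi, hF.pair_lie, ← tensorDual_map_pull,
        ← tensorDual_map_pull]
      simp only [tensorDual_map_pull]
      rw [map_neg (pull B i), map_neg (pull B i), ← neg_one_smul k (pull B i ⁅i ξ, v⁆),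
        tensorDual_smul_right, tensorDual_neg_left]
      ring
    simp only [h1]
    rw [finsum_add_distrib (finite_r hr _ _) (finite_r hr _ _), finsum_r hr, finsum_r hr,
      LinearMap.comp_apply, LinearMap.comp_apply, hF.restricted_pairing S hδ hA,
      ← hF.star_proj_zeroSet hω (S.proj_i ξ)]
    have h2 := hF.star_proj_zeroSet hω (S.proj_i ξ) u (D.proj (zeroSet ω) v)
    rw [D.proj_idem] at h2
    have h3 : D.proj (zeroSet ω) ⁅i ξ, v⁆ = ⁅i ξ, D.proj (zeroSet ω) v⁆ :=
      D.proj_lie_comm (A := zeroSet ω) (fun a ha b => by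
        rw [mem_zeroSet, mem_zeroSet, map_add, mem_zeroSet.1 ha, zero_add]) (S.proj_i ξ) v
    rw [h2, hF.star_apply, map_neg, map_neg, map_neg, map_neg, h3, LinearMap.neg_apply, hF.inv_left,
      map_sub, neg_neg]
    ring
  -- Contracted with `u` and `v`, the hexagon is the weight-`β` component of `T_star`.
  · intro β
    refine tensor_ext (F := pull B i) (G := fun p : L × L => tensorDual (pull B i p.1) (pull B i p.2))
      (S.pull_sep hF) (tensor_sep' (S.pull_sep hF) (S.pull_sep hF)) ?_
    rintro w ⟨u, v⟩
    rw [tensorDual_map, map_sum]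
    have h1 : tensorDual (pull B i u) (pull B i v) ∘ₗ (TensorProduct.map j j ∘ₗ δ ∘ₗ i)
        = pull B i (D.star u v) := by
      ext x
      exact hF.restricted_pairing S hδ hA u v x
    simp only [bracket1312_pairing hi, hF.idTensor_r hr]
    rw [h1, LinearMap.comp_id, ← map_sum, ← proj_lie_T hω, ← apply_idTensor, pull_apply,
      hF.idTensor_r hr, T_star, ← lie_skew]
    simp

end quasitriangular

end IsForm

end KMData

end KacMoody

/-! ### Actions of two-tensors and their vanishing -/

namespace LieBi

section vanish

variable {k : Type*} [Field k] {g : Type*} [LieRing g] [LieAlgebra k g]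
variable {V : Type*} [AddCommGroup V] [Module k V] (act : g →ₗ[k] Module.End k V)

@[simp] lemma actTensor_tmul (a b : g) (x y : V) :
    actTensor act (a ⊗ₜ[k] b) (x ⊗ₜ[k] y) = act a x ⊗ₜ[k] act b y := by
  simp [actTensor]

lemma actTensor_zero : actTensor act 0 = 0 := by simp [actTensor]

lemma actTensor_add (t t' : g ⊗[k] g) :
    actTensor act (t + t') = actTensor act t + actTensor act t' := by simp [actTensor]

@[simp] lemma actRight_tmul (a b : g) (x : V) :
    actRight act (a ⊗ₜ[k] b) x = a ⊗ₜ[k] act b x := by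
  simp [actRight]

lemma actRight_add (t t' : g ⊗[k] g) (x : V) :
    actRight act (t + t') x = actRight act t x + actRight act t' x := by simp [actRight]

lemma actRight_zero (x : V) : actRight act 0 x = 0 := by simp [actRight]

lemma actTensor_comm (t : g ⊗[k] g) (x y : V) :
    actTensor act (TensorProduct.comm k g g t) (x ⊗ₜ[k] y)
      = TensorProduct.comm k V V (actTensor act t (y ⊗ₜ[k] x)) := by
  induction t using TensorProduct.induction_on with
  | zero => simp [actTensor_zero]
  | add a b ha hb => simp only [map_add, actTensor_add, LinearMap.add_apply, ha, hb]
  | tmul a b => simp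

lemma range_map_induction {V : Type*} [AddCommGroup V] [Module k V] {p q : Submodule k V}
    {P : V ⊗[k] V → Prop} {t : V ⊗[k] V}
    (ht : t ∈ LinearMap.range (TensorProduct.map p.subtype q.subtype)) (h0 : P 0)
    (hadd : ∀ s t, P s → P t → P (s + t)) (h : ∀ a ∈ p, ∀ b ∈ q, P (a ⊗ₜ[k] b)) : P t := by
  obtain ⟨t, rfl⟩ := ht
  induction t using TensorProduct.induction_on with
  | zero => rw [map_zero]; exact h0
  | add a b ha hb => rw [map_add]; exact hadd _ _ ha hb
  | tmul a b => exact h _ a.2 _ b.2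

variable {p q : Submodule k g} {t : g ⊗[k] g}
  (ht : t ∈ LinearMap.range (TensorProduct.map p.subtype q.subtype))
include ht

lemma actTensor_eq_zero_left {x : V} (hx : ∀ z ∈ p, act z x = 0) (y : V) :
    actTensor act t (x ⊗ₜ[k] y) = 0 :=
  range_map_induction (P := fun t => actTensor act t (x ⊗ₜ[k] y) = 0) ht (by simp [actTensor_zero])
    (fun s t hs ht => by rw [actTensor_add, LinearMap.add_apply, hs, ht, add_zero])
    (fun a ha b _ => by simp [hx a ha])

lemma actTensor_eq_zero_right {y : V} (hy : ∀ z ∈ q, act z y = 0) (x : V) :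
    actTensor act t (x ⊗ₜ[k] y) = 0 :=
  range_map_induction (P := fun t => actTensor act t (x ⊗ₜ[k] y) = 0) ht (by simp [actTensor_zero])
    (fun s t hs ht => by rw [actTensor_add, LinearMap.add_apply, hs, ht, add_zero])
    (fun a _ b hb => by simp [hy b hb])

lemma actRight_eq_zero {x : V} (hx : ∀ z ∈ q, act z x = 0) : actRight act t x = 0 :=
  range_map_induction (P := fun t => actRight act t x = 0) ht (by simp [actRight_zero])
    (fun s t hs ht => by rw [actRight_add, hs, ht, add_zero])
    (fun a _ b hb => by simp [hx b hb])

lemma actLeft_eq_zero {x : V} (hx : ∀ z ∈ p, act z x = 0) : actLeft act t x = 0 :=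
  range_map_induction (P := fun t => actLeft act t x = 0) ht (by simp [actLeft, actRight_zero])
    (fun s t hs ht => by rw [actLeft, map_add, actRight_add, ← actLeft, ← actLeft, hs, ht, add_zero])
    (fun a ha b _ => by simp [actLeft, hx a ha])

end vanish

end LieBi

/-! ### Finiteness of the action of r, and the braided-Lie bialgebras -/

namespace KacMoody

open LieBi

namespace KMData

variable {k I H L : Type*} [Field k] [CharZero k] [Fintype I] [AddCommGroup H] [Module k H]
  [LieRing L] [LieAlgebra k L] {D : KMData k I H L}

section finiteness

variable {ω : (I →₀ ℤ) →+ ℤ} (hω : ∀ γ, 0 ≤ γ → 0 ≤ ω γ)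
include hω

/-- Acting in degree zero keeps the degree of `y` negative, so a nonzero result of weight β + γ must
have β + γ < 0. Only finitely many β lie below -γ. This finiteness underlies the infinite braiding
and the coaction. -/
lemma finite_neg {y : L} (hy : D.proj (negSet ω) y = y) :
    {β | ∃ z, D.proj (zeroSet ω) z = z ∧ z ∈ D.W (toInt β) ∧ ⁅z, y⁆ ≠ 0}.Finite := by
  rw [← hy]
  clear hy
  induction y using D.hom_induction with
  | hadd a b ha hb =>
    refine (ha.union hb).subset ?_
    rintro β ⟨z, h1, h2, h3⟩
    by_contra hc
    refine h3 ?_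
    rw [map_add, lie_add]
    have e1 : ⁅z, D.proj (negSet ω) a⁆ = 0 := by
      by_contra h; exact hc (Or.inl ⟨z, h1, h2, h⟩)
    have e2 : ⁅z, D.proj (negSet ω) b⁆ = 0 := by
      by_contra h; exact hc (Or.inr ⟨z, h1, h2, h⟩)
    rw [e1, e2, add_zero]
  | hW γ y hy =>
    by_cases hγ : ω γ < 0
    swap
    · rw [D.proj_of_notMem hy hγ]; simp
    rw [D.proj_of_mem hy hγ]
    refine (finite_toInt_le (-γ)).subset ?_
    rintro β ⟨z, h1, h2, h3⟩
    have hβ : ω (toInt β) = 0 := by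
      by_contra h
      rw [D.proj_of_notMem h2 h] at h1
      rw [← h1, zero_lie] at h3
      exact h3 rfl
    change toInt β ≤ -γ
    rcases D.W_sign (D.lie_mem_W h2 hy) with h | h | h | h
    · exact absurd h h3
    · have := hω _ h.le
      rw [map_add] at this; omega
    · have := congrArg ω h
      rw [map_add, map_zero] at this; omega
    · rw [le_neg_iff_add_nonpos_right]; exact h.le

lemma finite_pos {y : L} (hy : D.proj (posSet ω) y = y) :
    {β | ∃ z, D.proj (zeroSet ω) z = z ∧ z ∈ D.W (-toInt β) ∧ ⁅z, y⁆ ≠ 0}.Finite := by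
  have := D.mirror.finite_neg hω (y := y) (by rw [mirror_proj, neg_negSet, hy])
  simpa only [mirror_proj, neg_zeroSet, mirror_W] using this

end finiteness

variable {d : I → k} {B : L →ₗ[k] L →ₗ[k] k}

namespace IsForm

variable (hF : D.IsForm d B)
include hF

variable {g : Type*} [LieRing g] [LieAlgebra k g] {i₀ : g →ₗ[k] L}
variable {V : Type*} [AddCommGroup V] [Module k V] {i : V →ₗ[k] L}

section act

variable {act : g →ₗ[k] Module.End k V} (hact : ∀ ξ x, i (act ξ x) = ⁅i₀ ξ, i x⁆)
include hact

lemma pull_act (u : L) (ξ : g) (x : V) : pull B i u (act ξ x) = pull B i₀ ⁅i x, u⁆ ξ := by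
  rw [pull_apply, pull_apply, hact, hF.symm, hF.inv, hF.symm]

lemma actRight_pairing (φ : Module.Dual k g) (u : L) (t : g ⊗[k] g) (x : V) :
    tensorDual φ (pull B i u) (actRight act t x) = tensorDual φ (pull B i₀ ⁅i x, u⁆) t := by
  induction t using TensorProduct.induction_on with
  | zero => simp [actRight_zero]
  | add a b ha hb => simp only [map_add, actRight_add, ha, hb]
  | tmul a b => rw [actRight_tmul, tensorDual_tmul, tensorDual_tmul, hF.pull_act hact]

lemma actLeft_pairing (φ : Module.Dual k g) (u : L) (t : g ⊗[k] g) (x : V) :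
    tensorDual φ (pull B i u) (actLeft act t x) = tensorDual (pull B i₀ ⁅i x, u⁆) φ t := by
  rw [actLeft, hF.actRight_pairing hact, tensorDual_comm]

lemma actTensor_pairing (u v : L) (t : g ⊗[k] g) (x y : V) :
    tensorDual (pull B i u) (pull B i v) (actTensor act t (x ⊗ₜ[k] y))
      = tensorDual (pull B i₀ ⁅i x, u⁆) (pull B i₀ ⁅i y, v⁆) t := by
  induction t using TensorProduct.induction_on with
  | zero => simp [actTensor_zero]
  | add a b ha hb => simp only [map_add, actTensor_add, LinearMap.add_apply, ha, hb]
  | tmul a b =>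
    rw [actTensor_tmul, tensorDual_tmul, tensorDual_tmul, hF.pull_act hact, hF.pull_act hact]

end act

omit hF in
lemma tensorDer_pairing {T : Module.End k V} {S : L → L}
    (h : ∀ u x, pull B i u (T x) = pull B i (S u) x) (u v : L) (t : V ⊗[k] V) :
    tensorDual (pull B i u) (pull B i v) (tensorDer T t)
      = tensorDual (pull B i (S u)) (pull B i v) t + tensorDual (pull B i u) (pull B i (S v)) t := by
  have h' : ∀ u, pull B i u ∘ₗ T = pull B i (S u) := fun u => LinearMap.ext (h u)
  rw [tensorDer, LinearMap.add_apply, map_add, tensorDual_map, tensorDual_map, h', h',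
    LinearMap.comp_id, LinearMap.comp_id]

variable {ω : (I →₀ ℤ) →+ ℤ} (hω : ∀ γ, 0 ≤ γ → 0 ≤ ω γ)
variable {r : (I →₀ ℕ) → g ⊗[k] g} (hr : IsRFamily D ω B i₀ r)
  {j₀ : L →ₗ[k] g} (S₀ : D.Slice (zeroSet ω) i₀ j₀)
  (hom : ∀ β, r β ∈ LinearMap.range (TensorProduct.map ((D.W (toInt β)).comap i₀).subtype
        ((D.W (-toInt β)).comap i₀).subtype))
  (hi₀ : ∀ x y, i₀ ⁅x, y⁆ = ⁅i₀ x, i₀ y⁆)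
  {A : Set (I →₀ ℤ)} {j : L →ₗ[k] V} (S : D.Slice A i j)

omit hF in
/-- The half spaces cut out by `ω`, with a sign. -/
def _root_.KacMoody.IsHalf (ω : (I →₀ ℤ) →+ ℤ) (A : Set (I →₀ ℤ)) (ε : k) : Prop :=
  (A = negSet ω ∧ ε = 1) ∨ (A = posSet ω ∧ ε = -1)

omit hF in
lemma _root_.KacMoody.IsHalf.neg {ε : k} (hA : IsHalf ω A ε) : IsHalf ω (-A) (-ε) := by
  rcases hA with ⟨rfl, rfl⟩ | ⟨rfl, rfl⟩
  · exact Or.inr ⟨neg_negSet, rfl⟩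
  · exact Or.inl ⟨neg_posSet, neg_neg 1⟩

omit hF in
lemma _root_.KacMoody.IsHalf.sq {ε : k} (hA : IsHalf ω A ε) : ε * ε = 1 := by
  rcases hA with ⟨rfl, rfl⟩ | ⟨rfl, rfl⟩ <;> ring

omit hF in
lemma _root_.KacMoody.IsHalf.add_mem {ε : k} (hA : IsHalf ω A ε) : ∀ a ∈ A, ∀ b ∈ A, a + b ∈ A := by
  rcases hA with ⟨rfl, rfl⟩ | ⟨rfl, rfl⟩ <;> intro a ha b hb
  · rw [mem_negSet] at *; rw [map_add]; omega
  · rw [mem_posSet] at *; rw [map_add]; omega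

omit hF in
lemma _root_.KacMoody.IsHalf.zero_add_mem_iff {ε : k} (hA : IsHalf ω A ε) :
    ∀ a ∈ zeroSet ω, ∀ b, a + b ∈ A ↔ b ∈ A := by
  rcases hA with ⟨rfl, rfl⟩ | ⟨rfl, rfl⟩ <;> intro a ha b
  · rw [mem_zeroSet] at ha; rw [mem_negSet, mem_negSet, map_add, ha, zero_add]
  · rw [mem_zeroSet] at ha; rw [mem_posSet, mem_posSet, map_add, ha, zero_add]

omit hF in
lemma _root_.KacMoody.IsHalf.parts {ε : k} (hA : IsHalf ω A ε) (x : L) :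
    D.proj A x + D.proj (zeroSet ω) x + D.proj (-A) x = x := by
  rcases hA with ⟨rfl, rfl⟩ | ⟨rfl, rfl⟩
  · rw [neg_negSet, proj_parts]
  · rw [neg_posSet]; conv_rhs => rw [← D.proj_parts (ω := ω) x]
    abel

omit hF in
lemma _root_.KacMoody.IsHalf.star {ε : k} (hA : IsHalf ω A ε) (hω : ∀ γ, 0 ≤ γ → 0 ≤ ω γ) (u v : L) :
    D.star (D.proj A u) (D.proj A v) = ε • ⁅D.proj A u, D.proj A v⁆ := by
  rcases hA with ⟨rfl, rfl⟩ | ⟨rfl, rfl⟩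
  · rw [star_of_neg hω (D.proj_idem _ _) (D.proj_idem _ _), one_smul]
  · rw [star_of_pos hω (D.proj_idem _ _) (D.proj_idem _ _), neg_one_smul]

include S in
-- The functionals see only the `-A` parts of `u` and `v`, and on a half space `star` is plus or
-- minus the bracket. The opposite half carries the opposite sign.
lemma cobracket_pairing {ε : k} (hA : IsHalf ω A ε) (hω : ∀ γ, 0 ≤ γ → 0 ≤ ω γ)
    {δ : L →ₗ[k] L ⊗[k] L}
    (hδ : ∀ u v x, tensorDual (B u) (B v) (δ x) = B (D.star u v) x) (u v x : L) :
    tensorDual (pull B i u) (pull B i v) (TensorProduct.map j j (δ x))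
      = -ε * B ⁅D.proj (-A) u, D.proj (-A) v⁆ x := by
  have h1 : ∀ u, pull B i u ∘ₗ j = B (D.proj (-A) u) := by
    intro u
    ext x
    rw [LinearMap.comp_apply, pull_apply, S.i_j, hF.proj_adjoint, neg_neg]
  rw [tensorDual_map, h1, h1, hδ, hA.neg.star hω, map_smul, LinearMap.smul_apply, smul_eq_mul]

include hω hr S₀ hom hi₀ S in
-- One argument serves b with `ε = 1` and its dual with `ε = -1`, where the bracket is the opposite
-- one. The braided cocycle law measures the failure of the projection to `A` to commute with
-- brackets, and that failure is carried by degree zero, that is, by 2 r₊.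
lemma exists_braided {ε : k} (hA : IsHalf ω A ε) {δ : L →ₗ[k] L ⊗[k] L}
    (hδ : ∀ u v x, tensorDual (B u) (B v) (δ x) = B (D.star u v) x) :
    ∃ b : BraidedLieBialgebra r V, (∀ ξ x, i (b.act ξ x) = ⁅i₀ ξ, i x⁆) ∧
      (∀ x y, i (b.br x y) = ε • ⁅i x, i y⁆) ∧
      ∀ x, b.cobr x = TensorProduct.map j j (δ (i x)) := by
  have hi1 : ∀ ξ x, D.proj A ⁅i₀ ξ, i x⁆ = ⁅i₀ ξ, i x⁆ := fun ξ x =>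
    D.proj_lie (fun a ha b hb => (hA.zero_add_mem_iff a ha b).2 hb) (S₀.proj_i ξ) (S.proj_i x)
  have hi2 : ∀ x y, D.proj A ⁅i x, i y⁆ = ⁅i x, i y⁆ := fun x y =>
    D.proj_lie hA.add_mem (S.proj_i x) (S.proj_i y)
  let act : g →ₗ[k] Module.End k V := LinearMap.mk₂ k (fun ξ x => j ⁅i₀ ξ, i x⁆)
    (by intros; simp) (by intros; simp) (by intros; simp) (by intros; simp)
  have hact : ∀ ξ x, i (act ξ x) = ⁅i₀ ξ, i x⁆ := fun ξ x => by
    change i (j _) = _; rw [S.i_j, hi1]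
  let br : V →ₗ[k] V →ₗ[k] V := LinearMap.mk₂ k (fun x y => ε • j ⁅i x, i y⁆)
    (by intros; simp)
    (fun c x y => by rw [map_smul, smul_lie, map_smul, smul_comm]) (by intros; simp)
    (fun c x y => by rw [map_smul, lie_smul, map_smul, smul_comm])
  have hbr : ∀ x y, i (br x y) = ε • ⁅i x, i y⁆ := fun x y => by
    change i (ε • j _) = _; rw [map_smul, S.i_j, hi2]
  have hcob : ∀ u v x, tensorDual (pull B i u) (pull B i v) ((TensorProduct.map j j ∘ₗ δ ∘ₗ i) x)
      = -ε * B ⁅D.proj (-A) u, D.proj (-A) v⁆ (i x) :=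
    fun u v x => hF.cobracket_pairing S hA hω hδ u v (i x)
  have sep := S.pull_sep hF
  have sep' : ∀ x, (∀ u, pull B i (D.proj (-A) u) x = 0) → x = 0 := fun x h =>
    sep x fun u => by rw [← S.pull_proj hF, h]
  have hpact : ∀ ξ u x, pull B i u (act ξ x) = pull B i (-⁅i₀ ξ, u⁆) x := fun ξ u x => by
    rw [pull_apply, pull_apply, hact, map_neg, LinearMap.neg_apply, hF.inv_left, neg_neg]
  have hpbr : ∀ y u x, pull B i u (br y x) = pull B i (-ε • ⁅i y, u⁆) x := fun y u x => by
    rw [pull_apply, pull_apply, hbr, map_smul, map_smul, LinearMap.smul_apply, hF.inv_left,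
      smul_eq_mul, smul_eq_mul]
    ring
  -- For the negative half the first leg of `r β`, of weight β, eventually kills `x`; for the
  -- positive half the second leg, of weight -β, eventually kills `y`.
  have fin : ∀ x y, {β | actTensor act (r β) (x ⊗ₜ[k] y) ≠ 0}.Finite := by
    intro x y
    have hz : ∀ {ξ x}, ⁅i₀ ξ, i x⁆ = 0 → act ξ x = 0 := fun {ξ x} h =>
      S.injective (by rw [hact, h, map_zero])
    rcases hA with ⟨rfl, -⟩ | ⟨rfl, -⟩
    · refine (finite_neg hω (S.proj_i x)).subset fun β hβ => ?_
      by_contra hc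
      refine hβ (actTensor_eq_zero_left act (hom β) (fun z hz' => hz ?_) y)
      by_contra h
      exact hc ⟨i₀ z, S₀.proj_i z, hz', h⟩
    · refine (finite_pos hω (S.proj_i y)).subset fun β hβ => ?_
      by_contra hc
      refine hβ (actTensor_eq_zero_right act (hom β) (fun z hz' => hz ?_) x)
      by_contra h
      exact hc ⟨i₀ z, S₀.proj_i z, hz', h⟩
  refine ⟨{ act := act, br := br, cobr := TensorProduct.map j j ∘ₗ δ ∘ₗ i,
            act_lie := ?_, br_self := ?_, jacobi := ?_, isLieCoalgebra := ?_, act_br := ?_,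
            cobr_act := ?_, finite_braiding := fin, cocycle := ?_ }, hact, hbr, fun x => rfl⟩
  · intro ξ η x
    apply S.injective
    rw [map_sub, hact, hact, hact, hact, hact, hi₀, lie_lie]
  · intro x
    apply S.injective
    rw [hbr]; simp
  · intro x y z
    apply S.injective
    rw [map_add, hbr, hbr, hbr, hbr, hbr, hbr, smul_lie, lie_smul, lie_smul, leibniz_lie]
    module
  · refine isLieCoalgebra_of_pairing (F := pull B i) sep
      (fun u v => -ε • ⁅D.proj (-A) u, D.proj (-A) v⁆) ?_ ?_ ?_
    · intro u v x
      rw [hcob, pull_apply, map_smul, LinearMap.smul_apply, smul_eq_mul]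
    · intro u v x
      rw [← lie_skew (D.proj (-A) v), smul_neg, map_neg, LinearMap.neg_apply, add_neg_cancel]
    · intro u v w x
      have h1 : ∀ u v, D.proj (-A) ⁅D.proj (-A) u, D.proj (-A) v⁆
          = ⁅D.proj (-A) u, D.proj (-A) v⁆ := fun u v =>
        D.proj_lie hA.neg.add_mem (D.proj_idem _ _) (D.proj_idem _ _)
      simp only [map_smul (D.proj (-A)), h1, smul_lie, smul_smul, neg_mul_neg, hA.sq, one_smul]
      rw [← LinearMap.add_apply, ← LinearMap.add_apply, ← map_add, ← map_add]
      have := lie_jacobi (D.proj (-A) u) (D.proj (-A) v) (D.proj (-A) w)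
      rw [← lie_skew _ ⁅D.proj (-A) v, _⁆, ← lie_skew _ ⁅D.proj (-A) w, _⁆,
        ← lie_skew _ ⁅D.proj (-A) u, _⁆] at this
      rw [show ∀ a b c : L, a + b + c = -(-c + -b + -a) by intros; abel, this]
      simp
  · intro ξ x y
    apply S.injective
    rw [map_add, hact, hbr, hbr, hbr, hact, hact, lie_smul, leibniz_lie, smul_add]
  · intro ξ x
    refine tensor_ext sep sep fun u v => ?_
    have h1 : ∀ u, D.proj (-A) ⁅i₀ ξ, u⁆ = ⁅i₀ ξ, D.proj (-A) u⁆ := fun u =>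
      D.proj_lie_comm hA.neg.zero_add_mem_iff (S₀.proj_i ξ) u
    rw [tensorDer_pairing (hpact ξ), hcob, hcob, hcob, hact, map_neg, map_neg, h1, h1,
      neg_lie, lie_neg, map_neg, map_neg, LinearMap.neg_apply, LinearMap.neg_apply]
    have h2 := hF.inv_left (i₀ ξ) ⁅D.proj (-A) u, D.proj (-A) v⁆ (i x)
    rw [leibniz_lie, map_add, LinearMap.add_apply] at h2
    linear_combination -ε * h2
  · intro x y
    refine tensor_ext sep' sep' fun u v => ?_
    have hu := D.proj_idem (-A) u
    have hv := D.proj_idem (-A) v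
    generalize D.proj (-A) u = u at hu ⊢
    generalize D.proj (-A) v = v at hv ⊢
    -- As 2 r₊ represents `B` in degree zero, the braiding pairs through the degree-zero parts of
    -- the brackets of `x`, `y` with the test vectors.
    have hinf : tensorDual (pull B i u) (pull B i v) (infBraiding r act x y)
        = B ⁅i x, u⁆ (D.proj (zeroSet ω) ⁅i y, v⁆)
          - B ⁅i y, u⁆ (D.proj (zeroSet ω) ⁅i x, v⁆) := by
      have hsupp : {β | actTensor act (twiceSym (r β)) (wedge x y) ≠ 0}.Finite := by
        refine ((fin x y).union (fin y x)).subset fun β hβ => ?_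
        by_contra hc
        simp only [Set.mem_union, Set.mem_ofPred_eq, not_or, not_not] at hc
        refine hβ ?_
        rw [wedge, twiceSym, actTensor_add, LinearMap.add_apply, map_sub, map_sub, actTensor_comm,
          actTensor_comm, hc.1, hc.2]
        simp
      have e : ∀ β, tensorDual (pull B i u) (pull B i v)
            (actTensor act (twiceSym (r β)) (wedge x y))
          = tensorDual (pull B i₀ ⁅i x, u⁆) (pull B i₀ ⁅i y, v⁆) (twiceSym (r β))
            - tensorDual (pull B i₀ ⁅i y, u⁆) (pull B i₀ ⁅i x, v⁆) (twiceSym (r β)) := by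
        intro β
        rw [wedge, map_sub, map_sub, hF.actTensor_pairing hact, hF.actTensor_pairing hact]
      rw [infBraiding, map_finsum _ hsupp]
      simp only [e]
      rw [finsum_sub_distrib (hF.finite_twiceSym hr _ _) (hF.finite_twiceSym hr _ _),
        hF.finsum_twiceSym hr, hF.finsum_twiceSym hr]
    rw [map_sub, map_sub, tensorDer_pairing (hpbr x), tensorDer_pairing (hpbr y), hcob, hcob, hcob,
      hcob, hcob, hinf, hu, hv, hbr]
    simp only [map_smul, smul_lie, lie_smul, LinearMap.smul_apply, smul_eq_mul]
    have f1 : ∀ a b c : L, B ⁅D.proj (-A) a, b⁆ c = -B a (D.proj A ⁅c, b⁆) := by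
      intro a b c
      rw [hF.inv, hF.proj_adjoint, neg_neg, ← lie_skew, map_neg, map_neg]
    have f2 : ∀ a b c : L, B ⁅b, D.proj (-A) a⁆ c = B ⁅c, b⁆ (D.proj (-A) a) := by
      intro a b c
      rw [hF.inv_left b, hF.symm, ← lie_skew, map_neg, LinearMap.neg_apply, neg_neg]
    -- Invariance and Jacobi. After splitting each term on the right by degree with `f4`, the parts
    -- in `A` and `-A` are the derivation terms and the part in degree zero is the braiding; ε² = 1
    -- reconciles the signs.
    have f3 : B ⁅u, v⁆ ⁅i x, i y⁆ = B ⁅i x, u⁆ ⁅i y, v⁆ - B ⁅i y, u⁆ ⁅i x, v⁆ := by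
      rw [hF.inv_left (i x), hF.inv_left (i y), hF.inv, ← lie_skew, lie_lie, map_neg, map_sub]
      ring
    have f4 : ∀ a b : L, B a b = B a (D.proj A b) + B a (D.proj (zeroSet ω) b)
        + B a (D.proj (-A) b) := by
      intro a b
      rw [← map_add, ← map_add, hA.parts]
    rw [f1, f1, f2, f2]
    have e1 := f4 ⁅i x, u⁆ ⁅i y, v⁆
    have e2 := f4 ⁅i y, u⁆ ⁅i x, v⁆
    rw [e1, e2] at f3
    rw [f3]
    have hsq := hA.sq
    generalize B ⁅i x, u⁆ (D.proj A ⁅i y, v⁆) = a1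
    generalize B ⁅i x, u⁆ (D.proj (-A) ⁅i y, v⁆) = a2
    generalize B ⁅i x, u⁆ (D.proj (zeroSet ω) ⁅i y, v⁆) = a3
    generalize B ⁅i y, u⁆ (D.proj A ⁅i x, v⁆) = b1
    generalize B ⁅i y, u⁆ (D.proj (-A) ⁅i x, v⁆) = b2
    generalize B ⁅i y, u⁆ (D.proj (zeroSet ω) ⁅i x, v⁆) = b3
    linear_combination (b3 - a3) * hsq

end IsForm

end KMData

/-! ### Duality of the two halves and the double-bosonisation -/

namespace KMData

variable {k I H L : Type*} [Field k] [CharZero k] [Fintype I] [AddCommGroup H] [Module k H]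
  [LieRing L] [LieAlgebra k L] {D : KMData k I H L}

variable (D) in
lemma finite_proj (y : L) : {β : I →₀ ℕ | D.proj {toInt β} y ≠ 0}.Finite := by
  induction y using D.hom_induction with
  | hadd a b ha hb =>
    refine (ha.union hb).subset fun β hβ => ?_
    by_contra hc
    simp only [Set.mem_union, Set.mem_ofPred_eq, not_or, not_not] at hc
    exact hβ (by rw [map_add, hc.1, hc.2, add_zero])
  | hW γ y hy =>
    refine Set.Subsingleton.finite (s := _) (fun β hβ β' hβ' => toInt_injective ?_)
    have key : ∀ β : I →₀ ℕ, D.proj {toInt β} y ≠ 0 → γ = toInt β := by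
      intro β hβ
      by_contra hne
      exact hβ (D.proj_of_notMem hy hne)
    rw [← key β hβ, ← key β' hβ']

variable {d : I → k} {B : L →ₗ[k] L →ₗ[k] k}

namespace IsForm

variable (hF : D.IsForm d B) (ω : (I →₀ ℤ) →+ ℤ)
variable {g : Type*} [LieRing g] [LieAlgebra k g] {i₀ : g →ₗ[k] L} {j₀ : L →ₗ[k] g}
variable {V : Type*} [AddCommGroup V] [Module k V] {i : V →ₗ[k] L} {j : L →ₗ[k] V}
variable {W : Type*} [AddCommGroup W] [Module k W] {i' : W →ₗ[k] L} {j' : L →ₗ[k] W}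
variable {r : (I →₀ ℕ) → g ⊗[k] g} {b : BraidedLieBialgebra r V} {c : BraidedLieBialgebra r W}
  {p : W →ₗ[k] V →ₗ[k] k} {δ : L →ₗ[k] L ⊗[k] L}

/-- `V` with the braided-Lie bialgebra structure induced from `L`, up to the sign `ε`. -/
structure _root_.KacMoody.IsInduced (ε : k) (δ : L →ₗ[k] L ⊗[k] L) (i₀ : g →ₗ[k] L) (i : V →ₗ[k] L) (j : L →ₗ[k] V)
    (b : BraidedLieBialgebra r V) : Prop where
  act : ∀ ξ x, i (b.act ξ x) = ⁅i₀ ξ, i x⁆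
  br : ∀ x y, i (b.br x y) = ε • ⁅i x, i y⁆
  cobr : ∀ x, b.cobr x = TensorProduct.map j j (δ (i x))

variable {ω} (hω : ∀ γ, 0 ≤ γ → 0 ≤ ω γ)
  (hr : IsRFamily D ω B i₀ r) (S₀ : D.Slice (zeroSet ω) i₀ j₀)
  (hom : ∀ β, r β ∈ LinearMap.range (TensorProduct.map ((D.W (toInt β)).comap i₀).subtype
        ((D.W (-toInt β)).comap i₀).subtype))
  (S : D.Slice (negSet ω) i j) (S' : D.Slice (posSet ω) i' j')
  (hb : IsInduced 1 δ i₀ i j b) (hc : IsInduced (-1) δ i₀ i' j' c)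
  (hp : ∀ φ x, p φ x = B (i' φ) (i x))
  (hδ : ∀ u v x, tensorDual (B u) (B v) (δ x) = B (D.star u v) x)

include hF hω S hb hδ in
lemma neg_cobr_pairing (u v : L) (x : V) : tensorDual (pull B i u) (pull B i v) (b.cobr x)
    = -B ⁅D.proj (posSet ω) u, D.proj (posSet ω) v⁆ (i x) := by
  rw [hb.cobr, hF.cobracket_pairing S (ε := 1) (Or.inl ⟨rfl, rfl⟩) hω hδ, neg_negSet, neg_one_mul]

include hF hω S' hc hδ in
lemma pos_cobr_pairing (u v : L) (x : W) : tensorDual (pull B i' u) (pull B i' v) (c.cobr x)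
    = B ⁅D.proj (negSet ω) u, D.proj (negSet ω) v⁆ (i' x) := by
  rw [hc.cobr, hF.cobracket_pairing S' (ε := -1) (Or.inr ⟨rfl, rfl⟩) hω hδ, neg_posSet, neg_neg,
    one_mul]

include hp in
lemma pull_pairing (φ : W) : p φ = pull B i (i' φ) := LinearMap.ext fun x => hp φ x

include hF hp in
lemma pull_pairing_flip (x : V) : p.flip x = pull B i' (i x) := LinearMap.ext fun φ => by
  rw [LinearMap.flip_apply, hp, pull_apply, hF.symm]

include hF hω S S' hb hc hp hδ in
lemma isDuallyPaired : IsDuallyPaired b c p where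
  invariant ξ φ x := by
    rw [hp, hp, hb.act, hc.act, hF.inv_left, neg_add_cancel]
  br_cobr φ ψ x := by
    rw [pull_pairing hp φ, pull_pairing hp ψ, hF.neg_cobr_pairing hω S hb hδ, S'.proj_i, S'.proj_i,
      hp, hc.br, neg_one_smul, map_neg, LinearMap.neg_apply]
  cobr_br φ x y := by
    rw [hF.pull_pairing_flip hp, hF.pull_pairing_flip hp, hF.pos_cobr_pairing hω S' hc hδ, S.proj_i,
      S.proj_i, hp, hb.br, one_smul, hF.symm]

include hF hω S hb hδ in
-- With `idTensor_pos_cobr` and `mixed_eq` this identifies the three terms of [x, φ] in the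
-- double-bosonisation with the components of negative, positive and zero degree of the bracket in
-- `L`.
lemma idTensor_neg_cobr (u : L) (hu : D.proj (posSet ω) u = u) (x : V) :
    i (idTensor (pull B i u) (b.cobr x)) = D.proj (negSet ω) ⁅i x, u⁆ := by
  rw [← sub_eq_zero]
  refine hF.nondeg' _ fun w => ?_
  rw [map_sub, sub_eq_zero, ← pull_apply, apply_idTensor, hF.neg_cobr_pairing hω S hb hδ, hu, hF.inv,
    ← lie_skew, map_neg, neg_neg, hF.proj_adjoint, neg_posSet]

include hF hω S' hc hδ in
lemma idTensor_pos_cobr (u : L) (hu : D.proj (negSet ω) u = u) (φ : W) :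
    i' (idTensor (pull B i' u) (c.cobr φ)) = D.proj (posSet ω) ⁅u, i' φ⁆ := by
  rw [← sub_eq_zero]
  refine hF.nondeg' _ fun w => ?_
  rw [map_sub, sub_eq_zero, ← pull_apply, apply_idTensor, hF.pos_cobr_pairing hω S' hc hδ, hu, hF.inv,
    hF.proj_adjoint, neg_negSet]

include hF hb in
lemma idTensor_actRight (u : L) (t : g ⊗[k] g) (x : V) :
    idTensor (pull B i u) (actRight b.act t x) = idTensor (pull B i₀ ⁅i x, u⁆) t := by
  induction t using TensorProduct.induction_on with
  | zero => simp [actRight_zero]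
  | add a b ha hb => simp only [map_add, actRight_add, ha, hb]
  | tmul a c =>
    rw [actRight_tmul]
    simp only [idTensor, LinearMap.comp_apply, TensorProduct.map_tmul, hF.pull_act hb.act]

include hF hr S₀ in
lemma finite_idTensor (v : L) : {β | idTensor (pull B i₀ v) (twiceSym (r β)) ≠ 0}.Finite := by
  refine ((D.finite_proj (D.proj (zeroSet ω) (D.T v))).union
    (D.mirror.finite_proj (D.proj (zeroSet ω) v))).subset fun β hβ => ?_
  by_contra hc
  simp only [Set.mem_union, Set.mem_ofPred_eq, not_or, not_not] at hc
  refine hβ (S₀.injective ?_)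
  have h1 : i₀ (idTensor (pull B i₀ v) (TensorProduct.comm k g g (r β)))
      = wT k (toInt β) • D.proj {-toInt β} (D.proj (zeroSet ω) v) := by
    rw [← sub_eq_zero]
    refine hF.nondeg' _ fun u => ?_
    rw [map_sub, sub_eq_zero, ← pull_apply, apply_idTensor, tensorDual_comm, hr, hF.symm,
      hF.proj_adjoint, hF.proj_adjoint, neg_zeroSet, Set.neg_singleton, map_smul, smul_eq_mul,
      proj_proj, proj_proj, Set.inter_comm]
  have h2 := hc.2
  rw [mirror_proj, Set.neg_singleton] at h2
  rw [twiceSym, map_add, map_add, hF.idTensor_r hr, hc.1, h1, h2]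
  simp

include hF hr S₀ hb hp in
-- The action on `x` paired with `φ` equals `B` against the bracket of `x` and `φ`. Contracting 2
-- r₊, which represents `B` on degree zero, with this functional returns the degree-zero part of the
-- bracket.
lemma mixed_eq (x : V) (φ : W) : i₀ (mixed b p x φ) = D.proj (zeroSet ω) ⁅i x, i' φ⁆ := by
  rw [← sub_eq_zero]
  refine hF.nondeg' _ fun u => ?_
  rw [map_sub, sub_eq_zero, ← pull_apply, mixed, pull_pairing hp]
  simp only [hF.idTensor_actRight hb]
  rw [map_finsum _ (hF.finite_idTensor hr S₀ _)]
  simp only [apply_idTensor]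
  exact hF.finsum_twiceSym hr _ _

include hω S₀ hom S hb in
lemma finite_actLeft (x : V) : {β | actLeft b.act (r β) x ≠ 0}.Finite := by
  refine (finite_neg hω (S.proj_i x)).subset fun β hβ => ?_
  by_contra hc
  refine hβ (actLeft_eq_zero b.act (hom β) (fun z hz' => S.injective ?_))
  rw [hb.act, map_zero]
  by_contra h
  exact hc ⟨i₀ z, S₀.proj_i z, hz', h⟩

include hω S₀ hom S' hc in
lemma finite_actRight (φ : W) : {β | actRight c.act (r β) φ ≠ 0}.Finite := by
  refine (finite_pos hω (S'.proj_i φ)).subset fun β hβ => ?_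
  by_contra hc'
  refine hβ (actRight_eq_zero c.act (hom β) (fun z hz' => S'.injective ?_))
  rw [hc.act, map_zero]
  by_contra h
  exact hc' ⟨i₀ z, S₀.proj_i z, hz', h⟩

include hF hω hr S₀ hom S hb in
lemma finsum_actLeft (u v : L) (x : V) :
    tensorDual (pull B i₀ u) (pull B i v) (∑ᶠ β, actLeft b.act (r β) x)
      = B ⁅i x, v⁆ (D.T (D.proj (zeroSet ω) u)) := by
  rw [map_finsum _ (finite_actLeft hω S₀ hom S hb x)]
  simp only [hF.actLeft_pairing hb.act]
  exact finsum_r hr _ _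

include hF hω hr S₀ hom S' hc in
lemma finsum_actRight (u v : L) (φ : W) :
    tensorDual (pull B i₀ u) (pull B i' v) (∑ᶠ β, actRight c.act (r β) φ)
      = B u (D.T (D.proj (zeroSet ω) ⁅i' φ, v⁆)) := by
  rw [map_finsum _ (finite_actRight hω S₀ hom S' hc φ)]
  simp only [hF.actRight_pairing hc.act]
  exact finsum_r hr _ _

lemma _root_.KacMoody.KMData.Slice.comp_eq_zero {A A' : Set (I →₀ ℤ)} (h : Disjoint A A')
    (S : D.Slice A i j) (S' : D.Slice A' i' j') (x : V) : j' (i x) = 0 := by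
  apply S'.injective
  rw [S'.i_j, D.proj_disjoint h (S.proj_i x), map_zero]

include S₀ S S' in
lemma exists_doubleEquiv : ∃ Φ : (V × g × W) ≃ₗ[k] L,
    ∀ u, Φ u = i u.1 + i₀ u.2.1 + i' u.2.2 := by
  have d1 : Disjoint (negSet ω) (zeroSet ω) :=
    Set.disjoint_left.2 fun a h h' => (mem_negSet.1 h).ne h'
  have d2 : Disjoint (negSet ω) (posSet ω) :=
    Set.disjoint_left.2 fun a h h' => (mem_negSet.1 h).not_gt h'
  have d3 : Disjoint (zeroSet ω) (posSet ω) :=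
    Set.disjoint_left.2 fun a h h' => (mem_posSet.1 h').ne' h
  let f : (V × g × W) →ₗ[k] L := i.coprod (i₀.coprod i')
  refine ⟨LinearEquiv.ofLinearMap f (j.prod (j₀.prod j')) ?_ ?_, fun u => ?_⟩
  · refine LinearMap.ext fun y => ?_
    change i (j y) + (i₀ (j₀ y) + i' (j' y)) = y
    rw [S.i_j, S₀.i_j, S'.i_j, ← add_assoc, proj_parts]
  · refine LinearMap.ext fun u => ?_
    simp [f, S.j_i, S₀.j_i, S'.j_i, S.comp_eq_zero d1 S₀, S.comp_eq_zero d2 S',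
      S₀.comp_eq_zero d1.symm S, S₀.comp_eq_zero d3 S', S'.comp_eq_zero d2.symm S,
      S'.comp_eq_zero d3.symm S₀]
  · simp [f, add_assoc]

include hF hω hr S₀ hom S S' hb hc hp hδ in
-- For brackets, the only mixed case is [x, φ], which is the sum of its three degree components. For
-- cobrackets, pairing with `u` and `v` gives `star_apply_neg`, `star_apply_pos` and the restricted
-- cobracket.
lemma isDoubleBosonisationIso (hi₀ : ∀ x y, i₀ ⁅x, y⁆ = ⁅i₀ x, i₀ y⁆) {Φ : (V × g × W) ≃ₗ[k] L}
    (hΦ : ∀ u, Φ u = i u.1 + i₀ u.2.1 + i' u.2.2) :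
    IsDoubleBosonisationIso (TensorProduct.map j₀ j₀ ∘ₗ δ ∘ₗ i₀) b c p δ Φ where
  finite_left := finite_actLeft hω S₀ hom S hb
  finite_right := finite_actRight hω S₀ hom S' hc
  finite_mixed x φ := by
    rw [pull_pairing hp]
    simp only [hF.idTensor_actRight hb]
    exact hF.finite_idTensor hr S₀ _
  map_bracket := by
    rintro ⟨x, ξ, φ⟩ ⟨y, η, χ⟩
    have h1 : ∀ x φ, i (idTensor (p φ) (b.cobr x)) = D.proj (negSet ω) ⁅i x, i' φ⁆ := fun x φ => by
      rw [pull_pairing hp, hF.idTensor_neg_cobr hω S hb hδ _ (S'.proj_i φ)]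
    have h2 : ∀ x φ, i' (idTensor (p.flip x) (c.cobr φ)) = D.proj (posSet ω) ⁅i x, i' φ⁆ :=
      fun x φ => by
        rw [hF.pull_pairing_flip hp, hF.idTensor_pos_cobr hω S' hc hδ _ (S.proj_i x)]
    rw [hΦ, hΦ, hΦ]
    simp only [dbBracket, map_add, map_sub, map_neg, h1, h2, hb.act, hb.br, hc.act, hc.br,
      hF.mixed_eq hr S₀ hb hp, hi₀, add_lie, lie_add]
    have e1 := D.proj_parts (ω := ω) ⁅i x, i' χ⁆
    have e2 := D.proj_parts (ω := ω) ⁅i y, i' φ⁆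
    rw [← lie_skew (i' φ) (i y), ← lie_skew (i₀ ξ) (i y), ← lie_skew (i x) (i₀ η),
      ← lie_skew (i' φ) (i₀ η)]
    conv_rhs => rw [← e1, ← e2]
    rw [one_smul, neg_one_smul]
    abel
  map_cobracket := by
    rintro ⟨x, ξ, φ⟩
    refine hF.pair_ext fun u v => ?_
    have c1 : Φ.toLinearMap ∘ₗ LinearMap.inl k V (g × W) = i := by ext; simp [hΦ]
    have c2 : Φ.toLinearMap ∘ₗ LinearMap.inr k V (g × W) ∘ₗ LinearMap.inl k g W = i₀ := by
      ext; simp [hΦ]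
    have c3 : Φ.toLinearMap ∘ₗ LinearMap.inr k V (g × W) ∘ₗ LinearMap.inr k g W = i' := by
      ext; simp [hΦ]
    have hA : ∀ x, D.proj (zeroSet ω) x = x → ∀ u v,
        B (D.star (D.proj (-zeroSet ω) u) (D.proj (-zeroSet ω) v)) x = B (D.star u v) x := by
      intro x hx u v
      rw [neg_zeroSet, hF.star_proj_zeroSet hω hx]
    rw [tensorDual_map]
    simp only [dbCobracket, map_add, map_sub, tensorDual_map, LinearMap.comp_assoc, c1, c2, c3]
    simp only [← LinearMap.comp_assoc]
    change tensorDual (pull B i u) (pull B i v) _ + tensorDual (pull B i₀ u) (pull B i v) _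
      - tensorDual (pull B i u) (pull B i₀ v) _ + tensorDual (pull B i₀ u) (pull B i₀ v) _
      + tensorDual (pull B i' u) (pull B i' v) _ + tensorDual (pull B i' u) (pull B i₀ v) _
      - tensorDual (pull B i₀ u) (pull B i' v) _ = _
    simp only [tensorDual_comm]
    rw [hF.neg_cobr_pairing hω S hb hδ, hF.pos_cobr_pairing hω S' hc hδ,
      hF.finsum_actLeft hω hr S₀ hom S hb, hF.finsum_actLeft hω hr S₀ hom S hb,
      hF.finsum_actRight hω hr S₀ hom S' hc, hF.finsum_actRight hω hr S₀ hom S' hc,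
      LinearMap.comp_apply, LinearMap.comp_apply, hF.restricted_pairing S₀ hδ hA, hδ, hΦ, map_add,
      map_add, hF.star_apply_neg hω (S.proj_i x), hF.star_apply_pos hω (S'.proj_i φ)]
    ring

end IsForm

end KMData

/-! ### The graded dual of the negative part as the positive part -/

namespace KMData

variable {k I H L : Type*} [Field k] [CharZero k] [Fintype I] [AddCommGroup H] [Module k H]
  [LieRing L] [LieAlgebra k L] {D : KMData k I H L} {d : I → k} {B : L →ₗ[k] L →ₗ[k] k}
  {V : Type*} [AddCommGroup V] [Module k V] {ω : (I →₀ ℤ) →+ ℤ} {i : V →ₗ[k] L} {j : L →ₗ[k] V}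

/-- The map u ↦ B(u, ·) restricted to positive degree is injective by nondegeneracy and onto the
graded dual by `exists_of_mem_gradedDual`. Its inverse is the embedding `i'`. -/
lemma IsForm.exists_dual_slice [Module.Finite k H] (hF : D.IsForm d B) (S : D.Slice (negSet ω) i j) :
    ∃ (i' : ↥(gradedDual fun γ => (D.W γ).comap i) →ₗ[k] L)
      (j' : L →ₗ[k] ↥(gradedDual fun γ => (D.W γ).comap i)),
      D.Slice (V := ↥(gradedDual fun γ => (D.W γ).comap i)) (posSet ω) i' j' ∧
      ∀ (φ : ↥(gradedDual fun γ => (D.W γ).comap i)) x,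
        (φ : Module.Dual k V) x = B (i' φ) (i x) := by
  let Ψ : L →ₗ[k] (gradedDual fun γ => (D.W γ).comap i) :=
    (pull B i).codRestrict _ (fun u => hF.mem_gradedDual u)
  have hΨ : ∀ u x, (Ψ u : Module.Dual k V) x = B u (i x) := fun u x => rfl
  let N := LinearMap.range (D.proj (posSet ω))
  have hN : ∀ u ∈ N, D.proj (posSet ω) u = u := by
    rintro _ ⟨u, rfl⟩; exact D.proj_idem _ _
  have bij : Function.Bijective (Ψ ∘ₗ N.subtype) := by
    constructor
    · refine (injective_iff_map_eq_zero _).2 fun u hu => Subtype.ext ?_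
      refine hF.nondeg _ fun y => ?_
      rw [← hN u u.2, hF.proj_adjoint, neg_posSet, ← S.i_j, ← hΨ]
      change ((Ψ ∘ₗ N.subtype) u : Module.Dual k V) _ = 0
      rw [hu]; rfl
    · intro φ
      obtain ⟨u, hu, hφ⟩ := hF.exists_of_mem_gradedDual S φ.2
      rw [neg_negSet] at hu
      exact ⟨⟨u, u, hu⟩, Subtype.ext hφ.symm⟩
  let E := LinearEquiv.ofBijective _ bij
  have hE : ∀ φ, Ψ (E.symm φ : L) = φ := fun φ => E.apply_symm_apply φ
  refine ⟨N.subtype ∘ₗ E.symm.toLinearMap, Ψ, ⟨hE, fun x => ?_⟩, fun φ x => ?_⟩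
  · have h1 : Ψ x = E ⟨D.proj (posSet ω) x, x, rfl⟩ := by
      apply Subtype.ext
      change pull B i x = pull B i (D.proj (posSet ω) x)
      rw [← neg_negSet, S.pull_proj hF]
    rw [h1, LinearMap.comp_apply, LinearEquiv.coe_coe, E.symm_apply_apply]; rfl
  · conv_lhs => rw [← hE φ]
    rfl

end KMData

/-! ### The gradings of L(C) and of the Borel subalgebra, described by weights -/

section Gradings

variable {k : Type*} [Field k] [CharZero k] {I J : Type*} [Fintype I] [Fintype J]
  {C : Matrix I I ℤ} {H : Type*} [AddCommGroup H] [Module k H] (R : RootDatum k C H) (ι : J → I)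

/-- The degree of a weight. -/
def chiDeg {I J : Type*} [Fintype I] [Fintype J] (ι : J → I) : (I →₀ ℤ) →+ ℤ where
  toFun γ := ∑ i, (chi ι i : ℤ) * γ i
  map_zero' := by simp
  map_add' a b := by simp [mul_add, Finset.sum_add_distrib]

lemma chiDeg_single (i : I) : chiDeg ι (Finsupp.single i 1) = chi ι i := by
  classical
  simp [chiDeg, Finsupp.single_apply]

lemma chiDeg_nonneg (γ : I →₀ ℤ) (h : 0 ≤ γ) : 0 ≤ chiDeg ι γ :=
  Finset.sum_nonneg fun i _ => mul_nonneg (by positivity) (h i)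

/-- The weights of degree `n`. -/
def degSet {I J : Type*} [Fintype I] [Fintype J] (ι : J → I) (n : ℤ) : Set (I →₀ ℤ) := {γ | chiDeg ι γ = n}

lemma mem_degSet {ι : J → I} {n : ℤ} {γ : I →₀ ℤ} : γ ∈ degSet ι n ↔ chiDeg ι γ = n := Iff.rfl

lemma ew_mem_zGrading (l : List I) (i : I) :
    (data R).ew l i ∈ zGrading R ι (chiDeg ι (KMData.lwt l i)) := by
  induction l with
  | nil =>
    rw [KMData.lwt_nil, chiDeg_single]
    exact GenDegree.gen _ _ (Or.inl ⟨i, rfl, rfl⟩)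
  | cons j l ih =>
    rw [KMData.lwt_cons, map_add, chiDeg_single]
    exact GenDegree.lie _ _ _ _ (GenDegree.gen _ _ (Or.inl ⟨j, rfl, rfl⟩)) ih

lemma fw_mem_zGrading (l : List I) (i : I) :
    (data R).fw l i ∈ zGrading R ι (-chiDeg ι (KMData.lwt l i)) := by
  induction l with
  | nil =>
    rw [KMData.lwt_nil, chiDeg_single]
    exact GenDegree.gen _ _ (Or.inr (Or.inl ⟨i, rfl, rfl⟩))
  | cons j l ih =>
    rw [KMData.lwt_cons, map_add, chiDeg_single, neg_add]
    exact GenDegree.lie _ _ _ _ (GenDegree.gen _ _ (Or.inr (Or.inl ⟨j, rfl, rfl⟩))) ih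

lemma h_mem_zGrading (y : H) : h R y ∈ zGrading R ι 0 :=
  GenDegree.gen _ _ (Or.inr (Or.inr ⟨y, rfl, rfl⟩))

/-- The grading generated by the generators is the weight grading coarsened by `chiDeg`: one
inclusion is by induction on the generation, the other because every iterated bracket is homogeneous
of the expected degree. -/
lemma mem_zGrading_iff {n : ℤ} {x : Alg R} :
    x ∈ zGrading R ι n ↔ (data R).proj (degSet ι n) x = x := by
  constructor
  · intro hx
    have hx' : GenDegree k _ n x := hx
    clear hx
    induction hx' with
    | gen n x hx =>
      rcases hx with ⟨i, rfl, rfl⟩ | ⟨i, rfl, rfl⟩ | ⟨y, rfl, rfl⟩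
      · exact (data R).proj_of_mem ((data R).e_mem i) (chiDeg_single ι i)
      · exact (data R).proj_of_mem ((data R).f_mem i) (by rw [mem_degSet, map_neg, chiDeg_single])
      · exact (data R).proj_of_mem ((data R).h_mem y) (map_zero _)
    | zero => rw [map_zero]
    | add n x y h1 h2 ihx ihy => rw [map_add, ihx, ihy]
    | smul n c x h1 ihx => rw [map_smul, ihx]
    | lie m n x y h1 h2 ihx ihy =>
      exact (data R).proj_lie (fun a ha b hb => by
        rw [mem_degSet] at *; rw [map_add, ha, hb]) (ihx) (ihy)
  · intro hx
    rw [← hx]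
    refine (data R).proj_mem _ (fun l i h => ?_) (fun l i h => ?_) (fun h y => ?_) x
    · rw [← mem_degSet.1 h]; exact ew_mem_zGrading R ι l i
    · rw [← mem_degSet.1 h, map_neg]; exact fw_mem_zGrading R ι l i
    · rw [← mem_degSet.1 h, map_zero]; exact h_mem_zGrading R ι y

lemma zGrading_internal : DirectSum.IsInternal (zGrading R ι) := by
  refine isInternal_of_ops LinearMap.id Function.injective_id
    (fun n => (data R).proj (degSet ι n)) (fun n x hx => (mem_zGrading_iff R ι).1 hx)
    (fun m n hmn x hx => (data R).proj_disjoint ?_ ((mem_zGrading_iff R ι).1 hx)) ?_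
  · exact Set.disjoint_left.2 fun a h1 h2 => hmn (h2.symm.trans h1)
  · intro x
    induction x using (data R).hom_induction with
    | hadd a b ha hb => exact add_mem ha hb
    | hW γ x hx =>
      refine Submodule.mem_iSup_of_mem (chiDeg ι γ) ?_
      rw [mem_zGrading_iff]
      exact (data R).proj_of_mem hx rfl

lemma mem_iSup_zGrading {P : ℤ → Prop} {y : Alg R} :
    y ∈ ⨆ (n : ℤ) (_ : P n), zGrading R ι n
      ↔ (data R).proj {γ | P (chiDeg ι γ)} y = y := by
  constructor
  · intro hy
    have : ⨆ (n : ℤ) (_ : P n), zGrading R ι n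
        ≤ LinearMap.eqLocus ((data R).proj {γ | P (chiDeg ι γ)}) LinearMap.id := by
      refine iSup₂_le fun n hn x hx => ?_
      refine (data R).proj_subset (fun γ hγ => ?_) ((mem_zGrading_iff R ι).1 hx)
      rw [mem_degSet] at hγ
      change P _
      rwa [hγ]
    exact this hy
  · intro hy
    rw [← hy]
    refine (data R).proj_mem _ (fun l i h => ?_) (fun l i h => ?_) (fun h z => ?_) y
    · exact Submodule.mem_iSup_of_mem _ (Submodule.mem_iSup_of_mem h (ew_mem_zGrading R ι l i))
    · refine Submodule.mem_iSup_of_mem _ (Submodule.mem_iSup_of_mem ?_ (fw_mem_zGrading R ι l i))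
      rw [← map_neg]; exact h
    · refine Submodule.mem_iSup_of_mem _ (Submodule.mem_iSup_of_mem ?_ (h_mem_zGrading R ι z))
      rw [← map_zero (chiDeg ι)]; exact h

/-- The degree counts the letters outside ι(J), with nothing to cancel. So an iterated bracket of
degree zero uses only letters from ι(J), which is why the degree-zero part is no larger than
`sharp`. -/
lemma chiDeg_lwt_eq_zero {l : List I} {i : I} (hl : chiDeg ι (KMData.lwt l i) = 0) :
    chi ι i = 0 ∧ ∀ j ∈ l, chi ι j = 0 := by
  induction l with
  | nil =>
    rw [KMData.lwt_nil, chiDeg_single] at hl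
    exact ⟨by exact_mod_cast hl, by simp⟩
  | cons j l ih =>
    rw [KMData.lwt_cons, map_add, chiDeg_single] at hl
    have h1 := chiDeg_nonneg ι _ (KMData.lwt_nonneg l i)
    have h2 := ih (by omega)
    refine ⟨h2.1, fun j' hj' => ?_⟩
    rcases List.mem_cons.1 hj' with rfl | h
    · omega
    · exact h2.2 j' h

lemma chi_eq_zero {i : I} : chi ι i = 0 ↔ i ∈ Set.range ι := by
  classical
  rw [chi]; split_ifs <;> simp_all

lemma e_mem_sharp (j : J) : e R (ι j) ∈ sharp R ι :=
  LieSubalgebra.subset_lieSpan (Or.inl (Or.inl ⟨j, rfl⟩))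
lemma f_mem_sharp (j : J) : f R (ι j) ∈ sharp R ι :=
  LieSubalgebra.subset_lieSpan (Or.inl (Or.inr ⟨j, rfl⟩))
lemma h_mem_sharp (y : H) : h R y ∈ sharp R ι :=
  LieSubalgebra.subset_lieSpan (Or.inr ⟨y, rfl⟩)

lemma ew_mem_sharp {l : List I} {i : I} (hl : chiDeg ι (KMData.lwt l i) = 0) :
    (data R).ew l i ∈ sharp R ι := by
  obtain ⟨h1, h2⟩ := chiDeg_lwt_eq_zero ι hl
  clear hl
  induction l with
  | nil =>
    obtain ⟨j, rfl⟩ := (chi_eq_zero ι).1 h1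
    exact e_mem_sharp R ι j
  | cons j l ih =>
    obtain ⟨j, rfl⟩ := (chi_eq_zero ι).1 (h2 j (by simp))
    exact LieSubalgebra.lie_mem _ (e_mem_sharp R ι j) (ih fun j hj => h2 j (by simp [hj]))

lemma fw_mem_sharp {l : List I} {i : I} (hl : chiDeg ι (KMData.lwt l i) = 0) :
    (data R).fw l i ∈ sharp R ι := by
  obtain ⟨h1, h2⟩ := chiDeg_lwt_eq_zero ι hl
  clear hl
  induction l with
  | nil =>
    obtain ⟨j, rfl⟩ := (chi_eq_zero ι).1 h1
    exact f_mem_sharp R ι j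
  | cons j l ih =>
    obtain ⟨j, rfl⟩ := (chi_eq_zero ι).1 (h2 j (by simp))
    exact LieSubalgebra.lie_mem _ (f_mem_sharp R ι j) (ih fun j hj => h2 j (by simp [hj]))

/-- The Lie subalgebra of vectors with weights in a set closed under addition. -/
def weightSubalgebra (A : Set (I →₀ ℤ)) (hA : ∀ a ∈ A, ∀ b ∈ A, a + b ∈ A) :
    LieSubalgebra k (Alg R) :=
  { LinearMap.eqLocus ((data R).proj A) LinearMap.id with
    lie_mem' := fun hx hy => (data R).proj_lie hA hx hy }

lemma mem_sharp_iff {y : Alg R} :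
    y ∈ sharp R ι ↔ (data R).proj (zeroSet (chiDeg ι)) y = y := by
  constructor
  · intro hy
    have : sharp R ι ≤ weightSubalgebra R (zeroSet (chiDeg ι)) (fun a ha b hb => by
        rw [mem_zeroSet] at *; rw [map_add, ha, hb, add_zero]) := by
      refine LieSubalgebra.lieSpan_le.2 ?_
      have hz : ∀ j, chi ι (ι j) = 0 := fun j => (chi_eq_zero ι).2 ⟨j, rfl⟩
      rintro _ ((⟨j, rfl⟩ | ⟨j, rfl⟩) | ⟨z, rfl⟩)
      · exact (data R).proj_of_mem ((data R).e_mem (ι j)) (by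
          rw [mem_zeroSet, chiDeg_single, hz]; rfl)
      · exact (data R).proj_of_mem ((data R).f_mem (ι j)) (by
          rw [mem_zeroSet, map_neg, chiDeg_single, hz]; rfl)
      · exact (data R).proj_of_mem ((data R).h_mem z) (map_zero _)
    exact this hy
  · intro hy
    rw [← hy]
    refine (data R).proj_mem (N := (sharp R ι).toSubmodule) _ (fun l i h => ew_mem_sharp R ι h)
      (fun l i h => fw_mem_sharp R ι ?_) (fun _ z => h_mem_sharp R ι z) y
    rw [mem_zeroSet, map_neg, neg_eq_zero] at h; exact h

lemma zGrading_zero : zGrading R ι 0 = (sharp R ι).toSubmodule := by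
  ext x
  rw [mem_zGrading_iff]
  exact (mem_sharp_iff R ι).symm

lemma fw_mem_borel (l : List I) (i : I) : (data R).fw l i ∈ borel R := by
  induction l with
  | nil => exact LieSubalgebra.subset_lieSpan (Or.inl ⟨i, rfl⟩)
  | cons j l ih =>
    exact LieSubalgebra.lie_mem _ (LieSubalgebra.subset_lieSpan (Or.inl ⟨j, rfl⟩)) ih

lemma h_mem_borel (y : H) : h R y ∈ borel R := LieSubalgebra.subset_lieSpan (Or.inr ⟨y, rfl⟩)

lemma mem_borel_iff {y : Alg R} : y ∈ borel R ↔ (data R).proj {γ | γ ≤ 0} y = y := by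
  constructor
  · intro hy
    have : borel R ≤ weightSubalgebra R {γ | γ ≤ 0} (fun a (ha : a ≤ 0) b (hb : b ≤ 0) => show a + b ≤ 0 from add_nonpos ha hb) := by
      refine LieSubalgebra.lieSpan_le.2 ?_
      rintro _ (⟨j, rfl⟩ | ⟨z, rfl⟩)
      · exact (data R).proj_of_mem ((data R).f_mem j)
          (neg_nonpos.2 (KMData.single_pos j).le)
      · exact (data R).proj_of_mem ((data R).h_mem z) (Set.mem_ofPred_eq ▸ le_refl (0 : I →₀ ℤ))
    exact this hy
  · intro hy
    rw [← hy]
    exact (data R).proj_mem (N := (borel R).toSubmodule) _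
      (fun l i h => absurd h (KMData.lwt_pos l i).not_ge)
      (fun l i _ => fw_mem_borel R l i) (fun _ z => h_mem_borel R z) y

lemma exists_fw_nGrading (l : List I) (i : I) :
    ∃ (n : ℕ) (x : borel R), x ∈ nGrading R ι n ∧ (x : Alg R) = (data R).fw l i ∧
      (n : ℤ) = chiDeg ι (KMData.lwt l i) := by
  induction l with
  | nil =>
    refine ⟨chi ι i, ⟨_, fw_mem_borel R [] i⟩, GenDegree.gen _ _ (Or.inl ⟨i, rfl, rfl⟩), rfl, ?_⟩
    rw [KMData.lwt_nil, chiDeg_single]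
  | cons j l ih =>
    obtain ⟨n, x, hx, hx', hn⟩ := ih
    refine ⟨chi ι j + n, ⁅(⟨_, fw_mem_borel R [] j⟩ : borel R), x⁆,
      GenDegree.lie _ _ _ _ (GenDegree.gen _ _ (Or.inl ⟨j, rfl, rfl⟩)) hx, ?_, ?_⟩
    · rw [LieSubalgebra.coe_bracket, hx']; rfl
    · rw [KMData.lwt_cons, map_add, chiDeg_single, ← hn]; push_cast; rfl

lemma h_mem_nGrading (y : H) : (⟨h R y, h_mem_borel R y⟩ : borel R) ∈ nGrading R ι 0 :=
  GenDegree.gen _ _ (Or.inr ⟨y, rfl, rfl⟩)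

lemma proj_of_mem_nGrading {n : ℕ} {x : borel R} (hx : x ∈ nGrading R ι n) :
    (data R).proj (degSet ι (-n)) x = x := by
  have hx' : GenDegree k _ n x := hx
  clear hx
  induction hx' with
  | gen n x hx =>
    rcases hx with ⟨i, hi, rfl⟩ | ⟨y, hy, rfl⟩
    · rw [hi]
      exact (data R).proj_of_mem ((data R).f_mem i) (by rw [mem_degSet, map_neg, chiDeg_single])
    · rw [hy]
      exact (data R).proj_of_mem ((data R).h_mem y) (map_zero _)
  | zero => exact map_zero _
  | add n x y h1 h2 ihx ihy =>
    change (data R).proj _ ((x : Alg R) + y) = x + y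
    rw [map_add, ihx, ihy]
  | smul n c x h1 ihx =>
    change (data R).proj _ (c • (x : Alg R)) = c • (x : Alg R)
    rw [map_smul, ihx]
  | lie m n x y h1 h2 ihx ihy =>
    exact (data R).proj_lie (fun a ha b hb => by
      rw [mem_degSet] at *; rw [map_add, ha, hb]; push_cast; ring) (ihx) (ihy)

/-- A negative degree already forces a negative weight, so the strictly positive ℕ-degrees of the
Borel subalgebra exhaust the whole negative part of L(C). -/
lemma exists_bIncl_iff {y : Alg R} :
    (∃ x, bIncl R ι x = y) ↔ (data R).proj (negSet (chiDeg ι)) y = y := by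
  constructor
  · rintro ⟨x, rfl⟩
    have : bSpace R ι ≤ (LinearMap.eqLocus ((data R).proj (negSet (chiDeg ι)))
        LinearMap.id).comap (borel R).toSubmodule.subtype := by
      refine iSup₂_le fun n hn x hx => ?_
      refine (data R).proj_subset (fun γ hγ => ?_) (proj_of_mem_nGrading R ι hx)
      rw [mem_degSet] at hγ
      rw [mem_negSet, hγ]; omega
    exact this x.2
  · intro hy
    suffices h : y ∈ LinearMap.range (bIncl R ι) from h
    rw [← hy]
    refine (data R).proj_mem _ (fun l i h => ?_) (fun l i h => ?_) (fun h z => ?_) y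
    · exact absurd (chiDeg_nonneg ι _ (KMData.lwt_nonneg l i)) (not_le.2 h)
    · obtain ⟨n, x, hx, hx', hn⟩ := exists_fw_nGrading R ι l i
      rw [mem_negSet, map_neg, ← hn] at h
      exact ⟨⟨x, Submodule.mem_iSup_of_mem n (Submodule.mem_iSup_of_mem (by omega) hx)⟩, hx'⟩
    · rw [mem_negSet, map_zero] at h; omega

lemma bIncl_injective : Function.Injective (bIncl R ι) :=
  Subtype.val_injective.comp Subtype.val_injective

lemma nGrading_internal : DirectSum.IsInternal (nGrading R ι) := by
  refine isInternal_of_ops (borel R).toSubmodule.subtype Subtype.val_injective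
    (fun n => (data R).proj (degSet ι (-n))) (fun n x hx => proj_of_mem_nGrading R ι hx)
    (fun m n hmn x hx => (data R).proj_disjoint ?_ (proj_of_mem_nGrading R ι hx)) ?_
  · refine Set.disjoint_left.2 fun a h1 h2 => hmn ?_
    rw [mem_degSet] at h1 h2
    omega
  · intro x
    have h1 : (x : Alg R) ∈ (⨆ n, nGrading R ι n).map (borel R).toSubmodule.subtype := by
      rw [← (mem_borel_iff R).1 x.2]
      refine (data R).proj_mem _ (fun l i h => absurd h (KMData.lwt_pos l i).not_ge)
        (fun l i h => ?_) (fun h z => ?_) _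
      · obtain ⟨n, x, hx, hx', -⟩ := exists_fw_nGrading R ι l i
        exact ⟨x, Submodule.mem_iSup_of_mem n hx, hx'⟩
      · exact ⟨_, Submodule.mem_iSup_of_mem 0 (h_mem_nGrading R ι z), rfl⟩
    obtain ⟨y, hy, hyx⟩ := h1
    rwa [← Subtype.ext hyx]

lemma exists_borelProj : ∃ π : borel R →ₗ[k] borel R,
    (∀ x, (π x : Alg R) = (data R).proj (zeroSet (chiDeg ι)) x) ∧
    IsDegreeZeroProjection (nGrading R ι) π ∧ LinearMap.ker π = bSpace R ι := by
  have hmem : ∀ x : borel R, (data R).proj (zeroSet (chiDeg ι)) x ∈ (borel R).toSubmodule := by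
    intro x
    refine (mem_borel_iff R).2 ?_
    rw [KMData.proj_proj, Set.inter_comm, ← KMData.proj_proj, (mem_borel_iff R).1 x.2]
  let π : borel R →ₗ[k] borel R :=
    ((data R).proj (zeroSet (chiDeg ι)) ∘ₗ (borel R).toSubmodule.subtype).codRestrict
      (borel R).toSubmodule hmem
  have hπ : ∀ x, (π x : Alg R) = (data R).proj (zeroSet (chiDeg ι)) x := fun x => rfl
  refine ⟨π, hπ, ⟨fun x hx => Subtype.ext ?_, fun n hn x hx => Subtype.ext ?_⟩, ?_⟩
  · rw [hπ]
    exact (data R).proj_subset (fun a ha => by rw [mem_degSet] at ha; rw [mem_zeroSet, ha]; simp)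
      (proj_of_mem_nGrading R ι hx)
  · rw [hπ]
    refine (data R).proj_disjoint (Set.disjoint_left.2 fun a h1 h2 => ?_)
      (proj_of_mem_nGrading R ι hx)
    rw [mem_degSet] at h1
    rw [mem_zeroSet] at h2
    omega
  · ext x
    rw [LinearMap.mem_ker]
    constructor
    · intro hx
      have h0 : (data R).proj (zeroSet (chiDeg ι)) x = 0 := by rw [← hπ, hx]; rfl
      have h1 : (data R).proj (posSet (chiDeg ι)) x = 0 := by
        refine (data R).proj_disjoint (Set.disjoint_left.2 fun a (h1 : a ≤ 0) h2 => ?_)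
          ((mem_borel_iff R).1 x.2)
        have := chiDeg_nonneg ι (-a) (neg_nonneg.2 h1)
        rw [map_neg] at this
        rw [mem_posSet] at h2; omega
      have h2 := (data R).proj_parts (ω := chiDeg ι) (x : Alg R)
      rw [h0, h1, add_zero, add_zero] at h2
      obtain ⟨y, hy⟩ := (exists_bIncl_iff R ι).2 h2
      have hyx : (y : borel R) = x := Subtype.ext hy
      rw [← hyx]
      exact y.2
    · intro hx
      apply Subtype.ext
      rw [hπ]
      refine (data R).proj_disjoint (A := negSet (chiDeg ι)) (Set.disjoint_left.2 fun a h1 h2 => ?_)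
        ((exists_bIncl_iff R ι).1 ⟨⟨x, hx⟩, rfl⟩)
      rw [mem_negSet] at h1
      rw [mem_zeroSet] at h2
      omega

end Gradings

lemma lieSpan_eq_top_of_image {k L : Type*} [Field k] [LieRing L] [LieAlgebra k L] {S : Set L}
    {T : Set (LieSubalgebra.lieSpan k L S)} (hT : ∀ x ∈ S, ∃ y ∈ T, (y : L) = x) :
    LieSubalgebra.lieSpan k (LieSubalgebra.lieSpan k L S) T = ⊤ := by
  have h1 : LieSubalgebra.lieSpan k L S
      ≤ (LieSubalgebra.lieSpan k _ T).map (LieSubalgebra.lieSpan k L S).incl := by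
    refine LieSubalgebra.lieSpan_le.2 fun x hx => ?_
    obtain ⟨y, hy, rfl⟩ := hT x hx
    exact ⟨y, LieSubalgebra.subset_lieSpan hy, rfl⟩
  rw [eq_top_iff]
  rintro x -
  obtain ⟨y, hy, hyx⟩ := h1 x.2
  have : y = x := Subtype.ext hyx
  exact this ▸ hy

/-! ### The central extension of L(C') -/

section Quotient

variable {k : Type*} [Field k] [CharZero k] {I J : Type*} [Fintype I] [Fintype J]
  {C : Matrix I I ℤ} {C' : Matrix J J ℤ}
  {H H' : Type*} [AddCommGroup H] [Module k H] [AddCommGroup H'] [Module k H']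
  (R : RootDatum k C H) (R' : RootDatum k C' H') (ι : J → I)

omit [CharZero k] in
-- A left inverse of `s` need not respect the roots. The roots of H' are independent, so their joint
-- map `a'` has a section `σ`; then `t` is fixed modulo the kernel of `a'` by the roots, and on that
-- kernel by a retraction `ρ` of `s`.
lemma IsSubRootDatum.exists_retraction {R : RootDatum k C H} {R' : RootDatum k C' H'} {ι : J → I}
    (hsub : IsSubRootDatum R' R ι) : ∃ t : H →ₗ[k] H',
      Function.Surjective t ∧ (∀ j, t (R.coroot (ι j)) = R'.coroot j) ∧ ∀ j x, R'.root j (t x) = R.root (ι j) x := by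
  obtain ⟨s, hs, hs1, hs2⟩ := hsub.exists_map
  have hs2' : ∀ j x, R.root (ι j) (s x) = R'.root j x := fun j x => LinearMap.congr_fun (hs2 j) x
  classical
  let a : H →ₗ[k] (J → k) := LinearMap.pi fun j => R.root (ι j)
  let a' : H' →ₗ[k] (J → k) := LinearMap.pi R'.root
  have ha' : Function.Surjective a' := by
    rw [← LinearMap.range_eq_top]
    by_contra hne
    obtain ⟨f, hf, hle⟩ := Submodule.exists_le_ker_of_lt_top _ (lt_top_iff_ne_top.2 hne)
    have hfs : ∀ v : J → k, f v = ∑ j, v j * f (Pi.single j 1) := fun v => by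
      conv_lhs => rw [← Finset.univ_sum_single v, map_sum]
      refine Finset.sum_congr rfl fun j _ => ?_
      rw [← smul_eq_mul, ← map_smul, ← Pi.single_smul, smul_eq_mul, mul_one]
    have h1 := Fintype.linearIndependent_iff.1 R'.root_indep (fun j => f (Pi.single j 1)) (by
      ext y
      have h2 : f (a' y) = 0 := hle ⟨y, rfl⟩
      rw [hfs] at h2
      rw [LinearMap.zero_apply, ← h2, LinearMap.sum_apply]
      exact Finset.sum_congr rfl fun j _ => mul_comm _ _)
    refine hf (LinearMap.ext fun v => ?_)
    rw [hfs, Finset.sum_eq_zero fun j _ => by rw [h1, mul_zero]]; rfl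
  obtain ⟨σ, hσ⟩ := a'.exists_rightInverse_of_surjective (LinearMap.range_eq_top.2 ha')
  have hσ' : ∀ y, a' (σ y) = y := fun y => LinearMap.congr_fun hσ y
  obtain ⟨ρ, hρ⟩ := (s ∘ₗ (LinearMap.ker a').subtype).exists_leftInverse_of_injective
    (LinearMap.ker_eq_bot.2 (hs.comp Subtype.val_injective))
  let t : H →ₗ[k] H' := σ ∘ₗ a + (LinearMap.ker a').subtype ∘ₗ ρ ∘ₗ (LinearMap.id - s ∘ₗ σ ∘ₗ a)
  have ht : ∀ x, t x = σ (a x) + ρ (x - s (σ (a x))) := fun x => rfl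
  have has : ∀ y, a (s y) = a' y := fun y => funext fun j => hs2' j y
  have hts : ∀ y, t (s y) = y := by
    intro y
    rw [ht, has]
    have h1 : y - σ (a' y) ∈ LinearMap.ker a' := by
      rw [LinearMap.mem_ker, map_sub, hσ', sub_self]
    have h2 := LinearMap.congr_fun hρ ⟨_, h1⟩
    rw [LinearMap.comp_apply, LinearMap.comp_apply] at h2
    rw [← map_sub]
    change _ + ((ρ (s ((LinearMap.ker a').subtype ⟨_, h1⟩)) : LinearMap.ker a') : H') = _
    rw [h2]
    simp
  refine ⟨t, fun y => ⟨s y, hts y⟩, fun j => by rw [← hs1, hts], fun j x => ?_⟩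
  · have h1 : a' (t x) = a x := by
      rw [ht, map_add, hσ', LinearMap.mem_ker.1 (ρ _).2, add_zero]
    exact congrFun h1 j

/-- The realization data of `L♯(C')`. -/
def sharpData (hι : Function.Injective ι) : KMData k J H (sharp R ι) where
  root j := R.root (ι j)
  coroot j := R.coroot (ι j)
  e j := ⟨e R (ι j), e_mem_sharp R ι j⟩
  f j := ⟨f R (ι j), f_mem_sharp R ι j⟩
  h := (data R).h.codRestrict (sharp R ι).toSubmodule (h_mem_sharp R ι)
  root_indep := R.root_indep.comp ι hι
  h_inj := fun x y hxy => (data R).h_inj (congrArg Subtype.val hxy)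
  hh x y := Subtype.ext ((data R).hh x y)
  he x i := Subtype.ext ((data R).he x _)
  hf x i := Subtype.ext ((data R).hf x _)
  ef_same i := Subtype.ext ((data R).ef_same _)
  ef_ne i j hij := Subtype.ext ((data R).ef_ne _ _ (hι.ne hij))
  gen := by
    refine lieSpan_eq_top_of_image ?_
    rintro _ ((⟨j, rfl⟩ | ⟨j, rfl⟩) | ⟨z, rfl⟩)
    · exact ⟨_, Or.inl (Or.inl ⟨j, rfl⟩), rfl⟩
    · exact ⟨_, Or.inl (Or.inr ⟨j, rfl⟩), rfl⟩
    · exact ⟨_, Or.inr ⟨z, rfl⟩, rfl⟩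

section Graph

variable (hι : Function.Injective ι) (t : H →ₗ[k] H')

/-- The generators of the graph of the projection of `L♯(C')` onto `L(C')`. -/
def graphGens : Set (sharp R ι × Alg R') :=
  Set.range (fun j => ((sharpData R ι hι).e j, e R' j)) ∪
    Set.range (fun j => ((sharpData R ι hι).f j, f R' j)) ∪
    Set.range (fun x => ((sharpData R ι hι).h x, h R' (t x)))

/-- The graph of the projection of `L♯(C')` onto `L(C')`. -/
def graph : LieSubalgebra k (sharp R ι × Alg R') :=
  LieSubalgebra.lieSpan k _ (graphGens R R' ι hι t)

variable (ht1 : ∀ j, t (R.coroot (ι j)) = R'.coroot j)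
  (ht2 : ∀ j x, R'.root j (t x) = R.root (ι j) x)

/-- The realization data of the graph. -/
def graphData : KMData k J H (graph R R' ι hι t) where
  root j := R.root (ι j)
  coroot j := R.coroot (ι j)
  e j := ⟨((sharpData R ι hι).e j, e R' j), LieSubalgebra.subset_lieSpan (Or.inl (Or.inl ⟨j, rfl⟩))⟩
  f j := ⟨((sharpData R ι hι).f j, f R' j), LieSubalgebra.subset_lieSpan (Or.inl (Or.inr ⟨j, rfl⟩))⟩
  h := ((sharpData R ι hι).h.prod ((data R').h ∘ₗ t)).codRestrict (graph R R' ι hι t).toSubmodule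
    (fun x => LieSubalgebra.subset_lieSpan (Or.inr ⟨x, rfl⟩))
  root_indep := R.root_indep.comp ι hι
  h_inj := fun x y hxy => (sharpData R ι hι).h_inj (congrArg (fun z => z.1.1) hxy)
  hh x y := Subtype.ext (Prod.ext ((sharpData R ι hι).hh x y) ((data R').hh _ _))
  he x i := Subtype.ext (Prod.ext ((sharpData R ι hι).he x i) (by
    have := (data R').he (t x) i
    rw [show (data R').root i (t x) = R.root (ι i) x from ht2 i x] at this
    exact this))
  hf x i := Subtype.ext (Prod.ext ((sharpData R ι hι).hf x i) (by
    have := (data R').hf (t x) i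
    rw [show (data R').root i (t x) = R.root (ι i) x from ht2 i x] at this
    exact this))
  ef_same i := Subtype.ext (Prod.ext ((sharpData R ι hι).ef_same i) (by
    have := (data R').ef_same i
    rw [show (data R').coroot i = t (R.coroot (ι i)) from (ht1 i).symm] at this
    exact this))
  ef_ne i j hij := Subtype.ext (Prod.ext ((sharpData R ι hι).ef_ne i j hij) ((data R').ef_ne i j hij))
  gen := by
    refine lieSpan_eq_top_of_image ?_
    rintro _ ((⟨j, rfl⟩ | ⟨j, rfl⟩) | ⟨z, rfl⟩)
    · exact ⟨_, Or.inl (Or.inl ⟨j, rfl⟩), rfl⟩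
    · exact ⟨_, Or.inl (Or.inr ⟨j, rfl⟩), rfl⟩
    · exact ⟨_, Or.inr ⟨z, rfl⟩, rfl⟩

end Graph

include R R' in
-- L♯(C') is given as a subalgebra rather than by a presentation, so the map is found as a graph.
-- The subalgebra `G` of the product generated by pairs of generators surjects onto both factors,
-- and it is a graph once its elements with first coordinate zero vanish.
lemma exists_sharp_hom {ι : J → I} (hι : Function.Injective ι) {t : H →ₗ[k] H'}
    (ht1 : ∀ j, t (R.coroot (ι j)) = R'.coroot j)
    (ht2 : ∀ j x, R'.root j (t x) = R.root (ι j) x) (ht : Function.Surjective t) :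
    ∃ q : sharp R ι →ₗ⁅k⁆ Alg R', Function.Surjective q ∧
      (∀ j, q ((sharpData R ι hι).e j) = e R' j) ∧ (∀ j, q ((sharpData R ι hι).f j) = f R' j) ∧
      ∀ x, q ((sharpData R ι hι).h x) = h R' (t x) := by
  let G := graph R R' ι hι t
  let DG := graphData R R' ι hι t ht1 ht2
  let p1 : G →ₗ⁅k⁆ sharp R ι := (LieHom.fst k (sharp R ι) (Alg R')).comp G.incl
  let p2 : G →ₗ⁅k⁆ Alg R' := (LieHom.snd k (sharp R ι) (Alg R')).comp G.incl
  have s1 : Function.Surjective p1 := by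
    intro x
    induction x using (sharpData R ι hι).gen_induction with
    | he j => exact ⟨DG.e j, rfl⟩
    | hf j => exact ⟨DG.f j, rfl⟩
    | hh y => exact ⟨DG.h y, rfl⟩
    | h0 => exact ⟨0, map_zero _⟩
    | hadd x y hx hy =>
      obtain ⟨x, rfl⟩ := hx; obtain ⟨y, rfl⟩ := hy
      exact ⟨x + y, map_add _ _ _⟩
    | hsmul c x hx => obtain ⟨x, rfl⟩ := hx; exact ⟨c • x, map_smul _ _ _⟩
    | hlie x y hx hy =>
      obtain ⟨x, rfl⟩ := hx; obtain ⟨y, rfl⟩ := hy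
      exact ⟨⁅x, y⁆, LieHom.map_lie _ _ _⟩
  have s2 : Function.Surjective p2 := by
    intro x
    induction x using (data R').gen_induction with
    | he j => exact ⟨DG.e j, rfl⟩
    | hf j => exact ⟨DG.f j, rfl⟩
    | hh y => obtain ⟨y, rfl⟩ := ht y; exact ⟨DG.h y, rfl⟩
    | h0 => exact ⟨0, map_zero _⟩
    | hadd x y hx hy =>
      obtain ⟨x, rfl⟩ := hx; obtain ⟨y, rfl⟩ := hy
      exact ⟨x + y, map_add _ _ _⟩
    | hsmul c x hx => obtain ⟨x, rfl⟩ := hx; exact ⟨c • x, map_smul _ _ _⟩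
    | hlie x y hx hy =>
      obtain ⟨x, rfl⟩ := hx; obtain ⟨y, rfl⟩ := hy
      exact ⟨⁅x, y⁆, LieHom.map_lie _ _ _⟩
  -- Second coordinates of elements with first coordinate zero form an ideal, because `p2` is
  -- surjective. It then suffices that this ideal meets H' trivially.
  have hN : (LinearMap.ker (p1 : G →ₗ[k] sharp R ι)).map (p2 : G →ₗ[k] Alg R') = ⊥ := by
    refine data_ideal R' _ ?_ ?_
    · rintro z _ ⟨x, hx, rfl⟩
      obtain ⟨z, rfl⟩ := s2 z
      refine ⟨⁅z, x⁆, ?_, LieHom.map_lie _ _ _⟩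
      have hx' : p1 x = 0 := hx
      change p1 ⁅z, x⁆ = 0
      rw [LieHom.map_lie, hx', lie_zero]
    · rintro y ⟨x, hx, hxy⟩
      have hx' : p1 x = 0 := hx
      have hxy' : p2 x = h R' y := hxy
      -- The pair (0, h y) has weight 0 in `G`, so it is the generator attached to some `z` in H.
      -- Its first coordinate forces z = 0, hence y = 0.
      have hw : x ∈ DG.W 0 := by
        intro z
        rw [KMData.ev_zero, zero_smul]
        apply Subtype.ext
        refine Prod.ext ?_ ?_
        · change ⁅_, p1 x⁆ = 0
          rw [hx', lie_zero]
        · change ⁅h R' (t z), p2 x⁆ = 0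
          rw [hxy']
          exact (data R').hh _ _
      obtain ⟨z, rfl⟩ := DG.W_zero hw
      have hz : z = 0 := (sharpData R ι hι).h_inj (hx'.trans (map_zero _).symm)
      apply (data R').h_inj
      rw [map_zero]
      refine hxy'.symm.trans ?_
      rw [hz, map_zero, map_zero]
  have i1 : Function.Injective p1 := by
    refine (injective_iff_map_eq_zero p1).2 fun x hx => ?_
    have h2 : p2 x ∈ (LinearMap.ker (p1 : G →ₗ[k] sharp R ι)).map (p2 : G →ₗ[k] Alg R') :=
      ⟨x, hx, rfl⟩
    rw [hN, Submodule.mem_bot] at h2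
    exact Subtype.ext (Prod.ext hx h2)
  let E := LieEquiv.ofBijective p1 ⟨i1, s1⟩
  have hE : ∀ x : G, E.symm (p1 x) = x := fun x => E.symm_apply_apply x
  refine ⟨p2.comp E.symm.toLieHom, s2.comp E.symm.surjective, fun j => ?_, fun j => ?_, fun x => ?_⟩
  · change p2 (E.symm (p1 (DG.e j))) = _
    rw [hE]; rfl
  · change p2 (E.symm (p1 (DG.f j))) = _
    rw [hE]; rfl
  · change p2 (E.symm (p1 (DG.h x))) = _
    rw [hE]; rfl

lemma chiDeg_eq_zero_iff {γ : I →₀ ℤ} (hγ : 0 ≤ γ) (h0 : chiDeg ι γ = 0) {i : I}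
    (hi : i ∉ Set.range ι) : γ i = 0 := by
  have h1 := (Finset.sum_eq_zero_iff_of_nonneg (fun i _ =>
    mul_nonneg (by positivity : (0 : ℤ) ≤ chi ι i) (hγ i))).1 h0 i (Finset.mem_univ i)
  have h2 : chi ι i ≠ 0 := fun h => hi ((chi_eq_zero ι).1 h)
  rcases mul_eq_zero.1 h1 with h | h
  · exact absurd (by exact_mod_cast h) h2
  · exact h

/-- The kernel of the projection of `L♯(C')` onto `L(C')` is central. -/
lemma ker_le_center {ι : J → I} (hι : Function.Injective ι) {t : H →ₗ[k] H'}
    (ht1 : ∀ j, t (R.coroot (ι j)) = R'.coroot j)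
    (ht2 : ∀ j x, R'.root j (t x) = R.root (ι j) x) {d : I → k} (hd : ∀ i, d i ≠ 0)
    {B : Alg R →ₗ[k] Alg R →ₗ[k] k} (hF : (data R).IsForm d B) (q : sharp R ι →ₗ⁅k⁆ Alg R')
    (hq : ∀ x, q ((sharpData R ι hι).h x) = h R' (t x)) :
    q.ker ≤ LieAlgebra.center k (sharp R ι) := by
  have hker : ∀ x, q ((sharpData R ι hι).h x) = 0 → t x = 0 := fun x hx => by
    rw [hq] at hx
    exact (data R').h_inj (hx.trans (map_zero _).symm)
  -- A weight of degree zero and definite sign is supported on ι(J), so `t` sends ν(γ) to a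
  -- combination of the independent coroots of C' with coefficients γ_{ι(j)} d_{ι(j)}.
  have hnu : ∀ γ : I →₀ ℤ, chiDeg ι γ = 0 → (0 < γ ∨ γ < 0) → t ((data R).nu d γ) ≠ 0 := by
    intro γ h0 hs h1
    have hz : ∀ i, i ∉ Set.range ι → γ i = 0 := by
      intro i hi
      rcases hs with hs | hs
      · exact chiDeg_eq_zero_iff ι hs.le h0 hi
      · have := chiDeg_eq_zero_iff ι (γ := -γ) (neg_nonneg.2 hs.le) (by rw [map_neg, h0, neg_zero]) hi
        simpa using this
    have h2 : t ((data R).nu d γ) = ∑ j, ((γ (ι j) : k) * d (ι j)) • R'.coroot j := by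
      rw [KMData.nu, map_sum, ← Finset.sum_subset (Finset.subset_univ (Finset.univ.map ⟨ι, hι⟩)),
        Finset.sum_map]
      · refine Finset.sum_congr rfl fun j _ => ?_
        rw [map_smul]
        congr 1
        exact ht1 j
      · intro i _ hi
        rw [hz i (by simpa using hi)]; simp
    rw [h2] at h1
    have h3 := Fintype.linearIndependent_iff.1 R'.coroot_indep _ h1
    have h4 : γ = 0 := by
      ext i
      by_cases hi : i ∈ Set.range ι
      · obtain ⟨j, rfl⟩ := hi
        have := (mul_eq_zero.1 (h3 j)).resolve_right (hd _)
        simpa using this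
      · exact hz i hi
    rcases hs with hs | hs
    · exact hs.ne' h4
    · exact hs.ne h4
  intro x hx
  have hxq : q x = 0 := hx
  let N : Submodule k (Alg R) := (LinearMap.ker (q : sharp R ι →ₗ[k] Alg R')).map
    (sharp R ι).toSubmodule.subtype
  have hN : ∀ z ∈ sharp R ι, ∀ y ∈ N, ⁅z, y⁆ ∈ N := by
    rintro z hz _ ⟨y, hy, rfl⟩
    refine ⟨⁅(⟨z, hz⟩ : sharp R ι), y⁆, ?_, rfl⟩
    have hy' : q y = 0 := hy
    change q _ = 0
    rw [LieHom.map_lie, hy', lie_zero]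
  have hNh : ∀ y, ∀ x ∈ N, ⁅(data R).h y, x⁆ ∈ N := fun y => hN _ (h_mem_sharp R ι y)
  have hNz : ∀ y, h R y ∈ N → t y = 0 := by
    rintro y ⟨z, hz, hzy⟩
    refine hker y ?_
    have : z = (sharpData R ι hι).h y := Subtype.ext hzy
    rw [← this]; exact hz
  have hxN : (x : Alg R) ∈ N := ⟨x, hxq, rfl⟩
  -- The kernel has no component of nonzero weight. Such a component would pair nontrivially with
  -- some `y` of opposite weight, necessarily of degree zero, and their bracket would put ν(-γ) in
  -- the kernel, against `hnu`.
  have h0 : (data R).proj {0} (x : Alg R) = x := by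
    rw [eq_comm, ← sub_eq_zero]
    refine hF.nondeg _ fun y => ?_
    induction y using (data R).hom_induction with
    | hadd a b ha hb => rw [map_add, ha, hb, add_zero]
    | hW γ y hy =>
    rw [← (data R).proj_of_mem hy (Set.mem_singleton γ), ← neg_neg ({γ} : Set (I →₀ ℤ)),
      ← hF.proj_adjoint, Set.neg_singleton, map_sub, KMData.proj_proj]
    by_cases hγ : γ = 0
    · subst hγ; simp
    have h1 : ({-γ} : Set (I →₀ ℤ)) ∩ {0} = ∅ := by
      rw [Set.singleton_inter_eq_empty]; simpa using hγ
    have h2 : (data R).proj ∅ (x : Alg R) = 0 := by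
      rw [← h1, ← KMData.proj_proj]
      exact (data R).proj_of_notMem ((data R).proj_mem_W 0 _) (by simpa [eq_comm] using hγ)
    rw [h1, h2, sub_zero]
    set u := (data R).proj {-γ} (x : Alg R)
    have huN : u ∈ N := (data R).proj_mem_of_stable hNh _ hxN
    have huW : u ∈ (data R).W (-γ) := (data R).proj_mem_W _ _
    have hus : u ∈ sharp R ι := by
      obtain ⟨z, -, hz⟩ := huN
      rw [← hz]; exact z.2
    by_cases hu0 : u = 0
    · rw [hu0]; simp
    have hdeg : chiDeg ι (-γ) = 0 := by
      by_contra h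
      have := (mem_sharp_iff R ι).1 hus
      rw [(data R).proj_of_notMem huW h] at this
      exact hu0 this.symm
    have hys : y ∈ sharp R ι := by
      rw [mem_sharp_iff]
      refine (data R).proj_of_mem hy ?_
      rw [mem_zeroSet, ← neg_eq_zero, ← map_neg, hdeg]
    have h3 := hF.lie_eq (-γ) (neg_ne_zero.2 hγ) u huW y (by rwa [neg_neg])
    by_contra hB
    have h4 : h R ((data R).nu d (-γ)) ∈ N := by
      have h5 : ⁅u, y⁆ ∈ N := by
        rw [← lie_skew]; exact neg_mem (hN y hys u huN)
      rw [h3] at h5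
      exact (Submodule.smul_mem_iff _ hB).1 h5
    refine hnu (-γ) hdeg ?_ (hNz _ h4)
    rcases (data R).W_sign huW with h | h | h | h
    · exact absurd h hu0
    · exact Or.inl h
    · exact absurd h (neg_ne_zero.2 hγ)
    · exact Or.inr h
  -- A kernel element thus lies in H and is killed by `t`. All α_{ι(j)} vanish on it, so it commutes
  -- with the generators of L♯(C').
  obtain ⟨y, hy⟩ := (data R).W_zero (h0 ▸ (data R).proj_mem_W 0 (x : Alg R))
  have hxy : x = (sharpData R ι hι).h y := Subtype.ext hy.symm
  have hty : t y = 0 := hker y (by rw [← hxy, hxq])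
  have hry : ∀ j, R.root (ι j) y = 0 := fun j => by rw [← ht2, hty, map_zero]
  rw [LieModule.mem_maxTrivSubmodule]
  intro z
  rw [hxy]
  have comm : ∀ z : sharp R ι, ⁅(sharpData R ι hι).h y, z⁆ = 0 := by
    intro z
    induction z using (sharpData R ι hι).gen_induction with
    | he j => rw [KMData.he]; change R.root (ι j) y • _ = _; rw [hry, zero_smul]
    | hf j => rw [KMData.hf]; change -(R.root (ι j) y • _) = _; rw [hry, zero_smul, neg_zero]
    | hh z => exact KMData.hh _ _ _
    | h0 => exact lie_zero _
    | hadd a b ha hb => rw [lie_add, ha, hb, add_zero]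
    | hsmul c a ha => rw [lie_smul, ha, smul_zero]
    | hlie a b ha hb => rw [leibniz_lie, ha, hb, zero_lie, lie_zero, add_zero]
  rw [← lie_skew, comm, neg_zero]

end Quotient

/-! ### Compatibility with cobrackets and with the projection of the Borel subalgebra -/

section Final

variable {k : Type*} [Field k] [CharZero k] {I J : Type*} [Fintype I] [Fintype J]
  {C : Matrix I I ℤ} {C' : Matrix J J ℤ}
  {H H' : Type*} [AddCommGroup H] [Module k H] [AddCommGroup H'] [Module k H']
  (R : RootDatum k C H) (R' : RootDatum k C' H')

/-- The standard Lie bialgebra structure, in terms of the invariant form. -/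
lemma exists_standard {d : I → k} {B : Alg R →ₗ[k] Alg R →ₗ[k] k} (hF : (data R).IsForm d B) :
    ∃ δ : Alg R →ₗ[k] Alg R ⊗[k] Alg R,
      (∀ u v x, tensorDual (B u) (B v) (δ x) = B ((data R).star u v) x) ∧
      IsStandardCobracket R d δ ∧ IsLieBialgebra δ := by
  obtain ⟨δ, hδ⟩ := hF.exists_cobracket
  have h1 := hF.isLieBialgebra hδ
  exact ⟨δ, hδ, ⟨hF.cobracket_e hδ, hF.cobracket_f hδ, hF.cobracket_h hδ, h1.cocycle⟩, h1⟩

lemma map_wedge {V W : Type*} [AddCommGroup V] [Module k V] [AddCommGroup W] [Module k W]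
    (f : V →ₗ[k] W) (a b : V) : TensorProduct.map f f (wedge a b) = wedge (f a) (f b) := by
  simp [wedge]

/-- The projection of `L♯(C')` onto `L(C')` is compatible with the cobrackets. -/
lemma isCobracketHom_sharp {ι : J → I} (hι : Function.Injective ι) {t : H →ₗ[k] H'}
    (ht1 : ∀ j, t (R.coroot (ι j)) = R'.coroot j) {d : I → k}
    {δ : Alg R →ₗ[k] Alg R ⊗[k] Alg R} {δ' : Alg R' →ₗ[k] Alg R' ⊗[k] Alg R'}
    (hδ : IsStandardCobracket R d δ) (hδ' : IsStandardCobracket R' (fun j => d (ι j)) δ')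
    {j₀ : Alg R →ₗ[k] sharp R ι} (hj : ∀ x : sharp R ι, j₀ x = x)
    {q : sharp R ι →ₗ⁅k⁆ Alg R'}
    (hqe : ∀ j, q ((sharpData R ι hι).e j) = e R' j)
    (hqf : ∀ j, q ((sharpData R ι hι).f j) = f R' j)
    (hqh : ∀ x, q ((sharpData R ι hι).h x) = h R' (t x))
    (hs : IsLieBialgebra (TensorProduct.map j₀ j₀ ∘ₗ δ ∘ₗ (sharp R ι).toSubmodule.subtype)) :
    IsCobracketHom (TensorProduct.map j₀ j₀ ∘ₗ δ ∘ₗ (sharp R ι).toSubmodule.subtype) δ'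
      (q : sharp R ι →ₗ[k] Alg R') := by
  have hg : ∀ (x y : sharp R ι) (c : k), δ x = c • wedge (x : Alg R) y →
      TensorProduct.map (q : sharp R ι →ₗ[k] Alg R') (q : sharp R ι →ₗ[k] Alg R')
        ((TensorProduct.map j₀ j₀ ∘ₗ δ ∘ₗ (sharp R ι).toSubmodule.subtype) x)
      = c • wedge (q x) (q y) := by
    intro x y c hxy
    change TensorProduct.map _ _ (TensorProduct.map j₀ j₀ (δ x)) = _
    rw [hxy, map_smul, map_wedge, hj, hj, map_smul, map_wedge]
    rfl
  intro ξ
  change _ = δ' (q ξ)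
  induction ξ using (sharpData R ι hι).gen_induction with
  | he j =>
    rw [hg _ ((sharpData R ι hι).h (R.coroot (ι j))) _ (hδ.on_e (ι j)), hqe, hqh, ht1, hδ'.on_e]
  | hf j =>
    rw [hg _ ((sharpData R ι hι).h (R.coroot (ι j))) _ (hδ.on_f (ι j)), hqf, hqh, ht1, hδ'.on_f]
  | hh y =>
    rw [hqh, hδ'.on_h]
    change TensorProduct.map _ _ (TensorProduct.map j₀ j₀ (δ (h R y))) = _
    rw [hδ.on_h, map_zero, map_zero]
  | h0 => simp
  | hadd a b ha hb => rw [map_add, map_add, ha, hb, map_add, map_add]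
  | hsmul c a ha => rw [map_smul, map_smul, ha, map_smul, map_smul]
  | hlie a b ha hb =>
    rw [hs.cocycle, map_sub, map_lie_tensor _ (fun x y => LieHom.map_lie q x y),
      map_lie_tensor _ (fun x y => LieHom.map_lie q x y), ha, hb, LieHom.map_lie, hδ'.cocycle]
    rfl

/-- The braided-Lie bialgebra `b` is the kernel of the projection of `B⁻(C)`. -/
lemma isKernelBraided (ι : J → I) {d : I → k} {B : Alg R →ₗ[k] Alg R →ₗ[k] k}
    (hF : (data R).IsForm d B) {δ : Alg R →ₗ[k] Alg R ⊗[k] Alg R}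
    (hδ : ∀ u v x, tensorDual (B u) (B v) (δ x) = B ((data R).star u v) x)
    {j₀ : Alg R →ₗ[k] sharp R ι}
    (S₀ : (data R).Slice (zeroSet (chiDeg ι)) (sharp R ι).toSubmodule.subtype j₀)
    {j : Alg R →ₗ[k] bSpace R ι} (S : (data R).Slice (negSet (chiDeg ι)) (bIncl R ι) j)
    {jB : Alg R →ₗ[k] borel R}
    (SB : (data R).Slice {γ | γ ≤ 0} (borel R).toSubmodule.subtype jB)
    {δB : borel R →ₗ[k] borel R ⊗[k] borel R} (hδB : IsRestrictedCobracket δ (borel R) δB)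
    {π : borel R →ₗ[k] borel R}
    (hπ : ∀ x, (π x : Alg R) = (data R).proj (zeroSet (chiDeg ι)) x)
    (hker : LinearMap.ker π = bSpace R ι)
    {r : (I →₀ ℕ) → sharp R ι ⊗[k] sharp R ι}
    (hr : IsRFamily (data R) (chiDeg ι) B (sharp R ι).toSubmodule.subtype r)
    (hom : ∀ β, r β ∈ LinearMap.range (TensorProduct.map
      (((data R).W (toInt β)).comap (sharp R ι).toSubmodule.subtype).subtype
      (((data R).W (-toInt β)).comap (sharp R ι).toSubmodule.subtype).subtype))
    {b : BraidedLieBialgebra r (bSpace R ι)}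
    (hb : IsInduced 1 δ (sharp R ι).toSubmodule.subtype (bIncl R ι) j b) :
    IsKernelBraided R ι δB π b where
  ker_eq := hker
  br_eq x y := by rw [hb.br, one_smul]
  act_eq ξ x := hb.act ξ x
  cobr_eq x := by
    have hω := chiDeg_nonneg ι
    refine tensor_ext (SB.pull_sep hF) (SB.pull_sep hF) fun u v => ?_
    rw [← tensorDual_map_pull, ← tensorDual_map_pull]
    have h1 : ∀ y : borel R, (data R).proj (posSet (chiDeg ι)) (y : Alg R) = 0 := fun y => by
      refine (data R).proj_disjoint (Set.disjoint_left.2 fun a (h1 : a ≤ 0) h2 => ?_)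
        ((mem_borel_iff R).1 y.2)
      have := hω (-a) (neg_nonneg.2 h1)
      rw [map_neg] at this
      rw [mem_posSet] at h2; omega
    have h2 : (borel R).toSubmodule.subtype ∘ₗ (LinearMap.id - π)
        = (data R).proj (negSet (chiDeg ι)) ∘ₗ (borel R).toSubmodule.subtype := by
      ext y
      change (y : Alg R) - (π y : Alg R) = (data R).proj (negSet (chiDeg ι)) (y : Alg R)
      rw [hπ, sub_eq_iff_eq_add]
      have := (data R).proj_parts (ω := chiDeg ι) (y : Alg R)
      rw [h1, add_zero] at this
      exact this.symm
    have hR : TensorProduct.map (borel R).toSubmodule.subtype (borel R).toSubmodule.subtype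
        (TensorProduct.map (LinearMap.id - π) (LinearMap.id - π) (δB x))
        = TensorProduct.map ((data R).proj (negSet (chiDeg ι)))
          ((data R).proj (negSet (chiDeg ι))) (δ (x : borel R)) := by
      rw [← LinearMap.comp_apply, ← TensorProduct.map_comp, h2, TensorProduct.map_comp,
        LinearMap.comp_apply, hδB x]
    have hL : TensorProduct.map (borel R).toSubmodule.subtype (borel R).toSubmodule.subtype
        (TensorProduct.map (bSpace R ι).subtype (bSpace R ι).subtype (b.cobr x))
        = TensorProduct.map (bIncl R ι) (bIncl R ι) (b.cobr x) := by
      rw [← LinearMap.comp_apply, ← TensorProduct.map_comp]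
      rfl
    rw [hR, hL, tensorDual_map_pull, hF.neg_cobr_pairing hω S hb hδ, tensorDual_map]
    have h3 : ∀ u, B u ∘ₗ (data R).proj (negSet (chiDeg ι))
        = B ((data R).proj (posSet (chiDeg ι)) u) := by
      intro u
      ext y
      rw [LinearMap.comp_apply, hF.proj_adjoint, neg_posSet]
    rw [h3, h3, hδ, KMData.star_of_pos hω ((data R).proj_idem _ _) ((data R).proj_idem _ _)]
    rw [map_neg, LinearMap.neg_apply]
    rfl
  coaction_eq x := by
    have hω := chiDeg_nonneg ι
    refine hF.pair_ext fun u v => ?_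
    rw [tensorDual_map_pull, hF.finsum_actLeft hω hr S₀ hom S hb]
    have h2 : (borel R).toSubmodule.subtype ∘ₗ π
        = (data R).proj (zeroSet (chiDeg ι)) ∘ₗ (borel R).toSubmodule.subtype := by
      ext y; exact hπ y
    have h3 : B u ∘ₗ (data R).proj (zeroSet (chiDeg ι))
        = B ((data R).proj (zeroSet (chiDeg ι)) u) := by
      ext y
      rw [LinearMap.comp_apply, hF.proj_adjoint, neg_zeroSet]
    rw [h2, tensorDual_map, ← LinearMap.comp_assoc, h3, ← tensorDual_map, hδB x, hδ]
    change _ = B _ (bIncl R ι x)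
    -- With `u` projected to degree zero, the term with two positive parts vanishes, and the last
    -- term pairs negative degree with degree zero. Only the coaction term is left.
    rw [hF.star_apply_neg hω (S.proj_i x), KMData.proj_idem,
      (data R).proj_disjoint (A := zeroSet (chiDeg ι)) (A' := posSet (chiDeg ι))
        (Set.disjoint_left.2 fun a h1 h2 => (mem_posSet.1 h2).ne' h1) ((data R).proj_idem _ _)]
    have h4 : (data R).proj (negSet (chiDeg ι))
        ⁅bIncl R ι x, (data R).proj (zeroSet (chiDeg ι)) u⁆
        = ⁅bIncl R ι x, (data R).proj (zeroSet (chiDeg ι)) u⁆ :=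
      (data R).proj_lie (fun a ha b hb => by
        rw [mem_negSet] at *; rw [mem_zeroSet] at hb; rw [map_add]; omega)
        (S.proj_i x) ((data R).proj_idem _ _)
    have h5 : (data R).proj (posSet (chiDeg ι))
        ((data R).T ((data R).proj (zeroSet (chiDeg ι)) v)) = 0 :=
      (data R).proj_disjoint (A := zeroSet (chiDeg ι))
        (Set.disjoint_left.2 fun a h1 h2 => (mem_posSet.1 h2).ne' h1)
        (by rw [← KMData.T_proj, KMData.proj_idem])
    rw [← h4, hF.proj_adjoint, neg_negSet, h5]
    simp

lemma exists_sharp_slice (ι : J → I) : ∃ j₀ : Alg R →ₗ[k] sharp R ι,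
    (data R).Slice (V := sharp R ι) (zeroSet (chiDeg ι)) (sharp R ι).toSubmodule.subtype j₀ :=
  KMData.exists_slice (V := sharp R ι) Subtype.val_injective (fun y => by
    rw [← mem_sharp_iff]
    exact ⟨by rintro ⟨x, rfl⟩; exact x.2, fun hy => ⟨⟨y, hy⟩, rfl⟩⟩)

lemma exists_borel_slice : ∃ j₀ : Alg R →ₗ[k] borel R,
    (data R).Slice (V := borel R) {γ | γ ≤ 0} (borel R).toSubmodule.subtype j₀ :=
  KMData.exists_slice (V := borel R) Subtype.val_injective (fun y => by
    rw [← mem_borel_iff]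
    exact ⟨by rintro ⟨x, rfl⟩; exact x.2, fun hy => ⟨⟨y, hy⟩, rfl⟩⟩)

/-- The graded dual of `b` is identified by the form with the part of positive degree. -/
lemma exists_bDual_slice (ι : J → I) {d : I → k} {B : Alg R →ₗ[k] Alg R →ₗ[k] k}
    (hF : (data R).IsForm d B) {j : Alg R →ₗ[k] bSpace R ι}
    (S : (data R).Slice (negSet (chiDeg ι)) (bIncl R ι) j) :
    ∃ (i' : bDual R ι →ₗ[k] Alg R) (j' : Alg R →ₗ[k] bDual R ι),
      (data R).Slice (V := bDual R ι) (posSet (chiDeg ι)) i' j' ∧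
      ∀ φ x, evalPairing R ι φ x = B (i' φ) (bIncl R ι x) := by
  have := R.finite
  have key : ∀ 𝒜 : (I →₀ ℤ) → Submodule k (bSpace R ι),
      𝒜 = (fun γ => ((data R).W γ).comap (bIncl R ι)) →
      ∃ (i' : gradedDual 𝒜 →ₗ[k] Alg R) (j' : Alg R →ₗ[k] gradedDual 𝒜),
        (data R).Slice (V := gradedDual 𝒜) (posSet (chiDeg ι)) i' j' ∧
        ∀ (φ : gradedDual 𝒜) x, (φ : Module.Dual k (bSpace R ι)) x = B (i' φ) (bIncl R ι x) := by
    rintro _ rfl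
    exact hF.exists_dual_slice S
  exact key (bGrading R ι) rfl

end Final

end KacMoody

end

/-! ### The theorem -/

set_option maxHeartbeats 2000000 in
theorem proposition3p6 {k : Type*} [Field k] [IsAlgClosed k] [CharZero k]
    {I J : Type*} [Fintype I] [DecidableEq I] [Fintype J]
    {C : Matrix I I ℤ} {C' : Matrix J J ℤ}
    {H H' : Type*} [AddCommGroup H] [Module k H] [AddCommGroup H'] [Module k H']
    (R : KacMoody.RootDatum k C H) (R' : KacMoody.RootDatum k C' H') (ι : J → I)
    (hsub : KacMoody.IsSubRootDatum R' R ι)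
    (d : I → k) (hd : KacMoody.IsSymmetrizer C d) :
    -- the Kac–Moody bialgebras `L(C)` and `L(C')`
    ∃ (δ : KacMoody.Alg R →ₗ[k] KacMoody.Alg R ⊗[k] KacMoody.Alg R)
      (δ' : KacMoody.Alg R' →ₗ[k] KacMoody.Alg R' ⊗[k] KacMoody.Alg R'),
      KacMoody.IsStandardCobracket R d δ ∧ LieBi.IsLieBialgebra δ ∧
      KacMoody.IsStandardCobracket R' (fun j => d (ι j)) δ' ∧ LieBi.IsLieBialgebra δ' ∧
    -- `L♯(C')` is the degree-0 part of `L(C)`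
    DirectSum.IsInternal (KacMoody.zGrading R ι) ∧
    KacMoody.zGrading R ι 0 = (KacMoody.sharp R ι).toSubmodule ∧
    -- it is a Lie sub-bialgebra of `L(C)` and a central extension of `L(C')`
    ∃ δs : KacMoody.sharp R ι →ₗ[k] KacMoody.sharp R ι ⊗[k] KacMoody.sharp R ι,
      LieBi.IsRestrictedCobracket δ (KacMoody.sharp R ι) δs ∧
      (∃ q : KacMoody.sharp R ι →ₗ⁅k⁆ KacMoody.Alg R', Function.Surjective q ∧
        q.ker ≤ LieAlgebra.center k (KacMoody.sharp R ι) ∧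
        (∀ (ξ : KacMoody.sharp R ι) (j : J), (ξ : KacMoody.Alg R) = KacMoody.e R (ι j) →
          q ξ = KacMoody.e R' j) ∧
        (∀ (ξ : KacMoody.sharp R ι) (j : J), (ξ : KacMoody.Alg R) = KacMoody.f R (ι j) →
          q ξ = KacMoody.f R' j) ∧
        LieBi.IsCobracketHom δs δ' (q : KacMoody.sharp R ι →ₗ[k] KacMoody.Alg R')) ∧
    -- the split projection of `B⁻(C)` onto its degree-0 part
    DirectSum.IsInternal (KacMoody.nGrading R ι) ∧
    ∃ (δB : KacMoody.borel R →ₗ[k] KacMoody.borel R ⊗[k] KacMoody.borel R)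
      (π : KacMoody.borel R →ₗ[k] KacMoody.borel R),
      LieBi.IsRestrictedCobracket δ (KacMoody.borel R) δB ∧
      LieBi.IsDegreeZeroProjection (KacMoody.nGrading R ι) π ∧
    -- `L♯(C')` is formally quasitriangular
    ∃ r : (I →₀ ℕ) → KacMoody.sharp R ι ⊗[k] KacMoody.sharp R ι,
      LieBi.IsFormallyQuasitriangular (KacMoody.sharpGrading R ι) δs r ∧
    -- `b` and its graded dual are dually paired braided-Lie bialgebras of `L♯(C')`-modules
    ∃ (b : LieBi.BraidedLieBialgebra r (KacMoody.bSpace R ι))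
      (c : LieBi.BraidedLieBialgebra r (KacMoody.bDual R ι)),
      KacMoody.IsKernelBraided R ι δB π b ∧
      DirectSum.IsInternal (KacMoody.bGrading R ι) ∧
      (∀ γ, Module.Finite k (KacMoody.bGrading R ι γ)) ∧
      LieBi.IsDuallyPaired b c (KacMoody.evalPairing R ι) ∧
    -- `L(C)` is their double-bosonisation, compatibly with the inclusions and the grading
    ∃ Φ : (KacMoody.bSpace R ι × KacMoody.sharp R ι × KacMoody.bDual R ι) ≃ₗ[k] KacMoody.Alg R,
      LieBi.IsDoubleBosonisationIso δs b c (KacMoody.evalPairing R ι) δ Φ ∧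
      (∀ x, Φ (x, 0, 0) = KacMoody.bIncl R ι x) ∧
      (∀ ξ, Φ (0, ξ, 0) = (ξ : KacMoody.Alg R)) ∧
      (∀ y : KacMoody.Alg R, (∃ x, Φ (x, 0, 0) = y) ↔
        y ∈ ⨆ (n : ℤ) (_ : n < 0), KacMoody.zGrading R ι n) ∧
      (∀ y : KacMoody.Alg R, (∃ φ, Φ (0, 0, φ) = y) ↔
        y ∈ ⨆ (n : ℤ) (_ : 0 < n), KacMoody.zGrading R ι n) := by
  classical
  have := R.finite
  have hd' : KacMoody.IsSymmetrizer C' (fun j => d (ι j)) :=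
    ⟨fun j => hd.ne_zero _, fun i j => by rw [hsub.submatrix, hsub.submatrix, hd.symm]⟩
  obtain ⟨B, hF⟩ := KacMoody.exists_isForm R hd
  obtain ⟨B', hF'⟩ := KacMoody.exists_isForm R' hd'
  obtain ⟨δ, hδ, hst, hbi⟩ := KacMoody.exists_standard R hF
  obtain ⟨δ', -, hst', hbi'⟩ := KacMoody.exists_standard R' hF'
  have hω := KacMoody.chiDeg_nonneg ι
  obtain ⟨t, ht, ht1, ht2⟩ := hsub.exists_retraction
  have hi₀ : ∀ x y : KacMoody.sharp R ι, (KacMoody.sharp R ι).toSubmodule.subtype ⁅x, y⁆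
      = ⁅(KacMoody.sharp R ι).toSubmodule.subtype x,
        (KacMoody.sharp R ι).toSubmodule.subtype y⁆ := fun _ _ => rfl
  obtain ⟨j₀, S₀⟩ := KacMoody.exists_sharp_slice R ι
  obtain ⟨jB, SB⟩ := KacMoody.exists_borel_slice R
  obtain ⟨j, S⟩ := KacMoody.KMData.exists_slice (D := KacMoody.data R)
    (A := KacMoody.negSet (KacMoody.chiDeg ι)) (i := KacMoody.bIncl R ι)
    (KacMoody.bIncl_injective R ι) (fun y => KacMoody.exists_bIncl_iff R ι)
  obtain ⟨i', j', S', hp⟩ := KacMoody.exists_bDual_slice R ι hF S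
  have hA : ∀ x, (KacMoody.data R).proj (KacMoody.zeroSet (KacMoody.chiDeg ι)) x = x → ∀ u v,
      B ((KacMoody.data R).star
        ((KacMoody.data R).proj (-KacMoody.zeroSet (KacMoody.chiDeg ι)) u)
        ((KacMoody.data R).proj (-KacMoody.zeroSet (KacMoody.chiDeg ι)) v)) x
        = B ((KacMoody.data R).star u v) x := fun x hx u v => by
    rw [KacMoody.neg_zeroSet, hF.star_proj_zeroSet hω hx]
  have hAB : ∀ x, (KacMoody.data R).proj {γ | γ ≤ 0} x = x → ∀ u v,
      B ((KacMoody.data R).star ((KacMoody.data R).proj (-{γ | γ ≤ 0}) u)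
        ((KacMoody.data R).proj (-{γ | γ ≤ 0}) v)) x
        = B ((KacMoody.data R).star u v) x := fun x hx u v => by
    rw [show -{γ : I →₀ ℤ | γ ≤ 0} = {γ | 0 ≤ γ} by ext γ; simp, hF.star_proj_nonpos hx]
  -- The scalar is 1/2 for β = 0 and 1 otherwise, so `r` is half the Casimir element on H plus the
  -- canonical elements of the positive root spaces of L♯(C').
  have hr := fun β : I →₀ ℕ => hF.exists_component S₀ (LieBi.toInt β) (KacMoody.KMData.wT k (LieBi.toInt β))
  choose r hr hom using hr
  obtain ⟨q, hq, hqe, hqf, hqh⟩ := KacMoody.exists_sharp_hom R R' hsub.injective ht1 ht2 ht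
  have hquasi := hF.isFormallyQuasitriangular hr hω S₀ hi₀ hom hδ
  obtain ⟨b, hb1, hb2, hb3⟩ := hF.exists_braided hω hr S₀ hom hi₀ S (ε := 1)
    (Or.inl ⟨rfl, rfl⟩) hδ
  -- The sign makes the bracket of the dual the opposite of that of `L`, as its appearance with
  -- opposite bracket in the double-bosonisation requires.
  obtain ⟨c, hc1, hc2, hc3⟩ := hF.exists_braided hω hr S₀ hom hi₀ S' (ε := -1)
    (Or.inr ⟨rfl, rfl⟩) hδ
  have hb : KacMoody.IsInduced 1 δ (KacMoody.sharp R ι).toSubmodule.subtype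
    (KacMoody.bIncl R ι) j b := ⟨hb1, hb2, hb3⟩
  have hc : KacMoody.IsInduced (-1) δ (KacMoody.sharp R ι).toSubmodule.subtype i' j' c :=
    ⟨hc1, hc2, hc3⟩
  obtain ⟨π, hπ, hπ0, hker⟩ := KacMoody.exists_borelProj R ι
  obtain ⟨Φ, hΦ⟩ := KacMoody.KMData.IsForm.exists_doubleEquiv S₀ S S'
  have hδB : LieBi.IsRestrictedCobracket δ (KacMoody.borel R)
      (TensorProduct.map jB jB ∘ₗ δ ∘ₗ (KacMoody.borel R).toSubmodule.subtype) :=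
    fun x => hF.restricted_map SB hδ hAB x
  refine ⟨δ, δ', hst, hbi, hst', hbi', KacMoody.zGrading_internal R ι, KacMoody.zGrading_zero R ι,
    _, fun x => hF.restricted_map S₀ hδ hA x, ⟨q, hq,
      KacMoody.ker_le_center R R' hsub.injective ht1 ht2 hd.ne_zero hF q hqh, ?_, ?_,
      KacMoody.isCobracketHom_sharp R R' hsub.injective ht1 hst hst' S₀.j_i hqe hqf hqh
        hquasi.isLieBialgebra⟩,
    KacMoody.nGrading_internal R ι, _, π, hδB, hπ0, r, hquasi, b, c,
    KacMoody.isKernelBraided R ι hF hδ S₀ S SB hδB hπ hker hr hom hb, S.internal, S.finite,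
    hF.isDuallyPaired hω S S' hb hc hp hδ, Φ,
    hF.isDoubleBosonisationIso hω hr S₀ hom S S' hb hc hp hδ hi₀ hΦ, ?_, ?_, ?_, ?_⟩
  · intro ξ m hξ
    rw [← hqe m]; exact congrArg q (Subtype.ext hξ)
  · intro ξ m hξ
    rw [← hqf m]; exact congrArg q (Subtype.ext hξ)
  · intro x; rw [hΦ, map_zero, map_zero, add_zero, add_zero]
  · intro ξ; rw [hΦ, map_zero, map_zero, add_zero, zero_add]; rfl
  · intro y
    rw [KacMoody.mem_iSup_zGrading]
    refine Iff.trans ?_ (KacMoody.exists_bIncl_iff R ι)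
    exact exists_congr fun x => by rw [hΦ, map_zero, map_zero, add_zero, add_zero]
  · intro y
    rw [KacMoody.mem_iSup_zGrading]
    refine Iff.trans ?_ (S'.exists_iff y)
    exact exists_congr fun x => by rw [hΦ, map_zero, map_zero, add_zero, zero_add]
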